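/- **Setting.** Let $G$ be a finite group (non-abelian in the case of interest) with commutator subgroup $[G,G]$. A *Max-TSA instance* $\Phi$ consists of $n$ Boolean variables and $m$ constraints; the $i$-th constraint has an ordered tuple of five distinct variables as its scope and a bit $b_i$, and requires $\mathrm{tsa}(x_1,\dots,x_5):=x_1+x_2+x_3+x_4x_5=b_i \pmod 2$. For integers $1<t<r$, the *$(r,t)$-smooth UFG Label Cover* $\Lambda=\Lambda_{r,t}(\Phi)$ obtained from $\Phi$ by parallel repetition is the following. A verifier picks uniformly and independently $r$ constraints $w=(i_1,\dots,i_r)\in[m]^r$, a $t$-element set $T$ of the $r$ positions, and one of the five variables of each constraint in a position of $T$. The vertices in $W$ are the tuples $w$; the vertices in $V$ are the tuples $v$ consisting of the $t$ chosen variables and the $r-t$ constraints in the positions outside $T$ (both in the order of the positions). The edges are the choices of the verifier, each joining its $v$ and its $w$ (parallel edges are allowed). The label set of $W$ is $\mathcal R=(\{0,1\}^5)^r$, the assignments to the $5r$ variables; the label set of $V$ is $\mathcal L=\{0,1\}^t\times(\{0,1\}^5)^{r-t}$; the projection $\pi_e:\mathcal R\to\mathcal L$ of an edge $e$ keeps the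 values that the vertex $v$ of $e$ asks for. Further $p_j:\mathcal R\to\{0,1\}$, $p_j(a)=\mathrm{tsa}(a_j)$ for $j\in[r]$, and $I_w(j)=i_j$. An edge $e=(v,w)$ is satisfied by $\sigma=(\sigma_V,\sigma_W)$, $\sigma_V:V\to\mathcal L$, $\sigma_W:W\to\mathcal R$, if $\pi_e(\sigma_W(w))=\sigma_V(v)$ and $p_j(\sigma_W(w))=b_{I_w(j)}$ for all $j\in[r]$. $\mathrm{Opt}(\Lambda)$ is the maximal fraction of satisfied edges. Write $E_w$ for the set of edges incident to $w\in W$. For $d_0\in(0,1/3)$, call $\Lambda$ *$d_0$-smooth* if $$\Pr_{e\in E_w}\bigl[\,|\pi_e(S)|<|S|^{d_0}\,\bigr]\le |S|^{-d_0}\qquad\text{for all } w\in W \text{ and all non-empty } S\subseteq \mathcal R .$$ *The noiseless test.* On $G^{\mathcal R}$ let $\mathbf x\sim\mathbf y$ if for some $F:\{0,1\}^r\to G$ we have $x_a=F(p_1(a),\dots,p_r(a))\,y_a$ for all $a\in\mathcal R$; on $G^{\mathcal L}$ let $\mathbf x\sim\mathbf y$ if $\mathbf x=\mathbf y c$ (coordinatewise)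 for some $c\in G$. Fix a representative $\bar{\mathbf x}$ of every class. The Max-3-Lin instance $I$ over $G$ (variables with values in $G$, constraints $x_{i_1}x_{i_2}x_{i_3}=g$ with $g\in G$) has the variables $f^F_w(\bar{\mathbf x})$ and $f_w(\mathbf z)$ for $w\in W$, and $f^F_v(\bar{\mathbf y})$ for $v\in V$. Its constraints are produced by sampling uniformly an edge $e=(v,w)$, $\mathbf y\in G^{\mathcal L}$ and $\mathbf x\in G^{\mathcal R}$, setting $z_a=x_a^{-1}\,y_{\pi_e(a)}^{-1}$ for $a\in\mathcal R$, and testing $f^F_w(\mathbf x)\,f_w(\mathbf z)\,f^F_v(\mathbf y)=1$, where $f_w^F(\mathbf x)$ stands for $F(b_{I_w(1)},\dots,b_{I_w(r)})\,f^F_w(\bar{\mathbf x})$ if $x_a=F(p_1(a),\dots,p_r(a))\,\bar x_a$ for all $a$, and $f^F_v(\mathbf y)$ stands for $f^F_v(\bar{\mathbf y})\,c$ if $\mathbf y=\bar{\mathbf y}c$; that is, the constraint is $$f^F_w(\bar{\mathbf x})\,f_w(\mathbf z)\,f^F_v(\bar{\mathbf y})=F(b_{I_w(1)},\dots,b_{I_w(r)})^{-1}c^{-1}.$$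 $\mathrm{Opt}(I)$ is the maximal probability, over all assignments to the variables, that the sampled constraint is satisfied. **Theorem.** 1. There is a constant $d_0\in(0,1/3)$ such that for every $t>1$ and all sufficiently large $r$ (depending only on $t$), $\Lambda_{r,t}(\Phi)$ is $d_0$-smooth for every Max-TSA instance $\Phi$. 2. Let $d_0\in(0,1/3)$, let $\delta>0$, and let $C>0$ be a real constant with $C^{-d_0/2}\le \frac{\delta^2}{12|G|^6}$. Let $1<t<r$, and let $\Phi$ be a Max-TSA instance such that $\Lambda=\Lambda_{r,t}(\Phi)$ is $d_0$-smooth and $$\frac tr\le\frac{\delta^2}{8\,|G|^{6+C}\,C^2}.$$ Let $I$ be the Max-3-Lin instance over $G$ that the noiseless test produces from $\Lambda$. Then - *Completeness:* if $\mathrm{Opt}(\Lambda)=1$, then $\mathrm{Opt}(I)=1$. - *Soundness:* if $\mathrm{Opt}(\Lambda)\le\frac{\delta^4}{257\,|G|^{12+2C}}\,C^{-1}$, then $\mathrm{Opt}(I)\le\frac1{|[G,G]|}+\delta$. -/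

import Mathlib

/-- The probability that `P ω` holds for `ω` uniform in the finite type `Ω`, i.e. the fraction of
elements of `Ω` with property `P` (and `0` if `Ω` is empty). -/
noncomputable def uniformProb {Ω : Type*} (P : Ω → Prop) : ℝ :=
  (Nat.card {ω : Ω // P ω} : ℝ) / (Nat.card Ω : ℝ)

/-! ### Max-TSA -/

/-- A Max-TSA instance: `m` constraints on `n` Boolean variables; constraint `i` has as scope an
ordered tuple of five distinct variables and requires `x₁ + x₂ + x₃ + x₄ * x₅ = b i` modulo two. -/
structure MaxTSA where
  n : ℕ
  m : ℕ
  scope : Fin m → (Fin 5 ↪ Fin n)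
  b : Fin m → ZMod 2

/-- The left-hand side of a TSA constraint. -/
def tsa (x : Fin 5 → ZMod 2) : ZMod 2 := x 0 + x 1 + x 2 + x 3 * x 4

/-! ### UFG Label Cover -/

/-- A Label Cover instance with vertex sets `V`, `W`, alphabets `L`, `R` and a projection
`R → L` on every edge.  Edges are an indexed family: parallel edges, possibly with different
projections, are allowed. -/
structure LabelCover (V W E L R : Type*) where
  left : E → V
  right : E → W
  proj : E → R → L

/-- A UFG Label Cover instance: a Label Cover instance together with functions
`p 1, …, p r : R → {0,1}`, a vector `b ∈ {0,1}^m` and index maps `I w : [r] → [m]`. -/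
structure UFGLabelCover (V W E L R : Type*) (r m : ℕ) extends LabelCover V W E L R where
  p : Fin r → R → ZMod 2
  b : Fin m → ZMod 2
  I : W → Fin r → Fin m

namespace UFGLabelCover

variable {V W E L R : Type*} {r m : ℕ}

/-- The edge `e` is satisfied by the assignment `(σL, σR)`. -/
def Satisfies (Λ : UFGLabelCover V W E L R r m) (σL : V → L) (σR : W → R) (e : E) : Prop :=
  Λ.proj e (σR (Λ.right e)) = σL (Λ.left e) ∧
    ∀ i : Fin r, Λ.p i (σR (Λ.right e)) = Λ.b (Λ.I (Λ.right e) i)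

/-- The fraction of satisfied edges. -/
noncomputable def val (Λ : UFGLabelCover V W E L R r m) (σ : (V → L) × (W → R)) : ℝ :=
  uniformProb fun e : E => Λ.Satisfies σ.1 σ.2 e

/-- The largest fraction of edges that an assignment satisfies. -/
noncomputable def opt (Λ : UFGLabelCover V W E L R r m) : ℝ :=
  ⨆ σ : (V → L) × (W → R), Λ.val σ

/-- `Pr_{e ∈ E_w} [|π_e(S)| < |S|^d₀] ≤ 1 / |S|^d₀` for all `w ∈ W` and `S ⊆ R`, where `E_w` is the
set of edges incident to `w`. -/
def IsSmooth (Λ : UFGLabelCover V W E L R r m) (d₀ : ℝ) : Prop :=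
  ∀ (w : W) (S : Set R),
    uniformProb (fun e : {e : E // Λ.right e = w} =>
      ((Λ.proj e.1 '' S).ncard : ℝ) < (S.ncard : ℝ) ^ d₀) ≤ 1 / (S.ncard : ℝ) ^ d₀

end UFGLabelCover

/-! ### Smooth parallel repetition of Max-TSA -/

namespace MaxTSA

/-- What the first prover receives: an ordered tuple of `r` constraints. -/
abbrev RepW (Φ : MaxTSA) (r : ℕ) : Type := Fin r → Fin Φ.m

/-- What the second prover receives: `t` variables and `r - t` constraints. -/
abbrev RepV (Φ : MaxTSA) (r t : ℕ) : Type := (Fin t → Fin Φ.n) × (Fin (r - t) → Fin Φ.m)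

/-- The choices of the verifier, made uniformly at random: `r` constraints, which `t` of these `r`
are replaced by variables, and which one of the five variables is taken from each of these `t`. -/
abbrev RepE (Φ : MaxTSA) (r t : ℕ) : Type :=
  (Fin r → Fin Φ.m) × {T : Finset (Fin r) // T.card = t} × (Fin t → Fin 5)

/-- The answers of the first prover: assignments to the `5r` variables. -/
abbrev RepAnsR (r : ℕ) : Type := Fin r → Fin 5 → ZMod 2

/-- The answers of the second prover: values of the `t` variables, and assignments to the
variables of the `r - t` constraints. -/
abbrev RepAnsL (r t : ℕ) : Type := (Fin t → ZMod 2) × (Fin (r - t) → Fin 5 → ZMod 2)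

theorem card_compl_of_card {r t : ℕ} (T : {T : Finset (Fin r) // T.card = t}) :
    ((T.1)ᶜ).card = r - t := by
  rw [Finset.card_compl, T.2, Fintype.card_fin]

/-- The `k`-th selected position, in increasing order. -/
def selected {r t : ℕ} (T : {T : Finset (Fin r) // T.card = t}) : Fin t ↪o Fin r :=
  (T.1).orderEmbOfFin T.2

/-- The `k`-th position that is not selected, in increasing order. -/
def unselected {r t : ℕ} (T : {T : Finset (Fin r) // T.card = t}) : Fin (r - t) ↪o Fin r :=
  ((T.1)ᶜ).orderEmbOfFin (card_compl_of_card T)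

/-- The `(r, t)`-smooth UFG Label Cover obtained by parallel repetition of the Max-TSA instance
`Φ`. -/
def smoothRepetition (Φ : MaxTSA) (r t : ℕ) :
    UFGLabelCover (Φ.RepV r t) (Φ.RepW r) (Φ.RepE r t) (RepAnsL r t) (RepAnsR r) r Φ.m where
  left e :=
    (fun k => Φ.scope (e.1 (selected e.2.1 k)) (e.2.2 k), fun k => e.1 (unselected e.2.1 k))
  right e := e.1
  proj e a := (fun k => a (selected e.2.1 k) (e.2.2 k), fun k => a (unselected e.2.1 k))
  p i a := tsa (a i)
  b := Φ.b
  I w := w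

end MaxTSA

/-! ### Max-3-Lin -/

/-- A Max-3-Lin instance over `G` with variables `X` and constraints indexed by `ι`; constraint `i`
reads `x_{i₁} * x_{i₂} * x_{i₃} = c_i`, where `scope i = (i₁, i₂, i₃)` consists of distinct
variables. -/
structure MaxThreeLin (G X ι : Type*) where
  scope : ι → (Fin 3 ↪ X)
  rhs : ι → G

namespace MaxThreeLin

variable {G X ι : Type*} [Group G]

/-- The fraction of constraints that the assignment `σ` satisfies. -/
noncomputable def val (J : MaxThreeLin G X ι) (σ : X → G) : ℝ :=
  uniformProb fun i : ι =>
    σ (J.scope i 0) * σ (J.scope i 1) * σ (J.scope i 2) = J.rhs i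

/-- The largest fraction of constraints that an assignment satisfies. -/
noncomputable def opt (J : MaxThreeLin G X ι) : ℝ := ⨆ σ : X → G, J.val σ

end MaxThreeLin

/-! ### Folding -/

/-- The equivalence relation of functional folding: `x ∼ y` iff for some `F : {0,1}^r → G` we have
`x_d = F(p₁(d), …, p_r(d)) y_d` for all `d`. -/
def functionalFolding (G : Type*) [Group G] {R : Type*} {r : ℕ} (p : Fin r → R → ZMod 2) :
    Setoid (R → G) where
  r x y := ∃ F : (Fin r → ZMod 2) → G, ∀ d, x d = F (fun i => p i d) * y d
  iseqv :=
    { refl := fun _ => ⟨fun _ => 1, fun _ => (one_mul _).symm⟩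
      symm := fun ⟨F, hF⟩ => ⟨fun u => (F u)⁻¹, fun d => by rw [hF d, inv_mul_cancel_left]⟩
      trans := fun ⟨F, hF⟩ ⟨F', hF'⟩ =>
        ⟨fun u => F u * F' u, fun d => by rw [hF d, hF' d, mul_assoc]⟩ }

/-- The equivalence relation of classical folding on the right: `x ∼ y` iff `x = y c` for some
`c ∈ G`. -/
def classicalFolding (G : Type*) [Group G] (L : Type*) : Setoid (L → G) where
  r x y := ∃ c : G, ∀ d, x d = y d * c
  iseqv :=
    { refl := fun _ => ⟨1, fun _ => (mul_one _).symm⟩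
      symm := fun ⟨c, hc⟩ => ⟨c⁻¹, fun d => by rw [hc d, mul_inv_cancel_right]⟩
      trans := fun ⟨c, hc⟩ ⟨c', hc'⟩ => ⟨c' * c, fun d => by rw [hc d, hc' d, mul_assoc]⟩ }

theorem exists_functionalFolding_out {G : Type*} [Group G] {R : Type*} {r : ℕ}
    (p : Fin r → R → ZMod 2) (x : R → G) :
    ∃ F : (Fin r → ZMod 2) → G, ∀ d,
      x d = F (fun i => p i d) * (Quotient.mk (functionalFolding G p) x).out d :=
  (functionalFolding G p).symm (Quotient.mk_out (s := functionalFolding G p) x)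

theorem exists_classicalFolding_out {G : Type*} [Group G] {L : Type*} (y : L → G) :
    ∃ c : G, ∀ d, y d = (Quotient.mk (classicalFolding G L) y).out d * c :=
  (classicalFolding G L).symm (Quotient.mk_out (s := classicalFolding G L) y)

/-- A function `F` with `x_d = F(p₁(d), …, p_r(d)) x̄_d` for all `d`, where `x̄` is the fixed
representative of the class of `x`. -/
noncomputable def functionalShift {G : Type*} [Group G] {R : Type*} {r : ℕ}
    (p : Fin r → R → ZMod 2) (x : R → G) : (Fin r → ZMod 2) → G :=
  (exists_functionalFolding_out p x).choose

/-- An element `c` with `y = ȳ c`, where `ȳ` is the fixed representative of the class of `y`. -/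
noncomputable def classicalShift {G : Type*} [Group G] {L : Type*} (y : L → G) : G :=
  (exists_classicalFolding_out y).choose

/-! ### The noiseless test -/

/-- The variables of the Max-3-Lin instance: the values `f_w^F(x̄)` for `w ∈ W` and classes of
`x ∈ G^R`, the values `f_w(z)` for `w ∈ W` and `z ∈ G^R`, and the values `f_v^F(ȳ)` for `v ∈ V` and
classes of `y ∈ G^L`. -/
abbrev TestVar (G : Type*) [Group G] {V W E L R : Type*} {r m : ℕ}
    (Λ : UFGLabelCover V W E L R r m) : Type _ :=
  (W × Quotient (functionalFolding G Λ.p)) ⊕ (W × (R → G)) ⊕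
    (V × Quotient (classicalFolding G L))

theorem injective_of_three {A B C : Type*} (a : A) (b : B) (c : C) :
    Function.Injective
      (![Sum.inl a, Sum.inr (Sum.inl b), Sum.inr (Sum.inr c)] : Fin 3 → A ⊕ B ⊕ C) := by
  intro i j h
  fin_cases i <;> fin_cases j <;> simp at h ⊢

/-- The Max-3-Lin instance of the noiseless test: for an edge `e = (v, w)`, `y ∈ G^L` and `x ∈ G^R`,
chosen uniformly at random, and `z_i = x_i⁻¹ (y ∘ π_e)_i⁻¹`, test
`f_w^F(x) * f_w(z) * f_v^F(y) = 1`.  Here `f_w^F(x)` stands for `F(b_{I_w(1)}, …, b_{I_w(r)}) f_w^F(x̄)`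
if `x_d = F(p₁(d), …, p_r(d)) x̄_d`, and `f_v^F(y)` for `f_v^F(ȳ) c` if `y = ȳ c`, so that the
constraint is `f_w^F(x̄) * f_w(z) * f_v^F(ȳ) = F(b_{I_w(1)}, …, b_{I_w(r)})⁻¹ * c⁻¹`. -/
noncomputable def noiselessTest (G : Type*) [Group G] {V W E L R : Type*} {r m : ℕ}
    (Λ : UFGLabelCover V W E L R r m) :
    MaxThreeLin G (TestVar G Λ) (E × (L → G) × (R → G)) where
  scope := fun ⟨e, y, x⟩ =>
    ⟨![Sum.inl (Λ.right e, Quotient.mk (functionalFolding G Λ.p) x),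
        Sum.inr (Sum.inl (Λ.right e, fun i => (x i)⁻¹ * (y (Λ.proj e i))⁻¹)),
        Sum.inr (Sum.inr (Λ.left e, Quotient.mk (classicalFolding G L) y))],
      injective_of_three _ _ _⟩
  rhs := fun ⟨e, y, x⟩ =>
    (functionalShift Λ.p x (fun i => Λ.b (Λ.I (Λ.right e) i)))⁻¹ * (classicalShift y)⁻¹

/-! ### Finite groups acting isometrically on a finite-dimensional space -/

open scoped InnerProductSpace

/-! Write K = [G,G] and split the point mass at 1 into the uniform density on K, which contributes
at most 1/|K| to the acceptance probability, and the mean-zero remainder `commutatorDefect`.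
Expanding the remainder over two group elements (`commutatorDefect_mul_mul`) leaves |G|²
correlations E_e E_y h(y) E_x a(x) b((y∘π)x) of bounded real functions, where folding makes a
average to zero when the admissible labels are multiplied by K. Soundness amounts to bounding such
correlations.

Functions on G^R split orthogonally into `component`s indexed by S ⊆ R: K-invariant outside S and of
K-mean zero at each coordinate of S. As K is normal, the splitting commutes with all translations,
so a correlation is the sum of the correlations of its components, and S without an admissible label
contributes nothing.

For |S| ≤ C, a random projection is injective on S except with probability C²t/r, and then only the
component of h at π(S) matters (`abs_correlation_component_le`). Reading squared norms of components
as probabilities of label sets turns this part into a randomized labelling, whence √(C·Opt)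
(`expect_setWeights_le`).

For |S| > C there is no noise to damp the component; the non-commutativity of G does it. Choose the
projection by moving k disjoint blocks of t positions with a common random permutation. For two
disjoint blocks the fibres of π and π' through m points of S typically meet only in these points,
and translations u along the first and v along the second have their commutators concentrated there.
Since K has no invariants at these points, the two families of translations are nearly independent:
matrix coefficients of U(u)V(v) have mean square at most 3|G|²/√m (`sum_norm_inner_sq_le`). So fibre
means for different blocks are almost orthogonal, and the average over k of them has small norm.

The representation bound compares two extremes. A large mean square yields minimal invariant
subspaces of U and V of small dimension with large overlap (`exists_overlap`). Small dimension makes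
most coordinates act by scalars (`IsMinimalInvariant.exists_scalar_coordinates`), whereas joint
eigenvectors of U and of V on s coordinates have overlap exponentially small in s
(`norm_inner_pow_four_le`).

Completeness comes from evaluations at the labels. Smoothness comes from fibres of size at most 32^t
for large sets, and from injectivity with high probability for small ones. -/

/-- A nonzero invariant subspace that contains no smaller nonzero invariant subspace. -/
def IsMinimalInvariant {Γ E : Type*} [Group Γ] [AddCommGroup E] [Module ℂ E]
    (ρ : Γ →* Module.End ℂ E) (P : Submodule ℂ E) : Prop :=
  P ≠ ⊥ ∧ (∀ g, ∀ x ∈ P, ρ g x ∈ P) ∧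
    ∀ Q ≤ P, (∀ g, ∀ x ∈ Q, ρ g x ∈ Q) → Q = ⊥ ∨ Q = P

/-! ### Schur's lemma and scalar coordinates on a minimal invariant subspace. -/

section LinearAlgebra

variable {Γ E : Type*} [Group Γ] [AddCommGroup E] [Module ℂ E]

theorem exists_isMinimalInvariant_le [FiniteDimensional ℂ E] (ρ : Γ →* Module.End ℂ E) (Q : Submodule ℂ E) (hQ : Q ≠ ⊥)
    (hinv : ∀ g, ∀ x ∈ Q, ρ g x ∈ Q) : ∃ P ≤ Q, IsMinimalInvariant ρ P := by
  induction h : Module.finrank ℂ Q using Nat.strong_induction_on generalizing Q with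
  | _ n ih =>
    by_cases hmin : ∀ Q' ≤ Q, (∀ g, ∀ x ∈ Q', ρ g x ∈ Q') → Q' = ⊥ ∨ Q' = Q
    · exact ⟨Q, le_rfl, hQ, hinv, hmin⟩
    · push Not at hmin
      obtain ⟨Q', hle, hinv', hne, hne'⟩ := hmin
      obtain ⟨P, hP, hPm⟩ := ih _ (h ▸ Submodule.finrank_lt_finrank_of_lt (lt_of_le_of_ne hle hne'))
        Q' hne hinv' rfl
      exact ⟨P, hP.trans hle, hPm⟩

/-- Schur's lemma: an eigenspace of `A` inside `P` is invariant and nonzero, hence all of `P`.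
Commutation is needed on `P` only. -/
theorem IsMinimalInvariant.exists_eq_smul [FiniteDimensional ℂ E] {ρ : Γ →* Module.End ℂ E} {P : Submodule ℂ E}
    (hP : IsMinimalInvariant ρ P) (A : Module.End ℂ E) (hA : ∀ x ∈ P, A x ∈ P)
    (hcomm : ∀ g, ∀ x ∈ P, A (ρ g x) = ρ g (A x)) : ∃ c : ℂ, ∀ x ∈ P, A x = c • x := by
  obtain ⟨h0, hinv, hmin⟩ := hP
  have : Nontrivial P := Submodule.nontrivial_iff_ne_bot.2 h0
  obtain ⟨c, hc⟩ := Module.End.exists_eigenvalue (A.restrict hA)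
  obtain ⟨v, hv⟩ := hc.exists_hasEigenvector
  refine ⟨c, ?_⟩
  have hker : ∀ x, x ∈ LinearMap.ker (A - c • (1 : Module.End ℂ E)) ↔ A x = c • x := by
    intro x
    simp [sub_eq_zero]
  have := hmin (P ⊓ LinearMap.ker (A - c • (1 : Module.End ℂ E))) inf_le_left (by
    rintro g x ⟨hx, hx'⟩
    refine ⟨hinv g x hx, ?_⟩
    rw [SetLike.mem_coe, hker] at hx' ⊢
    rw [hcomm g x hx, hx', map_smul])
  rcases this with h | h
  · exfalso
    have hv1 : (v : E) ∈ P ⊓ LinearMap.ker (A - c • (1 : Module.End ℂ E)) := by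
      refine ⟨v.2, ?_⟩
      rw [SetLike.mem_coe, hker]
      have := congrArg Subtype.val hv.apply_eq_smul
      simpa using this
    rw [h, Submodule.mem_bot] at hv1
    exact hv.2 (Subtype.ext hv1)
  · intro x hx
    rw [← h] at hx
    exact (hker x).1 hx.2

/-- On a minimal invariant subspace `P` of a power of `G`, all but `(dim P)²` factors act by
scalars. -/
theorem IsMinimalInvariant.exists_scalar_coordinates [FiniteDimensional ℂ E] {G ι : Type*} [Group G] [Fintype ι]
    [DecidableEq ι] {ρ : (ι → G) →* Module.End ℂ E} {P : Submodule ℂ E}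
    (hP : IsMinimalInvariant ρ P) :
    ∃ B : Finset ι, B.card ≤ Module.finrank ℂ P ^ 2 ∧
      ∀ i ∉ B, ∀ g, ∃ c : ℂ, ∀ x ∈ P, ρ (Pi.mulSingle i g) x = c • x := by
  classical
  set B : Finset ι :=
    Finset.univ.filter fun i => ¬ ∀ g, ∃ c : ℂ, ∀ x ∈ P, ρ (Pi.mulSingle i g) x = c • x with hB
  refine ⟨B, ?_, fun i hi => by simpa [hB] using hi⟩
  have hb : ∀ i : B, ∃ g, ¬ ∃ c : ℂ, ∀ x ∈ P, ρ (Pi.mulSingle i.1 g) x = c • x := by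
    rintro ⟨i, hi⟩
    simpa [hB] using hi
  choose γ hγ using hb
  -- One non-scalar operator is picked from each bad factor. Their linear independence in End(P), of
  -- dimension (dim P)², bounds the number of bad factors.
  let X : B → Module.End ℂ P := fun i =>
    (ρ (Pi.mulSingle i.1 (γ i))).restrict (hP.2.1 _)
  have hlin : LinearIndependent ℂ X := by
    rw [linearIndependent_iff_notMem_span]
    intro i hi
    apply hγ i
    let Y : G → Module.End ℂ P := fun g => (ρ (Pi.mulSingle i.1 g)).restrict (hP.2.1 _)
    -- Operators from other factors commute with factor i. If X i were in their span, it would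
    -- commute with its own factor too, hence with the whole group, and be a scalar by Schur.
    have hspan : ∀ A ∈ Submodule.span ℂ (X '' (Set.univ \ {i})), ∀ g, A * Y g = Y g * A := by
      intro A hA g
      induction hA using Submodule.span_induction with
      | mem A hA =>
        obtain ⟨j, hj, rfl⟩ := hA
        have hji : j.1 ≠ i.1 := fun h => hj.2 (Subtype.ext h)
        ext x
        have := congrArg (fun T : Module.End ℂ E => T x)
          (((Pi.mulSingle_commute (f := fun _ : ι => G) hji (γ j) g)).map ρ).eq
        simpa [X, Y] using this
      | zero => simp
      | add A A' _ _ h h' => rw [add_mul, mul_add, h, h']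
      | smul c A _ h => rw [smul_mul_assoc, mul_smul_comm, h]
    apply hP.exists_eq_smul _ (hP.2.1 _)
    intro u x hx
    have hu : u = Function.update u i.1 1 * Pi.mulSingle i.1 (u i.1) := by
      funext k
      by_cases hk : k = i.1
      · subst hk; simp
      · simp [hk]
    have h1 : Commute (Pi.mulSingle i.1 (γ i)) (Function.update u i.1 1) := by
      funext k
      by_cases hk : k = i.1
      · subst hk; simp
      · simp [hk]
    have h2 : ∀ g, ∀ x ∈ P, ρ (Pi.mulSingle i.1 (γ i)) (ρ (Pi.mulSingle i.1 g) x) =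
        ρ (Pi.mulSingle i.1 g) (ρ (Pi.mulSingle i.1 (γ i)) x) := by
      intro g x hx
      have := congrArg (fun T : Module.End ℂ P => (T ⟨x, hx⟩ : E)) (hspan _ hi g)
      simpa [X, Y] using this
    have h3 : ∀ y, ρ (Pi.mulSingle i.1 (γ i)) (ρ (Function.update u i.1 1) y) =
        ρ (Function.update u i.1 1) (ρ (Pi.mulSingle i.1 (γ i)) y) := by
      intro y
      simpa using congrArg (fun T : Module.End ℂ E => T y) (h1.map ρ).eq
    rw [hu, map_mul, Module.End.mul_apply, Module.End.mul_apply, h3, h2 _ _ hx]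
  have := hlin.fintype_card_le_finrank
  rw [Fintype.card_coe] at this
  refine this.trans_eq ?_
  rw [Module.finrank_linearMap, sq]

/-- If the factors in `s` act on `P` by scalars, then so do the elements supported on `s`. -/
theorem exists_eq_smul_of_support {G ι : Type*} [Group G] [DecidableEq ι]
    (ρ : (ι → G) →* Module.End ℂ E) (P : Submodule ℂ E) (s : Finset ι)
    (h : ∀ i ∈ s, ∀ g, ∃ c : ℂ, ∀ x ∈ P, ρ (Pi.mulSingle i g) x = c • x) (w : ι → G)
    (hw : ∀ i ∉ s, w i = 1) : ∃ c : ℂ, ∀ x ∈ P, ρ w x = c • x := by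
  induction s using Finset.induction_on generalizing w with
  | empty =>
    have : w = 1 := by funext i; simpa using hw i
    exact ⟨1, fun x _ => by simp [this]⟩
  | insert i s hi ih =>
    obtain ⟨c, hc⟩ := ih (fun j hj => h j (Finset.mem_insert_of_mem hj)) (Function.update w i 1)
      (fun j hj => by
        by_cases hji : j = i
        · subst hji; simp
        · rw [Function.update_of_ne hji]; exact hw j (by simp [hji, hj]))
    obtain ⟨d, hd⟩ := h i (Finset.mem_insert_self i s) (w i)
    refine ⟨d * c, fun x hx => ?_⟩
    have hu : w = Function.update w i 1 * Pi.mulSingle i (w i) := by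
      funext k
      by_cases hk : k = i
      · subst hk; simp
      · simp [hk]
    rw [hu, map_mul, Module.End.mul_apply, hd x hx, map_smul, hc x hx, smul_smul]

end LinearAlgebra

/-! ### Extremal vectors of a frame form. -/

section Frame

variable {Γ E : Type*} [Group Γ] [NormedAddCommGroup E] [InnerProductSpace ℂ E]
  [FiniteDimensional ℂ E]

/-- A symmetric operator commuting with a group action attains its largest Rayleigh quotient on a
whole minimal invariant subspace. -/
theorem exists_isMinimalInvariant_isMax [Nontrivial E] (ρ : Γ →* Module.End ℂ E)
    (T : Module.End ℂ E) (hT : T.IsSymmetric) (hcomm : ∀ g x, T (ρ g x) = ρ g (T x)) :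
    ∃ (c : ℝ) (P : Submodule ℂ E), IsMinimalInvariant ρ P ∧ (∀ x ∈ P, T x = (c : ℂ) • x) ∧
      ∀ x, RCLike.re ⟪T x, x⟫_ℂ ≤ c * ‖x‖ ^ 2 := by
  have hev := hT.hasEigenvalue_iSup_of_finiteDimensional
  set c : ℝ := ⨆ x : { x : E // x ≠ 0 }, RCLike.re ⟪T x, x⟫_ℂ / ‖(x : E)‖ ^ 2 with hc
  have hne : Module.End.eigenspace T (c : ℂ) ≠ ⊥ := hev
  obtain ⟨P, hle, hP⟩ := exists_isMinimalInvariant_le ρ (Module.End.eigenspace T (c : ℂ)) hne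
    (fun g x hx => by
      rw [Module.End.mem_eigenspace_iff] at hx ⊢
      rw [hcomm, hx, map_smul])
  refine ⟨c, P, hP, fun x hx => Module.End.mem_eigenspace_iff.1 (hle hx), fun x => ?_⟩
  by_cases hx : x = 0
  · simp [hx]
  have hbdd : BddAbove (Set.range fun x : { x : E // x ≠ 0 } =>
      RCLike.re ⟪T x, x⟫_ℂ / ‖(x : E)‖ ^ 2) := by
    refine ⟨‖LinearMap.toContinuousLinearMap T‖, ?_⟩
    rintro _ ⟨⟨y, hy⟩, rfl⟩
    have hy' : 0 < ‖y‖ := norm_pos_iff.2 hy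
    rw [div_le_iff₀ (by positivity)]
    calc RCLike.re ⟪T y, y⟫_ℂ ≤ ‖T y‖ * ‖y‖ := re_inner_le_norm _ _
      _ ≤ (‖LinearMap.toContinuousLinearMap T‖ * ‖y‖) * ‖y‖ := by
          gcongr
          exact (LinearMap.toContinuousLinearMap T).le_opNorm y
      _ = _ := by ring
  have := le_ciSup hbdd ⟨x, hx⟩
  have hx' : 0 < ‖x‖ := norm_pos_iff.2 hx
  rwa [div_le_iff₀ (by positivity)] at this

/-- For a finite family of vectors permuted by a group, the frame form
`x ↦ ∑ i, |⟨ξ i, x⟩|²` is maximal on a whole minimal invariant subspace. -/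
theorem exists_isMinimalInvariant_frame [Nontrivial E] {ι : Type*} [Fintype ι]
    (ρ : Γ →* Module.End ℂ E) (hρ : ∀ g x y, ⟪ρ g x, ρ g y⟫_ℂ = ⟪x, y⟫_ℂ) (ξ : ι → E)
    (hξ : ∀ g, ∃ e : ι ≃ ι, ∀ i, ρ g (ξ i) = ξ (e i)) :
    ∃ (c : ℝ) (P : Submodule ℂ E), IsMinimalInvariant ρ P ∧
      (∀ x ∈ P, ∑ i, ‖⟪ξ i, x⟫_ℂ‖ ^ 2 = c * ‖x‖ ^ 2) ∧
      ∀ x, ∑ i, ‖⟪ξ i, x⟫_ℂ‖ ^ 2 ≤ c * ‖x‖ ^ 2 := by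
  -- The frame operator: its quadratic form is the frame form, and it commutes with the group
  -- because the group permutes the vectors ξ.
  let T : Module.End ℂ E := ∑ i, (innerₛₗ ℂ (ξ i)).smulRight (ξ i)
  have hTx : ∀ x, T x = ∑ i, ⟪ξ i, x⟫_ℂ • ξ i := by
    intro x
    simp [T, LinearMap.sum_apply]
  have hTT : ∀ x, ⟪T x, x⟫_ℂ = ((∑ i, ‖⟪ξ i, x⟫_ℂ‖ ^ 2 : ℝ) : ℂ) := by
    intro x
    rw [hTx, sum_inner]
    push_cast
    refine Finset.sum_congr rfl fun i _ => ?_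
    rw [inner_smul_left, RCLike.conj_mul]
    rfl
  have hT : T.IsSymmetric := by
    intro x y
    rw [hTx, hTx, sum_inner, inner_sum]
    refine Finset.sum_congr rfl fun i _ => ?_
    rw [inner_smul_left, inner_smul_right, inner_conj_symm, mul_comm]
  have hcomm : ∀ g x, T (ρ g x) = ρ g (T x) := by
    intro g x
    obtain ⟨e, he⟩ := hξ g
    rw [hTx, hTx, map_sum, ← e.sum_comp]
    refine Finset.sum_congr rfl fun i _ => ?_
    rw [map_smul, he, ← he, hρ]
  obtain ⟨c, P, hP, h1, h2⟩ := exists_isMinimalInvariant_isMax ρ T hT hcomm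
  refine ⟨c, P, hP, fun x hx => ?_, fun x => ?_⟩
  · have h := hTT x
    rw [h1 x hx, inner_smul_left, inner_self_eq_norm_sq_to_K] at h
    have h' : ((c * ‖x‖ ^ 2 : ℝ) : ℂ) = ((∑ i, ‖⟪ξ i, x⟫_ℂ‖ ^ 2 : ℝ) : ℂ) := by
      rw [← h]; simp
    exact_mod_cast h'.symm
  · have h := h2 x
    rw [hTT] at h
    simpa only [RCLike.re_eq_complex_re, Complex.ofReal_re] using h

end Frame

/-! ### From a large mean square to overlapping small invariant subspaces. -/

section Overlap

variable {H E : Type*} [Group H] [NormedAddCommGroup E] [InnerProductSpace ℂ E]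

theorem inner_map_left_of_isometric {ρ : H →* Module.End ℂ E}
    (hρ : ∀ g x y, ⟪ρ g x, ρ g y⟫_ℂ = ⟪x, y⟫_ℂ) (g : H) (x y : E) :
    ⟪ρ g x, y⟫_ℂ = ⟪x, ρ g⁻¹ y⟫_ℂ := by
  rw [← hρ g⁻¹ (ρ g x) y, ← Module.End.mul_apply, ← map_mul, inv_mul_cancel, map_one,
    Module.End.one_apply]

theorem norm_map_of_isometric {ρ : H →* Module.End ℂ E}
    (hρ : ∀ g x y, ⟪ρ g x, ρ g y⟫_ℂ = ⟪x, y⟫_ℂ) (g : H) (x : E) : ‖ρ g x‖ = ‖x‖ := by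
  have h := congrArg RCLike.re (hρ g x x)
  rw [inner_self_eq_norm_sq, inner_self_eq_norm_sq] at h
  exact (pow_left_inj₀ (norm_nonneg _) (norm_nonneg _) two_ne_zero).1 h

theorem orthonormal_map_of_isometric {ι : Type*} {ρ : H →* Module.End ℂ E}
    (hρ : ∀ g x y, ⟪ρ g x, ρ g y⟫_ℂ = ⟪x, y⟫_ℂ) (g : H) {b : ι → E} (hb : Orthonormal ℂ b) :
    Orthonormal ℂ fun i => ρ g (b i) := by
  classical
  rw [orthonormal_iff_ite] at hb ⊢
  intro i j
  rw [hρ, hb]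

/-- The mean of `|⟨φ, U u (V v ψ)⟩|²` is controlled by the overlap of two unit vectors in
minimal invariant subspaces of `U` and `V` of small dimension. -/
theorem exists_overlap [Fintype H] [FiniteDimensional ℂ E] [Nontrivial E] (U V : H →* Module.End ℂ E)
    (hU : ∀ g x y, ⟪U g x, U g y⟫_ℂ = ⟪x, y⟫_ℂ) (hV : ∀ g x y, ⟪V g x, V g y⟫_ℂ = ⟪x, y⟫_ℂ)
    (φ : E) (hφ : ‖φ‖ = 1) :
    ∃ (κ : ℝ) (P Q : Submodule ℂ E) (f q : E), IsMinimalInvariant V P ∧ IsMinimalInvariant U Q ∧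
      f ∈ P ∧ q ∈ Q ∧ ‖f‖ = 1 ∧ ‖q‖ = 1 ∧ κ ≤ ‖⟪q, f⟫_ℂ‖ ^ 2 ∧
      Module.finrank ℂ P * κ ≤ 1 ∧ Module.finrank ℂ Q * κ ≤ 1 ∧
      ∀ ψ, ∑ u, ∑ v, ‖⟪φ, U u (V v ψ)⟫_ℂ‖ ^ 2 ≤ (Fintype.card H : ℝ) ^ 2 * κ * ‖ψ‖ ^ 2 := by
  classical
  set N : ℝ := (Fintype.card H : ℝ) with hN
  have hN0 : 0 < N := by simp [hN, Fintype.card_pos]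
  -- The mean square as a form in ψ is the frame form of these vectors; its maximum c is attained on
  -- all of `P`.
  obtain ⟨c, P, hP, hPeq, hPle⟩ := exists_isMinimalInvariant_frame V hV
    (fun a : H × H => V a.2⁻¹ (U a.1⁻¹ φ)) (fun g => by
      refine ⟨(Equiv.refl H).prodCongr (Equiv.mulRight g⁻¹), fun a => ?_⟩
      rw [← Module.End.mul_apply, ← map_mul]
      simp)
  have hform : ∀ ψ, ∑ a : H × H, ‖⟪V a.2⁻¹ (U a.1⁻¹ φ), ψ⟫_ℂ‖ ^ 2 =
      ∑ u, ∑ v, ‖⟪φ, U u (V v ψ)⟫_ℂ‖ ^ 2 := by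
    intro ψ
    rw [Fintype.sum_prod_type]
    refine Finset.sum_congr rfl fun u _ => Finset.sum_congr rfl fun v _ => ?_
    rw [inner_map_left_of_isometric hV, inner_map_left_of_isometric hU, inv_inv, inv_inv]
  simp only [hform] at hPeq hPle
  set r := Module.finrank ℂ P with hr
  let b := stdOrthonormalBasis ℂ P
  have hbo : Orthonormal ℂ fun k => (b k : E) := b.orthonormal.comp_linearIsometry P.subtypeₗᵢ
  -- The same in the first argument, summed over an orthonormal basis of `P`.
  obtain ⟨d, Q, hQ, hQeq, hQle⟩ := exists_isMinimalInvariant_frame U hU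
    (fun a : (H × H) × Fin r => U a.1.1 (V a.1.2 (b a.2))) (fun g => by
      refine ⟨((Equiv.mulLeft g).prodCongr (Equiv.refl H)).prodCongr (Equiv.refl _), fun a => ?_⟩
      rw [← Module.End.mul_apply, ← map_mul]
      simp)
  have hform2 : ∀ x, ∑ a : (H × H) × Fin r, ‖⟪U a.1.1 (V a.1.2 (b a.2)), x⟫_ℂ‖ ^ 2 =
      ∑ a : H × H, ∑ k, ‖⟪V a.2 (b k), U a.1⁻¹ x⟫_ℂ‖ ^ 2 := by
    intro x
    rw [Fintype.sum_prod_type]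
    refine Finset.sum_congr rfl fun a _ => Finset.sum_congr rfl fun k _ => ?_
    rw [inner_map_left_of_isometric hU]
  simp only [hform2] at hQeq hQle
  -- The second form evaluated at φ is the sum of the first over a basis of `P`, that is, r·c.
  have hrc : r * c ≤ d := by
    calc (r : ℝ) * c = ∑ k, c * ‖(b k : E)‖ ^ 2 := by
          simp [hbo.1, hr]
      _ = ∑ k, ∑ u, ∑ v, ‖⟪φ, U u (V v (b k))⟫_ℂ‖ ^ 2 :=
          Finset.sum_congr rfl fun k _ => (hPeq _ (b k).2).symm
      _ = ∑ a : H × H, ∑ k, ‖⟪V a.2 (b k), U a.1⁻¹ φ⟫_ℂ‖ ^ 2 := by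
          rw [Finset.sum_comm' (t' := Finset.univ) (s' := fun _ => Finset.univ) (by simp),
            Fintype.sum_prod_type]
          refine Finset.sum_congr rfl fun u _ => ?_
          rw [Finset.sum_comm]
          refine Finset.sum_congr rfl fun v _ => Finset.sum_congr rfl fun k _ => ?_
          rw [norm_inner_symm, inner_map_left_of_isometric hU, norm_inner_symm,
            norm_inner_symm]
      _ ≤ d * ‖φ‖ ^ 2 := hQle φ
      _ = d := by rw [hφ]; ring
  set r' := Module.finrank ℂ Q with hr'
  let b' := stdOrthonormalBasis ℂ Q
  have hbo' : Orthonormal ℂ fun k => (b' k : E) :=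
    b'.orthonormal.comp_linearIsometry Q.subtypeₗᵢ
  have hrpos : 0 < r := Submodule.one_le_finrank_iff.2 hP.1
  have hrpos' : 0 < r' := Submodule.one_le_finrank_iff.2 hQ.1
  -- The trace of the second form over `Q`, with Bessel's inequality for each of the N²·r unit
  -- vectors.
  have hrd : r' * d ≤ N ^ 2 * r := by
    calc (r' : ℝ) * d = ∑ l, d * ‖(b' l : E)‖ ^ 2 := by
          simp [hbo'.1, hr']
      _ = ∑ l, ∑ a : H × H, ∑ k, ‖⟪V a.2 (b k), U a.1⁻¹ (b' l)⟫_ℂ‖ ^ 2 :=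
          Finset.sum_congr rfl fun l _ => (hQeq _ (b' l).2).symm
      _ = ∑ a : H × H, ∑ k, ∑ l, ‖⟪U a.1⁻¹ (b' l), V a.2 (b k)⟫_ℂ‖ ^ 2 := by
          rw [Finset.sum_comm]
          refine Finset.sum_congr rfl fun a _ => ?_
          rw [Finset.sum_comm]
          refine Finset.sum_congr rfl fun k _ => Finset.sum_congr rfl fun l _ => ?_
          rw [norm_inner_symm]
      _ ≤ ∑ a : H × H, ∑ k : Fin r, (1 : ℝ) := by
          refine Finset.sum_le_sum fun a _ => Finset.sum_le_sum fun k _ => ?_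
          refine ((orthonormal_map_of_isometric hU a.1⁻¹ hbo').sum_inner_products_le
            (V a.2 (b k)) (s := Finset.univ)).trans_eq ?_
          rw [norm_map_of_isometric hV, hbo.1, one_pow]
      _ = N ^ 2 * r := by simp [hN, sq]
  let l0 : Fin r' := ⟨0, hrpos'⟩
  have hd : d = ∑ a : H × H, ∑ k, ‖⟪V a.2 (b k), U a.1⁻¹ (b' l0)⟫_ℂ‖ ^ 2 := by
    rw [hQeq _ (b' l0).2, hbo'.1]; ring
  obtain ⟨a, -, ha⟩ : ∃ a ∈ (Finset.univ : Finset (H × H)), d / N ^ 2 ≤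
      ∑ k, ‖⟪V a.2 (b k), U a.1⁻¹ (b' l0)⟫_ℂ‖ ^ 2 := by
    refine Finset.exists_le_of_sum_le Finset.univ_nonempty ?_
    rw [← hd]
    simp only [Finset.sum_const, Finset.card_univ, Fintype.card_prod, nsmul_eq_mul]
    push_cast
    rw [← hN]
    apply le_of_eq
    field_simp
  have hq1 : ‖U a.1⁻¹ (b' l0)‖ = 1 := by rw [norm_map_of_isometric hU, hbo'.1]
  have hdN : d / N ^ 2 ≤ 1 := by
    refine ha.trans (((orthonormal_map_of_isometric hV a.2 hbo).sum_inner_products_le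
      (U a.1⁻¹ (b' l0)) (s := Finset.univ)).trans_eq ?_)
    rw [hq1, one_pow]
  -- Two pigeonholes, first over the N² pairs and then over the r basis vectors, leave an overlap of
  -- at least d/(N²r) ≥ c/N². So κ = c/N².
  obtain ⟨k, -, hk⟩ : ∃ k ∈ (Finset.univ : Finset (Fin r)), c / N ^ 2 ≤
      ‖⟪V a.2 (b k), U a.1⁻¹ (b' l0)⟫_ℂ‖ ^ 2 := by
    refine Finset.exists_le_of_sum_le ⟨⟨0, hrpos⟩, Finset.mem_univ _⟩ (le_trans ?_ ha)
    simp only [Finset.sum_const, Finset.card_univ, Fintype.card_fin, nsmul_eq_mul]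
    rw [mul_div_assoc']
    gcongr
  refine ⟨c / N ^ 2, P, Q, V a.2 (b k), U a.1⁻¹ (b' l0), hP, hQ, hP.2.1 _ _ (b k).2,
    hQ.2.1 _ _ (b' l0).2, by rw [norm_map_of_isometric hV, hbo.1], hq1, ?_, ?_, ?_, ?_⟩
  · rw [norm_inner_symm]; exact hk
  · refine le_trans ?_ hdN
    rw [mul_div_assoc']
    gcongr
  -- From r·r'·c ≤ r'·d ≤ N²·r; the factor r cancels.
  · have hr0 : (0 : ℝ) < r := by exact_mod_cast hrpos
    have : (r : ℝ) * (r' * c) ≤ r * N ^ 2 := by nlinarith [hrd, hrc, (Nat.cast_nonneg r' : (0:ℝ) ≤ r')]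
    have := le_of_mul_le_mul_left this hr0
    rw [mul_div_assoc', div_le_one (by positivity)]
    exact this
  · intro ψ
    refine (hPle ψ).trans_eq ?_
    field_simp

end Overlap

open scoped Pointwise commutatorElement

/-! ### Random commutators contract vectors without K-invariants. -/

section Commutators

variable {G E : Type*} [Group G] [NormedAddCommGroup E] [InnerProductSpace ℂ E]

/-- Every element of the commutator subgroup is a product of `|G|` commutators. -/
theorem mem_commutatorSet_pow_card [Fintype G] {c : G} (hc : c ∈ commutator G) :
    c ∈ commutatorSet G ^ Fintype.card G := by
  have h1 : (1 : G) ∈ commutatorSet G := ⟨1, 1, by simp⟩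
  -- The |G|-th power of a subset containing 1 is a subgroup.
  have hle : commutator G ≤ powCardSubgroup (commutatorSet G) ⟨1, h1⟩ := by
    rw [commutator_eq_closure, Subgroup.closure_le]
    intro x hx
    change x ∈ commutatorSet G ^ Fintype.card G
    exact (Set.subset_pow h1 Fintype.card_ne_zero) hx
  exact hle hc

/-- An isometric action without vectors fixed by the commutator subgroup has, at every vector, a
commutator that moves it. -/
theorem exists_commutator_norm_le [Fintype G] [Fintype (commutator G)] (W : G →* Module.End ℂ E)
    (hW : ∀ g x y, ⟪W g x, W g y⟫_ℂ = ⟪x, y⟫_ℂ) (x : E) (hx : ∑ c : commutator G, W c x = 0) :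
    ∃ u v : G, ‖x‖ / Fintype.card G ≤ ‖W (u⁻¹ * v⁻¹ * u * v) x - x‖ := by
  by_contra! hcon
  have hn : (0 : ℝ) < Fintype.card G := by exact_mod_cast Fintype.card_pos
  have hx0 : 0 < ‖x‖ := by
    have := (norm_nonneg _).trans_lt (hcon 1 1)
    by_contra h
    have : ‖x‖ = 0 := le_antisymm (not_lt.1 h) (norm_nonneg _)
    simp_all
  -- Displacements add along products of isometries. If every commutator moves x by less than
  -- ‖x‖/|G|, each element of K moves it by at most ‖x‖, so all Re⟨x, W c x⟩ are at least ‖x‖²/2 and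
  -- cannot sum to zero.
  have hpow : ∀ k : ℕ, ∀ c ∈ commutatorSet G ^ k, ‖W c x - x‖ ≤ k * (‖x‖ / Fintype.card G) := by
    intro k
    induction k with
    | zero => intro c hc; simp_all
    | succ k ih =>
      intro c hc
      rw [pow_succ] at hc
      obtain ⟨a, ha, b, ⟨u, v, rfl⟩, rfl⟩ := Set.mem_mul.1 hc
      have hb := (hcon u⁻¹ v⁻¹).le
      rw [inv_inv, inv_inv, ← commutatorElement_def] at hb
      calc ‖W (a * ⁅u, v⁆) x - x‖ = ‖W a (W ⁅u, v⁆ x - x) + (W a x - x)‖ := by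
            rw [map_mul, Module.End.mul_apply, map_sub]; congr 1; abel
        _ ≤ ‖W a (W ⁅u, v⁆ x - x)‖ + ‖W a x - x‖ := norm_add_le _ _
        _ ≤ ‖x‖ / Fintype.card G + k * (‖x‖ / Fintype.card G) := by
            rw [norm_map_of_isometric hW]
            exact add_le_add hb (ih a ha)
        _ = _ := by push_cast; ring
  have hle : ∀ c : commutator G, ‖x‖ ^ 2 / 2 ≤ RCLike.re ⟪x, W c x⟫_ℂ := by
    intro c
    have h := hpow _ _ (mem_commutatorSet_pow_card c.2)
    rw [mul_div_cancel₀ _ hn.ne'] at h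
    have h2 := norm_sub_sq (𝕜 := ℂ) (W c x) x
    rw [norm_map_of_isometric hW, inner_re_symm] at h2
    nlinarith [norm_nonneg (W c x - x)]
  have hsum : ∑ c : commutator G, RCLike.re ⟪x, W c x⟫_ℂ = 0 := by
    rw [← map_sum, ← inner_sum, hx, inner_zero_right, map_zero]
  have : 0 < ∑ c : commutator G, RCLike.re ⟪x, W c x⟫_ℂ :=
    Finset.sum_pos (fun c _ => lt_of_lt_of_le (by positivity) (hle c)) Finset.univ_nonempty
  exact this.ne' hsum

/-- Averaging over commutators with one random entry contracts, in mean square over the other. -/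
theorem sum_norm_sum_commutator_sq_le [Fintype G] [Fintype (commutator G)] (W : G →* Module.End ℂ E)
    (hW : ∀ g x y, ⟪W g x, W g y⟫_ℂ = ⟪x, y⟫_ℂ) (x : E) (hx : ∑ c : commutator G, W c x = 0) :
    ∑ u : G, ‖∑ v : G, W (u⁻¹ * v⁻¹ * u * v) x‖ ^ 2 ≤
      (Fintype.card G : ℝ) ^ 3 * (1 - 1 / (4 * (Fintype.card G : ℝ) ^ 4)) * ‖x‖ ^ 2 := by
  classical
  set n : ℝ := (Fintype.card G : ℝ) with hn
  have hn1 : 1 ≤ n := by simp only [hn]; exact_mod_cast Fintype.card_pos (α := G)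
  by_cases hx0 : x = 0
  · simp [hx0]
  have hxpos : 0 < ‖x‖ := norm_pos_iff.2 hx0
  obtain ⟨u, v, huv⟩ := exists_commutator_norm_le W hW x hx
  rw [← hn] at huv
  have hv : v ≠ 1 := by
    rintro rfl
    simp only [inv_one, mul_one, inv_mul_cancel, map_one, Module.End.one_apply, sub_self,
      norm_zero] at huv
    have : 0 < ‖x‖ / n := by positivity
    linarith
  have hgen : ∀ w : G, ‖∑ v : G, W (w⁻¹ * v⁻¹ * w * v) x‖ ≤ n * ‖x‖ := by
    intro w
    refine (norm_sum_le _ _).trans_eq ?_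
    simp [norm_map_of_isometric hW, hn]
  -- For this u the summands at 1 (which is x itself) and at v differ by at least ‖x‖/n. The
  -- parallelogram law saves 1/(4n²) in their sum; the other n − 2 terms are bounded trivially.
  have hu : ‖∑ v : G, W (u⁻¹ * v⁻¹ * u * v) x‖ ≤ (n - 1 / (4 * n ^ 2)) * ‖x‖ := by
    have hpair : ‖x + W (u⁻¹ * v⁻¹ * u * v) x‖ ≤ (2 - 1 / (4 * n ^ 2)) * ‖x‖ := by
      have hpar := parallelogram_law_with_norm ℂ (W (u⁻¹ * v⁻¹ * u * v) x) x
      rw [norm_map_of_isometric hW] at hpar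
      have h1 : (‖x‖ / n) * (‖x‖ / n) ≤ ‖W (u⁻¹ * v⁻¹ * u * v) x - x‖ *
          ‖W (u⁻¹ * v⁻¹ * u * v) x - x‖ := by gcongr
      have h2 : 1 / (4 * n ^ 2) ≤ 2 := by
        rw [div_le_iff₀ (by positivity)]; nlinarith
      rw [add_comm]
      refine le_of_sq_le_sq ?_ (mul_nonneg (by linarith) hxpos.le)
      have h3 : ((2 - 1 / (4 * n ^ 2)) * ‖x‖) ^ 2 =
          4 * ‖x‖ ^ 2 - (‖x‖ / n) * (‖x‖ / n) + (‖x‖ / (4 * n ^ 2)) ^ 2 := by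
        field_simp; ring
      rw [h3]
      nlinarith [sq_nonneg (‖x‖ / (4 * n ^ 2))]
    rw [← Finset.sum_erase_add _ _ (Finset.mem_univ (1 : G)),
      ← Finset.sum_erase_add _ _ (Finset.mem_erase.2 ⟨hv, Finset.mem_univ v⟩), add_assoc]
    refine (norm_add_le _ _).trans ?_
    have hrest : ‖∑ v ∈ (Finset.univ.erase (1 : G)).erase v, W (u⁻¹ * v⁻¹ * u * v) x‖ ≤
        (n - 2) * ‖x‖ := by
      refine (norm_sum_le _ _).trans_eq ?_
      simp only [norm_map_of_isometric hW, Finset.sum_const, nsmul_eq_mul]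
      have hcard : ((Finset.univ.erase (1 : G)).erase v).card + 2 = Fintype.card G := by
        rw [← Finset.card_univ, ← Finset.card_erase_add_one (Finset.mem_univ (1 : G)),
          ← Finset.card_erase_add_one (Finset.mem_erase.2 ⟨hv, Finset.mem_univ v⟩)]
      rw [hn, ← hcard]
      push_cast
      ring
    have h1 : W (u⁻¹ * (1 : G)⁻¹ * u * 1) x = x := by simp
    rw [h1, add_comm (W _ x) x]
    nlinarith
  have hsplit := Finset.sum_erase_add Finset.univ
    (fun u : G => ‖∑ v : G, W (u⁻¹ * v⁻¹ * u * v) x‖ ^ 2) (Finset.mem_univ u)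
  -- The other u give (n − 1)n², this one gives n² − 1/(4n); the total is n³(1 − 1/(4n⁴)).
  rw [← hsplit]
  have hA : ∑ w ∈ Finset.univ.erase u, ‖∑ v : G, W (w⁻¹ * v⁻¹ * w * v) x‖ ^ 2 ≤
      (n - 1) * (n * ‖x‖) ^ 2 := by
    have hc : ((Finset.univ.erase u).card : ℝ) = n - 1 := by
      rw [Finset.card_erase_of_mem (Finset.mem_univ u), Finset.card_univ, Nat.cast_sub
        Fintype.card_pos]; simp [hn]
    rw [← hc, ← nsmul_eq_mul]
    refine Finset.sum_le_card_nsmul _ _ _ fun w _ => ?_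
    have := hgen w
    gcongr
  have hB : ‖∑ v : G, W (u⁻¹ * v⁻¹ * u * v) x‖ ^ 2 ≤ (n ^ 2 - 1 / (4 * n)) * ‖x‖ ^ 2 := by
    have h0 : ‖∑ v : G, W (u⁻¹ * v⁻¹ * u * v) x‖ ^ 2 ≤
        ((n - 1 / (4 * n ^ 2)) * ‖x‖) * (n * ‖x‖) := by
      rw [sq]
      exact mul_le_mul hu (hgen u) (norm_nonneg _) ((norm_nonneg _).trans hu)
    refine h0.trans_eq ?_
    field_simp
  refine (add_le_add hA hB).trans_eq ?_
  field_simp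
  ring

/-- The contraction of `sum_norm_sum_commutator_sq_le` for a power of `G`. -/
theorem sum_norm_sum_commutator_sq_le_pow [Fintype G] [Fintype (commutator G)] (s : ℕ)
    (W : (Fin s → G) →* Module.End ℂ E) (hW : ∀ g x y, ⟪W g x, W g y⟫_ℂ = ⟪x, y⟫_ℂ)
    (h0 : ∀ i x, ∑ c : commutator G, W (Pi.mulSingle i (c : G)) x = 0) (x : E) :
    ∑ u : Fin s → G, ‖∑ v : Fin s → G, W (u⁻¹ * v⁻¹ * u * v) x‖ ^ 2 ≤
      ((Fintype.card G : ℝ) ^ 3 * (1 - 1 / (4 * (Fintype.card G : ℝ) ^ 4))) ^ s * ‖x‖ ^ 2 := by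
  induction s with
  | zero => simp
  | succ s ih =>
    let W0 : G →* Module.End ℂ E := W.comp (MonoidHom.mulSingle (fun _ : Fin (s + 1) => G) 0)
    let ι : (Fin s → G) →* (Fin (s + 1) → G) :=
      { toFun := fun u => Fin.cons 1 u
        map_one' := by
          funext i; refine Fin.cases ?_ (fun i => ?_) i <;> simp
        map_mul' := fun a b => by
          funext i; refine Fin.cases ?_ (fun i => ?_) i <;> simp }
    let W1 : (Fin s → G) →* Module.End ℂ E := W.comp ι
    have hW1 := ih W1 (fun g x y => hW _ _ _) (fun i x => by
      have := h0 i.succ x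
      have hι : ∀ c : G, ι (Pi.mulSingle i c) = Pi.mulSingle i.succ c := by
        intro c
        funext j
        refine Fin.cases ?_ (fun j => ?_) j
        · simp [ι, (Fin.succ_ne_zero i).symm]
        · simp [ι, Pi.mulSingle_apply]
      simpa [W1, hι] using this)
    have hsplit : ∀ (a b : G) (u v : Fin s → G),
        W ((Fin.cons a u : Fin (s + 1) → G)⁻¹ * (Fin.cons b v : Fin (s + 1) → G)⁻¹ *
          Fin.cons a u * Fin.cons b v) x =
        W0 (a⁻¹ * b⁻¹ * a * b) (W1 (u⁻¹ * v⁻¹ * u * v) x) := by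
      intro a b u v
      simp only [W0, W1, MonoidHom.comp_apply]
      rw [← Module.End.mul_apply, ← map_mul]
      congr 2
      funext i
      refine Fin.cases ?_ (fun i => ?_) i
      · simp [ι]
      · simp [ι]
    rw [← (Fin.consEquiv fun _ : Fin (s + 1) => G).sum_comp, Fintype.sum_prod_type,
      Finset.sum_comm]
    calc _ = ∑ u : Fin s → G, ∑ a : G, ‖∑ b : G, W0 (a⁻¹ * b⁻¹ * a * b)
            (∑ v : Fin s → G, W1 (u⁻¹ * v⁻¹ * u * v) x)‖ ^ 2 := by
          refine Finset.sum_congr rfl fun u _ => Finset.sum_congr rfl fun a _ => ?_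
          rw [← (Fin.consEquiv fun _ : Fin (s + 1) => G).sum_comp, Fintype.sum_prod_type]
          congr 2
          refine Finset.sum_congr rfl fun b _ => ?_
          rw [map_sum]
          refine Finset.sum_congr rfl fun v _ => ?_
          rw [← hsplit]
          rfl
      _ ≤ ∑ u : Fin s → G, (Fintype.card G : ℝ) ^ 3 *
            (1 - 1 / (4 * (Fintype.card G : ℝ) ^ 4)) *
            ‖∑ v : Fin s → G, W1 (u⁻¹ * v⁻¹ * u * v) x‖ ^ 2 :=
          Finset.sum_le_sum fun u _ =>
            sum_norm_sum_commutator_sq_le W0 (fun g x y => hW _ _ _) _ (h0 0 _)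
      _ ≤ _ := by
          rw [← Finset.mul_sum, pow_succ' (_ * _), mul_assoc (_ * _) (_ ^ s)]
          refine mul_le_mul_of_nonneg_left hW1 (mul_nonneg (by positivity) ?_)
          have hn1 : (1 : ℝ) ≤ Fintype.card G := by exact_mod_cast Fintype.card_pos (α := G)
          have : (1 : ℝ) ≤ (Fintype.card G : ℝ) ^ 4 := one_le_pow₀ hn1
          rw [sub_nonneg, div_le_one (by positivity)]
          linarith

end Commutators

theorem Function.extend_one_mulSingle {G ι κ : Type*} [Group G] [DecidableEq ι] [DecidableEq κ] {j : ι → κ}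
    (hj : Function.Injective j) (i : ι) (g : G) :
    Function.extend j (Pi.mulSingle i g) 1 = Pi.mulSingle (j i) g := by
  funext k
  by_cases hk : ∃ l, j l = k
  · obtain ⟨l, rfl⟩ := hk
    rw [hj.extend_apply]
    by_cases hl : l = i
    · subst hl; simp
    · rw [Pi.mulSingle_eq_of_ne hl, Pi.mulSingle_eq_of_ne (fun h => hl (hj h))]
  · rw [Function.extend_apply' _ _ _ hk, Pi.mulSingle_eq_of_ne (fun h => hk ⟨i, h.symm⟩)]
    rfl

/-- Bernoulli bounds s·x by (1 + x)^s, and (1 − x)(1 + x) ≤ 1. It turns exponential decay in s into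
the polynomial bound used below. -/
theorem one_sub_pow_mul_le_one {x : ℝ} (hx0 : 0 ≤ x) (hx1 : x ≤ 1) (s : ℕ) :
    (1 - x) ^ s * (s * x) ≤ 1 := by
  have h1 : (s : ℝ) * x ≤ (1 + x) ^ s := by
    have := one_add_mul_le_pow (a := x) (by linarith) s
    linarith
  calc (1 - x) ^ s * (s * x) ≤ (1 - x) ^ s * (1 + x) ^ s := by
        gcongr
    _ = (1 - x ^ 2) ^ s := by rw [← mul_pow]; ring_nf
    _ ≤ 1 := pow_le_one₀ (by nlinarith) (by nlinarith)

/-! ### The mean-square bound for two actions with non-trivial commutators. -/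

section KeyBound

variable {G E : Type*} [Group G] [Fintype G] [Fintype (commutator G)] [NormedAddCommGroup E]
  [InnerProductSpace ℂ E]

/-- An eigenvector of all `U u` and an eigenvector of all `V v` are almost orthogonal if the
commutators of the `U u` with the `V v` act without invariants. -/
theorem norm_inner_pow_four_le (s : ℕ) (U V W : (Fin s → G) →* Module.End ℂ E)
    (hU : ∀ g x y, ⟪U g x, U g y⟫_ℂ = ⟪x, y⟫_ℂ) (hV : ∀ g x y, ⟪V g x, V g y⟫_ℂ = ⟪x, y⟫_ℂ)
    (hW : ∀ g x y, ⟪W g x, W g y⟫_ℂ = ⟪x, y⟫_ℂ)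
    (hcomm : ∀ u v, U u * V v = V v * U u * W (u⁻¹ * v⁻¹ * u * v))
    (h0 : ∀ i x, ∑ c : commutator G, W (Pi.mulSingle i (c : G)) x = 0)
    (q f : E) (hq : ‖q‖ = 1) (hf : ‖f‖ = 1) (hUq : ∀ u, ∃ c : ℂ, U u q = c • q)
    (hVf : ∀ v, ∃ c : ℂ, V v f = c • f) :
    ‖⟪q, f⟫_ℂ‖ ^ 4 ≤ (1 - 1 / (4 * (Fintype.card G : ℝ) ^ 4)) ^ s := by
  classical
  set N : ℝ := (Fintype.card (Fin s → G) : ℝ) with hN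
  have hN0 : 0 < N := by simp only [hN]; exact_mod_cast Fintype.card_pos
  have hNn : N = (Fintype.card G : ℝ) ^ s := by simp [hN]
  choose c hc using hUq
  choose d hd using hVf
  have hc1 : ∀ u, ‖c u‖ = 1 := by
    intro u
    have := norm_map_of_isometric hU u q
    rwa [hc, norm_smul, hq, mul_one] at this
  have hd1 : ∀ u, ‖d u‖ = 1 := by
    intro u
    have := norm_map_of_isometric hV u f
    rwa [hd, norm_smul, hf, mul_one] at this
  have h1 : N ^ 2 * ‖⟪q, f⟫_ℂ‖ ^ 2 ≤ N * ∑ u, ‖⟪f, U u f⟫_ℂ‖ := by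
    -- Each summand has the same inner product with the eigenvector q, so F correlates with q N
    -- times as strongly as f does; expanding ‖F‖² leaves only the diagonal coefficients of U at f.
    set F : E := ∑ u, (starRingEnd ℂ) (c u) • U u f with hF
    have hqF : ⟪q, F⟫_ℂ = N * ⟪q, f⟫_ℂ := by
      rw [hF, inner_sum]
      have : ∀ u, ⟪q, (starRingEnd ℂ) (c u) • U u f⟫_ℂ = ⟪q, f⟫_ℂ := by
        intro u
        rw [inner_smul_right, ← inner_smul_left, ← hc, hU]
      simp only [this, Finset.sum_const, Finset.card_univ, nsmul_eq_mul, hN]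
      norm_cast
    have hle : ‖⟪q, F⟫_ℂ‖ ≤ ‖F‖ := by
      have := norm_inner_le_norm (𝕜 := ℂ) q F
      rwa [hq, one_mul] at this
    rw [hqF, norm_mul, Complex.norm_real, Real.norm_of_nonneg hN0.le] at hle
    calc N ^ 2 * ‖⟪q, f⟫_ℂ‖ ^ 2 = (N * ‖⟪q, f⟫_ℂ‖) ^ 2 := by ring
      _ ≤ ‖F‖ ^ 2 := by gcongr
      _ = ‖⟪F, F⟫_ℂ‖ := by rw [inner_self_eq_norm_sq_to_K]; simp
      _ ≤ ∑ u, ∑ u', ‖⟪U u f, U u' f⟫_ℂ‖ := by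
          rw [hF, sum_inner]
          refine (norm_sum_le _ _).trans (Finset.sum_le_sum fun u _ => ?_)
          rw [inner_sum]
          refine (norm_sum_le _ _).trans (Finset.sum_le_sum fun u' _ => ?_)
          rw [inner_smul_left, inner_smul_right, norm_mul, norm_mul]
          simp [hc1]
      _ = ∑ u, ∑ u', ‖⟪f, U u' f⟫_ℂ‖ := by
          refine Finset.sum_congr rfl fun u _ => ?_
          rw [← Equiv.sum_comp (Equiv.mulLeft u)]
          refine Finset.sum_congr rfl fun u' _ => ?_
          rw [Equiv.coe_mulLeft, map_mul, Module.End.mul_apply, hU]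
      _ = N * ∑ u, ‖⟪f, U u f⟫_ℂ‖ := by simp [hN]
  have h2 : ∀ u, N * ‖⟪f, U u f⟫_ℂ‖ ≤ ‖∑ v, W (u⁻¹ * v⁻¹ * u * v) f‖ := by
    intro u
    -- f may be replaced by V v f on both sides, since the phases cancel. Moving V v past U u then
    -- creates the commutator W, which is averaged over v.
    have hv : ∀ v, ⟪f, U u f⟫_ℂ = ⟪f, U u (W (u⁻¹ * v⁻¹ * u * v) f)⟫_ℂ := by
      intro v
      have e1 : U u (V v f) = V v (U u (W (u⁻¹ * v⁻¹ * u * v) f)) := by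
        have := congrArg (fun T : Module.End ℂ E => T f) (hcomm u v)
        simpa using this
      have e2 : ⟪V v f, U u (V v f)⟫_ℂ = ⟪f, U u f⟫_ℂ := by
        rw [hd, map_smul, inner_smul_left, inner_smul_right, ← mul_assoc, RCLike.conj_mul, hd1]
        simp
      rw [← e2, e1, hV]
    have hs : (N : ℂ) * ⟪f, U u f⟫_ℂ = ⟪f, U u (∑ v, W (u⁻¹ * v⁻¹ * u * v) f)⟫_ℂ := by
      rw [map_sum, inner_sum, ← Finset.sum_congr rfl fun v _ => hv v]
      simp [hN]
    have := norm_inner_le_norm (𝕜 := ℂ) f (U u (∑ v, W (u⁻¹ * v⁻¹ * u * v) f))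
    rw [← hs, norm_mul, hf, one_mul, norm_map_of_isometric hU, Complex.norm_real,
      Real.norm_of_nonneg hN0.le] at this
    exact this
  have h3 : N ^ 2 * ‖⟪q, f⟫_ℂ‖ ^ 2 ≤ ∑ u, ‖∑ v, W (u⁻¹ * v⁻¹ * u * v) f‖ := by
    rw [Finset.mul_sum] at h1
    exact h1.trans (Finset.sum_le_sum fun u _ => h2 u)
  have h4 : (∑ u, ‖∑ v, W (u⁻¹ * v⁻¹ * u * v) f‖) ^ 2 ≤
      N * ∑ u, ‖∑ v, W (u⁻¹ * v⁻¹ * u * v) f‖ ^ 2 := by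
    have := sq_sum_le_card_mul_sum_sq (s := Finset.univ)
      (f := fun u : Fin s → G => ‖∑ v, W (u⁻¹ * v⁻¹ * u * v) f‖)
    simpa [hN] using this
  have h5 := sum_norm_sum_commutator_sq_le_pow s W hW h0 f
  rw [hf, one_pow, mul_one, mul_pow, ← pow_mul, mul_comm 3, pow_mul, ← hNn] at h5
  have h6 : N ^ 4 * ‖⟪q, f⟫_ℂ‖ ^ 4 ≤
      N ^ 4 * (1 - 1 / (4 * (Fintype.card G : ℝ) ^ 4)) ^ s := by
    calc N ^ 4 * ‖⟪q, f⟫_ℂ‖ ^ 4 = (N ^ 2 * ‖⟪q, f⟫_ℂ‖ ^ 2) ^ 2 := by ring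
      _ ≤ (∑ u, ‖∑ v, W (u⁻¹ * v⁻¹ * u * v) f‖) ^ 2 := by gcongr
      _ ≤ _ := h4
      _ ≤ N * (N ^ 3 * (1 - 1 / (4 * (Fintype.card G : ℝ) ^ 4)) ^ s) := by gcongr
      _ = _ := by ring
  exact le_of_mul_le_mul_left h6 (by positivity)

/-- If the commutators of two isometric actions of `G ^ m` are given coordinatewise by an action
without invariants of the commutator subgroup, then the matrix coefficients of the products
`U u * V v` are small in mean square. -/
theorem sum_norm_inner_sq_le [FiniteDimensional ℂ E] {m : ℕ} (hm : 0 < m)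
    (U V W : (Fin m → G) →* Module.End ℂ E)
    (hU : ∀ g x y, ⟪U g x, U g y⟫_ℂ = ⟪x, y⟫_ℂ) (hV : ∀ g x y, ⟪V g x, V g y⟫_ℂ = ⟪x, y⟫_ℂ)
    (hW : ∀ g x y, ⟪W g x, W g y⟫_ℂ = ⟪x, y⟫_ℂ)
    (hcomm : ∀ u v, U u * V v = V v * U u * W (u⁻¹ * v⁻¹ * u * v))
    (h0 : ∀ i x, ∑ c : commutator G, W (Pi.mulSingle i (c : G)) x = 0) (φ ψ : E) :
    ∑ u, ∑ v, ‖⟪φ, U u (V v ψ)⟫_ℂ‖ ^ 2 ≤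
      (Fintype.card (Fin m → G) : ℝ) ^ 2 * (3 * (Fintype.card G : ℝ) ^ 2 / √m) *
        (‖φ‖ ^ 2 * ‖ψ‖ ^ 2) := by
  classical
  by_cases hφ0 : φ = 0
  · simp [hφ0]
  have hφpos : 0 < ‖φ‖ := norm_pos_iff.2 hφ0
  have : Nontrivial E := ⟨φ, 0, hφ0⟩
  set n : ℝ := (Fintype.card G : ℝ) with hn
  have hn1 : 1 ≤ n := by simp only [hn]; exact_mod_cast Fintype.card_pos (α := G)
  have hm0 : (0 : ℝ) < m := by exact_mod_cast hm
  obtain ⟨κ, P, Q, f, q, hP, hQ, hfP, hqQ, hf, hq, hκ, hκP, hκQ, hbound⟩ :=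
    exists_overlap U V hU hV ((‖φ‖⁻¹ : ℂ) • φ)
      (by rw [norm_smul, norm_inv, Complex.norm_real, norm_norm, inv_mul_cancel₀ hφpos.ne'])
  -- Otherwise dim P and dim Q are at most 1/κ < √m/3, so at least m/2 coordinates act by scalars on
  -- both subspaces, and the eigenvector bound fails.
  have hκle : κ ≤ 3 * n ^ 2 / √m := by
    by_contra! hcon
    have hκ0 : 0 < κ := lt_of_le_of_lt (by positivity) hcon
    have hκ2 : 9 * n ^ 4 / m < κ ^ 2 := by
      have : (3 * n ^ 2 / √m) ^ 2 < κ ^ 2 := by gcongr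
      rw [div_pow, Real.sq_sqrt hm0.le] at this
      refine lt_of_eq_of_lt ?_ this
      ring
    obtain ⟨B, hB, hBs⟩ := hP.exists_scalar_coordinates
    obtain ⟨B', hB', hBs'⟩ := hQ.exists_scalar_coordinates
    set I : Finset (Fin m) := (B ∪ B')ᶜ with hI
    set s := I.card with hs
    let j : Fin s ↪o Fin m := I.orderEmbOfFin rfl
    have hjI : ∀ i, j i ∈ I := fun i => I.orderEmbOfFin_mem rfl i
    let ext : (Fin s → G) →* (Fin m → G) := Function.ExtendByOne.hom G j
    have hext1 : ∀ (w : Fin s → G), ∀ i ∉ I, ext w i = 1 := by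
      intro w i hi
      change Function.extend j w 1 i = 1
      rw [Function.extend_apply' _ _ _ (by rintro ⟨k, rfl⟩; exact hi (hjI k))]
      rfl
    have hω := norm_inner_pow_four_le s (U.comp ext) (V.comp ext) (W.comp ext)
      (fun g x y => hU _ _ _) (fun g x y => hV _ _ _) (fun g x y => hW _ _ _)
      (fun u v => by
        simp only [MonoidHom.comp_apply, map_mul ext, map_inv ext]
        exact hcomm _ _)
      (fun i x => by
        have := h0 (j i) x
        refine Eq.trans (Finset.sum_congr rfl fun c _ => ?_) this
        rw [MonoidHom.comp_apply]
        congr 2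
        exact Function.extend_one_mulSingle j.injective i (c : G)) q f hq hf
      (fun u => by
        obtain ⟨c, hc⟩ := exists_eq_smul_of_support U Q I
          (fun i hi => hBs' i (by simp [hI] at hi; exact hi.2)) (ext u) (hext1 u)
        exact ⟨c, hc q hqQ⟩)
      (fun v => by
        obtain ⟨c, hc⟩ := exists_eq_smul_of_support V P I
          (fun i hi => hBs i (by simp [hI] at hi; exact hi.1)) (ext v) (hext1 v)
        exact ⟨c, hc f hfP⟩)
    have hcards : (m : ℝ) ≤ s + (Module.finrank ℂ P ^ 2 + Module.finrank ℂ Q ^ 2) := by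
      have h1 : (B ∪ B').card + s = m := by
        rw [hs, hI, Finset.card_add_card_compl, Fintype.card_fin]
      have h2 := Finset.card_union_le B B'
      have h3 : m ≤ s + (Module.finrank ℂ P ^ 2 + Module.finrank ℂ Q ^ 2) := by omega
      exact_mod_cast h3
    -- Each of the two exceptional sets has at most m/9 elements, which leaves s ≥ 7m/9.
    have hdim : ∀ r : ℝ, 0 ≤ r → r * κ ≤ 1 → r ^ 2 ≤ m / 9 := by
      intro r hr0 hr
      have h1 : r ^ 2 * κ ^ 2 ≤ 1 := by rw [← mul_pow]; exact pow_le_one₀ (by positivity) hr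
      have h2 : r ^ 2 * (9 * n ^ 4 / m) ≤ 1 := by nlinarith [sq_nonneg r]
      rw [mul_div_assoc', div_le_one hm0] at h2
      have : (1 : ℝ) ≤ n ^ 4 := one_le_pow₀ hn1
      nlinarith [sq_nonneg r]
    have hsm : (m : ℝ) / 2 ≤ s := by
      have := hdim _ (Nat.cast_nonneg _) hκP
      have := hdim _ (Nat.cast_nonneg _) hκQ
      linarith
    have hx1 : 1 / (4 * n ^ 4) ≤ 1 := by
      have : (1 : ℝ) ≤ n ^ 4 := one_le_pow₀ hn1
      rw [div_le_one (by positivity)]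
      linarith
    have hpow := one_sub_pow_mul_le_one (x := 1 / (4 * n ^ 4)) (by positivity) hx1 s
    have hκ4 : κ ^ 2 ≤ (1 - 1 / (4 * n ^ 4)) ^ s := by
      refine le_trans ?_ hω
      calc κ ^ 2 ≤ (‖⟪q, f⟫_ℂ‖ ^ 2) ^ 2 := by gcongr
        _ = _ := by ring
    have hfin : 9 * n ^ 4 / m * (m / 2 * (1 / (4 * n ^ 4))) ≤ 1 := by
      refine le_trans ?_ hpow
      have h2 := hκ2.le.trans hκ4
      gcongr
    -- The constant 3 in the bound is chosen so that this exceeds 1.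
    have : 9 * n ^ 4 / m * (m / 2 * (1 / (4 * n ^ 4))) = 9 / 8 := by field_simp; norm_num
    linarith
  have hb := hbound ψ
  have hscale : ∀ u v, ‖⟪(‖φ‖⁻¹ : ℂ) • φ, U u (V v ψ)⟫_ℂ‖ ^ 2 =
      (‖φ‖ ^ 2)⁻¹ * ‖⟪φ, U u (V v ψ)⟫_ℂ‖ ^ 2 := by
    intro u v
    rw [inner_smul_left, norm_mul, mul_pow]
    simp
  simp only [hscale, ← Finset.mul_sum] at hb
  rw [inv_mul_le_iff₀ (by positivity)] at hb
  refine hb.trans ?_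
  calc ‖φ‖ ^ 2 * ((Fintype.card (Fin m → G) : ℝ) ^ 2 * κ * ‖ψ‖ ^ 2)
      = (Fintype.card (Fin m → G) : ℝ) ^ 2 * κ * (‖φ‖ ^ 2 * ‖ψ‖ ^ 2) := by ring
    _ ≤ _ := by gcongr

end KeyBound

/-! ### Translations along fibres and their commutators. -/

section Translation

variable {G R : Type*} [Group G]

/-- Left translation on the functions on `R → G`. -/
noncomputable def leftTranslation (G R : Type*) [Group G] [Fintype G] [Fintype R] [DecidableEq R] :
    (R → G) →* Module.End ℂ (EuclideanSpace ℂ (R → G)) where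
  toFun g :=
    { toFun := fun f => WithLp.toLp 2 fun x => f (g⁻¹ * x)
      map_add' := fun _ _ => rfl
      map_smul' := fun _ _ => rfl }
  map_one' := by ext f x; simp
  map_mul' g h := by
    ext f x
    change f ((g * h)⁻¹ * x) = f (h⁻¹ * (g⁻¹ * x))
    rw [mul_inv_rev, mul_assoc]

@[simp]
theorem leftTranslation_apply [Fintype G] [Fintype R] [DecidableEq R] (g : R → G) (f : EuclideanSpace ℂ (R → G)) (x : R → G) :
    leftTranslation G R g f x = f (g⁻¹ * x) := rfl

theorem inner_leftTranslation [Fintype G] [Fintype R] [DecidableEq R] (g : R → G) (f f' : EuclideanSpace ℂ (R → G)) :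
    ⟪leftTranslation G R g f, leftTranslation G R g f'⟫_ℂ = ⟪f, f'⟫_ℂ := by
  simp only [PiLp.inner_apply, leftTranslation_apply]
  exact Equiv.sum_comp (Equiv.mulLeft g⁻¹) fun x => ⟪f x, f' x⟫_ℂ

/-- The functions on `R → G` whose average over the commutator subgroup vanishes in each of the
coordinates `a i`. -/
def commutatorMeanZero [Fintype G] [Fintype R] [DecidableEq R] [Fintype (commutator G)] {m : ℕ} (a : Fin m → R) : Submodule ℂ (EuclideanSpace ℂ (R → G)) where
  carrier := {f | ∀ i, ∀ x : R → G, ∑ c : commutator G, f (Pi.mulSingle (a i) (c : G) * x) = 0}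
  zero_mem' := by intro i x; simp
  add_mem' := by
    intro f f' hf hf' i x
    simp [Finset.sum_add_distrib, hf i x, hf' i x]
  smul_mem' := by
    intro k f hf i x
    simp [← Finset.mul_sum, hf i x]

theorem mulSingle_conj [DecidableEq R] (b : R) (g : R → G) (c : G) :
    g⁻¹ * Pi.mulSingle b c = Pi.mulSingle b ((g b)⁻¹ * c * g b) * g⁻¹ := by
  funext k
  by_cases hk : k = b
  · subst hk; simp
  · simp [hk]

/-- Conjugation by `g` on the commutator subgroup. -/
def commutatorConj (g : G) : commutator G ≃ commutator G :=
  (MulAut.conjNormal g).toEquiv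

@[simp]
theorem coe_commutatorConj (g : G) (c : commutator G) :
    (commutatorConj g c : G) = g * c * g⁻¹ := rfl

/-- K is normal: moving c past g⁻¹ conjugates it, and conjugation permutes K. -/
theorem leftTranslation_mem_commutatorMeanZero [Fintype G] [Fintype R] [DecidableEq R] [Fintype (commutator G)] 
    {m : ℕ} (a : Fin m → R) (g : R → G)
    (f : EuclideanSpace ℂ (R → G)) (hf : f ∈ commutatorMeanZero a) :
    leftTranslation G R g f ∈ commutatorMeanZero a := by
  intro i x
  refine Eq.trans (Finset.sum_congr rfl fun c _ => ?_)
    ((Equiv.sum_comp (commutatorConj (g (a i))⁻¹) fun c : commutator G =>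
      f (Pi.mulSingle (a i) (c : G) * (g⁻¹ * x))).trans (hf i (g⁻¹ * x)))
  rw [leftTranslation_apply, ← mul_assoc, mulSingle_conj, mul_assoc, coe_commutatorConj, inv_inv]

/-- Elements of `G ^ m`, placed in the fibres of `π` through the points `a i`. -/
noncomputable def fibreHom {m : ℕ} {L : Type*} (π : R → L) (a : Fin m → R) :
    (Fin m → G) →* (R → G) where
  toFun u := Function.extend (π ∘ a) u 1 ∘ π
  map_one' := by
    funext r
    exact congrFun (map_one (Function.ExtendByOne.hom G (π ∘ a))) (π r)
  map_mul' u v := by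
    funext r
    exact congrFun (map_mul (Function.ExtendByOne.hom G (π ∘ a)) u v) (π r)

theorem fibreHom_apply {m : ℕ} {L : Type*} {π : R → L} {a : Fin m → R}
    (h : Function.Injective (π ∘ a)) (u : Fin m → G) {r : R} {i : Fin m} (hr : π r = π (a i)) :
    fibreHom π a u r = u i := by
  change Function.extend (π ∘ a) u 1 (π r) = u i
  rw [hr]
  exact h.extend_apply u 1 i

theorem fibreHom_apply_eq_one {m : ℕ} {L : Type*} {π : R → L} {a : Fin m → R} (u : Fin m → G)
    {r : R} (hr : ∀ i, π r ≠ π (a i)) : fibreHom π a u r = 1 := by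
  change Function.extend (π ∘ a) u 1 (π r) = 1
  rw [Function.extend_apply' _ _ _ (by rintro ⟨i, hi⟩; exact hr i hi.symm)]
  rfl

/-- Fibres that meet in an induced matching have commutators located at the meeting points. -/
theorem fibreHom_mul_fibreHom {L : Type*} {m : ℕ} {π π' : R → L} {a : Fin m → R}
    (ha : ∀ i j r, π r = π (a i) → π' r = π' (a j) → i = j ∧ r = a i) (u v : Fin m → G) :
    fibreHom π a u * fibreHom π' a v =
      fibreHom π' a v * fibreHom π a u * fibreHom id a (u⁻¹ * v⁻¹ * u * v) := by
  have hinj : Function.Injective (π ∘ a) := fun i j h => (ha i j (a j) h.symm rfl).1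
  have hinj' : Function.Injective (π' ∘ a) := fun i j h => (ha i j (a i) rfl h).1
  have hinja : Function.Injective (id ∘ a) := hinj.of_comp
  funext r
  simp only [Pi.mul_apply]
  by_cases hr : ∃ i, π r = π (a i)
  · obtain ⟨i, hi⟩ := hr
    by_cases hr' : ∃ j, π' r = π' (a j)
    · obtain ⟨j, hj⟩ := hr'
      obtain ⟨rfl, hra⟩ := ha i j r hi hj
      rw [fibreHom_apply hinj u hi, fibreHom_apply hinj' v hj, fibreHom_apply hinja _ hra]
      simp only [Pi.mul_apply, Pi.inv_apply]
      group
    · push Not at hr'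
      rw [fibreHom_apply_eq_one v hr', fibreHom_apply_eq_one (π := id) _
        (fun k hk => hr' k (congrArg π' hk))]
      simp
  · push Not at hr
    rw [fibreHom_apply_eq_one u hr, fibreHom_apply_eq_one (π := id) _
        (fun k hk => hr k (congrArg π hk))]
    simp

theorem sum_leftTranslation_eq_zero [Fintype G] [Fintype R] [DecidableEq R]
    [Fintype (commutator G)] {m : ℕ} {a : Fin m → R} (ha : Function.Injective a) (i : Fin m)
    {f : EuclideanSpace ℂ (R → G)} (hf : f ∈ commutatorMeanZero a) :
    ∑ c : commutator G, leftTranslation G R (fibreHom id a (Pi.mulSingle i (c : G))) f = 0 := by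
  ext z
  have hx := hf i z
  rw [← Equiv.sum_comp (Equiv.inv (commutator G))] at hx
  simp only [WithLp.ofLp_sum, Finset.sum_apply, PiLp.zero_apply]
  refine Eq.trans (Finset.sum_congr rfl fun c _ => ?_) hx
  have : fibreHom (id : R → R) a (Pi.mulSingle i (c : G)) = Pi.mulSingle (a i) (c : G) :=
    Function.extend_one_mulSingle ha i (c : G)
  rw [this, leftTranslation_apply, ← Pi.mulSingle_inv]
  simp

end Translation

/-! ### Passing to the mean-zero subspace and to all translations along the fibres. -/

section Restriction

variable {Γ E : Type*} [Group Γ] [NormedAddCommGroup E] [InnerProductSpace ℂ E]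

/-- The restriction of a group action to an invariant subspace. -/
def restrictHom (T : Γ →* Module.End ℂ E) (S : Submodule ℂ E) (hS : ∀ g, ∀ x ∈ S, T g x ∈ S) :
    Γ →* Module.End ℂ S where
  toFun g := (T g).restrict (hS g)
  map_one' := by ext x; simp
  map_mul' g h := by ext x; simp

/-- `sum_norm_inner_sq_le` on an invariant subspace. -/
theorem sum_norm_inner_sq_le_of_mem {G : Type*} [Group G] [Fintype G] [Fintype (commutator G)]
    [FiniteDimensional ℂ E] {m : ℕ} (hm : 0 < m) (T : Γ →* Module.End ℂ E)
    (hT : ∀ g x y, ⟪T g x, T g y⟫_ℂ = ⟪x, y⟫_ℂ) (S : Submodule ℂ E)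
    (hS : ∀ g, ∀ x ∈ S, T g x ∈ S) (α β γ : (Fin m → G) →* Γ)
    (hcomm : ∀ u v, α u * β v = β v * α u * γ (u⁻¹ * v⁻¹ * u * v))
    (h0 : ∀ i, ∀ x ∈ S, ∑ c : commutator G, T (γ (Pi.mulSingle i (c : G))) x = 0)
    {φ ψ : E} (hφ : φ ∈ S) (hψ : ψ ∈ S) :
    ∑ u, ∑ v, ‖⟪φ, T (α u) (T (β v) ψ)⟫_ℂ‖ ^ 2 ≤
      (Fintype.card (Fin m → G) : ℝ) ^ 2 * (3 * (Fintype.card G : ℝ) ^ 2 / √m) *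
        (‖φ‖ ^ 2 * ‖ψ‖ ^ 2) := by
  let T' := restrictHom T S hS
  exact sum_norm_inner_sq_le hm (T'.comp α) (T'.comp β) (T'.comp γ)
    (fun g x y => hT _ _ _) (fun g x y => hT _ _ _) (fun g x y => hT _ _ _)
    (fun u v => by
      have := congrArg T' (hcomm u v)
      rw [map_mul, map_mul, map_mul] at this
      exact this)
    (fun i x => by
      ext
      rw [AddSubmonoidClass.coe_finsetSum]
      exact h0 i x x.2) ⟨φ, hφ⟩ ⟨ψ, hψ⟩

end Restriction

/-- A mean-square bound over a product of subgroups extends to the groups containing them. -/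
theorem sum_norm_inner_sq_le_of_subgroups {H Y Γ E : Type*} [Group H] [Fintype H] [Group Y]
    [Fintype Y] [Group Γ] [NormedAddCommGroup E] [InnerProductSpace ℂ E]
    (T : Γ →* Module.End ℂ E) (hT : ∀ g x y, ⟪T g x, T g y⟫_ℂ = ⟪x, y⟫_ℂ) (p p' : Y →* Γ)
    (e e' : H →* Y) (κ : ℝ) (S : Submodule ℂ E) (hS : ∀ g, ∀ x ∈ S, T g x ∈ S)
    (h : ∀ φ ∈ S, ∀ ψ ∈ S, ∑ u, ∑ v, ‖⟪φ, T (p (e u)) (T (p' (e' v)) ψ)⟫_ℂ‖ ^ 2 ≤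
      (Fintype.card H : ℝ) ^ 2 * κ * (‖φ‖ ^ 2 * ‖ψ‖ ^ 2)) {F : E} (hF : F ∈ S) :
    ∑ y, ∑ y', ‖⟪T (p y)⁻¹ F, T (p' y')⁻¹ F⟫_ℂ‖ ^ 2 ≤
      (Fintype.card Y : ℝ) ^ 2 * κ * (‖F‖ ^ 2) ^ 2 := by
  set N : ℝ := (Fintype.card H : ℝ) with hN
  have hN0 : 0 < N := by simp only [hN]; exact_mod_cast Fintype.card_pos
  set M : ℝ := (Fintype.card Y : ℝ) with hM
  -- Shifting y and y' by subgroup elements leaves the double sum unchanged; averaging over these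
  -- shifts brings in the bound `h` for each pair of translates of F.
  have hshift : ∀ u v : H,
      ∑ y, ∑ y', ‖⟪T (p y)⁻¹ F, T (p' y')⁻¹ F⟫_ℂ‖ ^ 2 =
      ∑ y, ∑ y', ‖⟪T (p y)⁻¹ F, T (p (e u)) (T (p' (e' v)) (T (p' y')⁻¹ F))⟫_ℂ‖ ^ 2 := by
    intro u v
    rw [← Equiv.sum_comp (Equiv.mulRight (e u))]
    refine Finset.sum_congr rfl fun y _ => ?_
    rw [← Equiv.sum_comp (Equiv.mulRight (e' v)⁻¹)]
    refine Finset.sum_congr rfl fun y' _ => ?_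
    congr 2
    simp only [Equiv.coe_mulRight, map_mul p, map_mul p', map_inv p', mul_inv_rev, inv_inv, map_mul T,
      Module.End.mul_apply]
    rw [inner_map_left_of_isometric hT, inv_inv]
  refine le_of_mul_le_mul_left (a := N ^ 2) ?_ (by positivity)
  calc N ^ 2 * ∑ y, ∑ y', ‖⟪T (p y)⁻¹ F, T (p' y')⁻¹ F⟫_ℂ‖ ^ 2
      = ∑ u : H, ∑ v : H, ∑ y, ∑ y', ‖⟪T (p y)⁻¹ F, T (p' y')⁻¹ F⟫_ℂ‖ ^ 2 := by
        rw [Finset.sum_const, Finset.sum_const, Finset.card_univ, smul_smul, nsmul_eq_mul, hN]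
        push_cast
        ring
    _ = ∑ u : H, ∑ v : H, ∑ y, ∑ y',
          ‖⟪T (p y)⁻¹ F, T (p (e u)) (T (p' (e' v)) (T (p' y')⁻¹ F))⟫_ℂ‖ ^ 2 :=
        Finset.sum_congr rfl fun u _ => Finset.sum_congr rfl fun v _ => hshift u v
    _ = ∑ y, ∑ y', ∑ u : H, ∑ v : H,
          ‖⟪T (p y)⁻¹ F, T (p (e u)) (T (p' (e' v)) (T (p' y')⁻¹ F))⟫_ℂ‖ ^ 2 := by
        have hswap : ∀ Φ : H → H → Y → Y → ℝ, ∑ u, ∑ v, ∑ y, ∑ y', Φ u v y y' =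
            ∑ y, ∑ y', ∑ u, ∑ v, Φ u v y y' := fun Φ =>
          calc _ = ∑ b : H × H, ∑ c : Y × Y, Φ b.1 b.2 c.1 c.2 := by
                simp only [Fintype.sum_prod_type]
            _ = ∑ c : Y × Y, ∑ b : H × H, Φ b.1 b.2 c.1 c.2 := Finset.sum_comm
            _ = _ := by simp only [Fintype.sum_prod_type]
        exact hswap _
    _ ≤ ∑ _y : Y, ∑ _y' : Y, N ^ 2 * κ * (‖F‖ ^ 2 * ‖F‖ ^ 2) := by
        refine Finset.sum_le_sum fun y _ => Finset.sum_le_sum fun y' _ => ?_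
        refine (h _ (hS _ _ hF) _ (hS _ _ hF)).trans_eq ?_
        rw [norm_map_of_isometric hT, norm_map_of_isometric hT]
    _ = _ := by
        rw [Finset.sum_const, Finset.sum_const, Finset.card_univ, smul_smul, nsmul_eq_mul, hM]
        push_cast
        ring

/-- Composition with `π`. -/
def pullbackHom {L R : Type*} (G : Type*) [Group G] (π : R → L) : (L → G) →* (R → G) where
  toFun y := y ∘ π
  map_one' := rfl
  map_mul' _ _ := rfl

/-- The correlation bound: translates of `f` along the fibres of `π` and of `π'` are almost
uncorrelated if these fibres meet in an induced matching of size `m`. -/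
theorem sum_correlation_sq_le {G R L : Type*} [Group G] [Fintype G] [Fintype (commutator G)]
    [Fintype R] [DecidableEq R] [Fintype L] [DecidableEq L] {m : ℕ} (hm : 0 < m)
    (π π' : R → L) (a : Fin m → R)
    (ha : ∀ i j r, π r = π (a i) → π' r = π' (a j) → i = j ∧ r = a i)
    (f : (R → G) → ℝ)
    (hf : ∀ i, ∀ x : R → G, ∑ c : commutator G, f (Pi.mulSingle (a i) (c : G) * x) = 0) :
    ∑ y : L → G, ∑ y' : L → G, (∑ x, f ((y ∘ π) * x) * f ((y' ∘ π') * x)) ^ 2 ≤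
      (Fintype.card (L → G) : ℝ) ^ 2 * (3 * (Fintype.card G : ℝ) ^ 2 / √m) *
        (∑ x, f x ^ 2) ^ 2 := by
  have hinja : Function.Injective a :=
    Function.Injective.of_comp (f := π) fun i j h => (ha i j (a j) h.symm rfl).1
  let F : EuclideanSpace ℂ (R → G) := WithLp.toLp 2 fun x => (f x : ℂ)
  have hF : F ∈ commutatorMeanZero a := by
    intro i x
    have := hf i x
    simp only [F]
    exact_mod_cast this
  have hcorr : ∀ g g' : R → G,
      ‖⟪leftTranslation G R g⁻¹ F, leftTranslation G R g'⁻¹ F⟫_ℂ‖ ^ 2 =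
        (∑ x, f (g * x) * f (g' * x)) ^ 2 := by
    intro g g'
    have : ⟪leftTranslation G R g⁻¹ F, leftTranslation G R g'⁻¹ F⟫_ℂ =
        ((∑ x, f (g * x) * f (g' * x) : ℝ) : ℂ) := by
      rw [PiLp.inner_apply]
      push_cast
      refine Finset.sum_congr rfl fun x _ => ?_
      simp [F, mul_comm]
    rw [this, Complex.norm_real, Real.norm_eq_abs, sq_abs]
  have hFnorm : ‖F‖ ^ 2 = ∑ x, f x ^ 2 := by
    rw [EuclideanSpace.norm_sq_eq]
    simp [F]
  rw [← hFnorm]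
  have hsub := sum_norm_inner_sq_le_of_subgroups (H := Fin m → G) (leftTranslation G R)
    inner_leftTranslation (pullbackHom G π) (pullbackHom G π')
    (Function.ExtendByOne.hom G (π ∘ a)) (Function.ExtendByOne.hom G (π' ∘ a))
    (3 * (Fintype.card G : ℝ) ^ 2 / √m) (commutatorMeanZero a)
    (leftTranslation_mem_commutatorMeanZero a)
    (fun φ hφ ψ hψ => sum_norm_inner_sq_le_of_mem hm (leftTranslation G R) inner_leftTranslation
      (commutatorMeanZero a) (leftTranslation_mem_commutatorMeanZero a) (fibreHom π a)
      (fibreHom π' a) (fibreHom id a) (fibreHom_mul_fibreHom ha)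
      (fun i x hx => sum_leftTranslation_eq_zero hinja i hx) hφ hψ) hF
  refine le_trans (le_of_eq ?_) hsub
  exact Finset.sum_congr rfl fun y _ => Finset.sum_congr rfl fun y' _ => (hcorr _ _).symm

/-! ### The decomposition of functions on a power of `G` relative to the commutator subgroup -/

open scoped BigOperators

theorem mulSingle_mem_commutator {G R : Type*} [Group G] [DecidableEq R] (b : R) (k : commutator G) (a : R) :
    (Pi.mulSingle b (k : G) : R → G) a ∈ commutator G := by
  by_cases h : a = b
  · subst h; simp
  · simp [h, one_mem]

section Kernels

variable {G : Type*} [Group G]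

open Classical in
/-- The uniform density on the commutator subgroup. -/
noncomputable def commutatorDensity (g : G) : ℝ :=
  if g ∈ commutator G then 1 / (Nat.card (commutator G) : ℝ) else 0

open Classical in
/-- The point mass at `1` minus the uniform density on the commutator subgroup. -/
noncomputable def commutatorDefect (g : G) : ℝ :=
  (if g = 1 then 1 else 0) - commutatorDensity g

theorem commutatorDensity_mul {k : G} (hk : k ∈ commutator G) (g : G) :
    commutatorDensity (k * g) = commutatorDensity g := by
  classical
  exact if_congr (Subgroup.mul_mem_cancel_left _ hk) rfl rfl

/-- A class function, because K is normal. This is what makes the decomposition compatible with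
translations by all of G, not only by K. -/
theorem commutatorDensity_mul_comm (g h : G) :
    commutatorDensity (g * h) = commutatorDensity (h * g) := by
  have : g * h ∈ commutator G ↔ h * g ∈ commutator G :=
    (inferInstance : (commutator G).Normal).mem_comm_iff
  classical
  exact if_congr this rfl rfl

theorem commutatorDefect_mul_comm (g h : G) :
    commutatorDefect (g * h) = commutatorDefect (h * g) := by
  have : g * h = 1 ↔ h * g = 1 := mul_eq_one_comm
  unfold commutatorDefect
  rw [commutatorDensity_mul_comm g h]
  classical
  exact congrArg (· - _) (if_congr this rfl rfl)

theorem sum_commutatorDefect [Fintype (commutator G)] (g : G) :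
    ∑ k : commutator G, commutatorDefect ((k : G) * g) = 0 := by
  classical
  have hK : (Nat.card (commutator G) : ℝ) ≠ 0 := by
    exact_mod_cast Nat.card_pos.ne'
  simp only [commutatorDefect, commutatorDensity_mul (Subtype.property _), Finset.sum_sub_distrib,
    Finset.sum_const, Finset.card_univ, nsmul_eq_mul]
  rw [← Nat.card_eq_fintype_card, commutatorDensity]
  by_cases hg : g ∈ commutator G
  -- Within the coset K the point mass is met exactly once, at g⁻¹, and cancels the total density 1;
  -- off K both parts vanish.
  · rw [if_pos hg, mul_one_div_cancel hK, Finset.sum_eq_single (⟨g, hg⟩⁻¹ : commutator G)]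
    · simp
    · intro k _ hk
      rw [if_neg]
      intro h
      exact hk (Subtype.ext (by simpa using eq_inv_of_mul_eq_one_left h))
    · simp
  · rw [if_neg hg, mul_zero, sub_zero]
    refine Finset.sum_eq_zero fun k _ => if_neg fun h => hg ?_
    rw [eq_inv_of_mul_eq_one_right h]
    exact inv_mem k.2

theorem abs_commutatorDefect_le_one [Finite G] (g : G) : |commutatorDefect g| ≤ 1 := by
  have hK : (1 : ℝ) ≤ Nat.card (commutator G) := by exact_mod_cast Nat.card_pos
  have h1 : 1 / (Nat.card (commutator G) : ℝ) ≤ 1 := by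
    rw [div_le_one (by positivity)]; exact hK
  have h0 : 0 ≤ 1 / (Nat.card (commutator G) : ℝ) := by positivity
  unfold commutatorDefect commutatorDensity
  rw [abs_le]
  split_ifs <;> constructor <;> linarith

variable {R : Type*} [Fintype R] [DecidableEq R]

/-- The convolution kernel of the projection `component S`. -/
noncomputable def componentKernel (S : Finset R) (c : R → G) : ℝ :=
  ∏ a, if a ∈ S then commutatorDefect (c a) else commutatorDensity (c a)

theorem componentKernel_mul (S : Finset R) {k : R → G} (hk : ∀ a, k a ∈ commutator G)
    (hS : ∀ a ∈ S, k a = 1) (c : R → G) : componentKernel S (k * c) = componentKernel S c := by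
  refine Finset.prod_congr rfl fun a _ => ?_
  by_cases ha : a ∈ S
  · simp [ha, hS a ha]
  · simp [ha, commutatorDensity_mul (hk a)]

theorem componentKernel_mul_comm (S : Finset R) (c d : R → G) :
    componentKernel S (c * d) = componentKernel S (d * c) := by
  refine Finset.prod_congr rfl fun a _ => ?_
  simp only [Pi.mul_apply, commutatorDefect_mul_comm (c a), commutatorDensity_mul_comm (c a)]

theorem sum_componentKernel_mulSingle [Fintype (commutator G)] {S : Finset R} {b : R} (hb : b ∈ S)
    (c : R → G) : ∑ k : commutator G, componentKernel S (Pi.mulSingle b (k : G) * c) = 0 := by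
  have : ∀ k : commutator G, componentKernel S (Pi.mulSingle b (k : G) * c) =
      commutatorDefect ((k : G) * c b) * ∏ a ∈ Finset.univ.erase b,
        if a ∈ S then commutatorDefect (c a) else commutatorDensity (c a) := by
    intro k
    rw [componentKernel, ← Finset.mul_prod_erase _ _ (Finset.mem_univ b)]
    congr 1
    · simp [hb]
    · refine Finset.prod_congr rfl fun a ha => ?_
      simp [Pi.mulSingle_eq_of_ne (Finset.ne_of_mem_erase ha)]
  simp only [this, ← Finset.sum_mul, sum_commutatorDefect, zero_mul]

-- Each coordinate splits the point mass at 1 as defect plus density; multiplying out the product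
-- over the coordinates gives the sum over S. Hence the components add up to the function.
open Classical in
theorem sum_componentKernel (c : R → G) :
    ∑ S : Finset R, componentKernel S c = if c = 1 then 1 else 0 := by
  have h1 : ∀ S : Finset R, componentKernel S c =
      (∏ a ∈ S, commutatorDefect (c a)) * ∏ a ∈ Finset.univ \ S, commutatorDensity (c a) := by
    intro S
    rw [componentKernel, Finset.prod_ite]
    congr 1
    · congr 1; ext; simp
    · congr 1; ext; simp
  simp only [h1]
  rw [← Finset.powerset_univ, ← Finset.prod_add]
  simp only [commutatorDefect, sub_add_cancel]
  rw [Finset.prod_boole]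
  simp [funext_iff]

variable [Fintype G]

/-- The component of a function on `R → G` at a set `S` of coordinates: it is invariant under the
commutator subgroup in the coordinates outside `S`, and its average over the commutator subgroup
vanishes in the coordinates in `S`. -/
noncomputable def component (S : Finset R) : ((R → G) → ℝ) →ₗ[ℝ] ((R → G) → ℝ) where
  toFun f x := ∑ c : R → G, componentKernel S c * f (c⁻¹ * x)
  map_add' f g := by
    funext x
    simp [mul_add, Finset.sum_add_distrib]
  map_smul' r f := by
    funext x
    simp [Finset.mul_sum, mul_left_comm]

theorem component_apply (S : Finset R) (f : (R → G) → ℝ) (x : R → G) :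
    component S f x = ∑ c : R → G, componentKernel S c * f (c⁻¹ * x) := rfl

theorem sum_component (f : (R → G) → ℝ) (x : R → G) : ∑ S : Finset R, component S f x = f x := by
  classical
  simp only [component_apply]
  rw [Finset.sum_comm]
  simp only [← Finset.sum_mul, sum_componentKernel]
  simp

theorem component_translate (S : Finset R) (f : (R → G) → ℝ) (g x : R → G) :
    component S (fun x => f (g * x)) x = component S f (g * x) := by
  simp only [component_apply]
  -- Left translation does not commute with a general convolution on this side; it does here since
  -- the kernel is invariant under conjugation.
  rw [← Equiv.sum_comp (MulAut.conj g).toEquiv fun c => componentKernel S c * f (c⁻¹ * (g * x))]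
  refine Finset.sum_congr rfl fun c _ => ?_
  change _ = componentKernel S (g * c * g⁻¹) * f ((g * c * g⁻¹)⁻¹ * (g * x))
  rw [componentKernel_mul_comm S (g * c)]
  congr 2 <;> group

theorem component_mul_of_mem (S : Finset R) (f : (R → G) → ℝ) {k : R → G}
    (hk : ∀ a, k a ∈ commutator G) (hS : ∀ a ∈ S, k a = 1) (x : R → G) :
    component S f (k * x) = component S f x := by
  simp only [component_apply]
  rw [← Equiv.sum_comp (Equiv.mulLeft k)]
  refine Finset.sum_congr rfl fun c _ => ?_
  rw [Equiv.coe_mulLeft, componentKernel_mul S hk hS]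
  congr 2
  group

theorem component_mulSingle_of_notMem {S : Finset R} {b : R} (hb : b ∉ S) (f : (R → G) → ℝ)
    (k : commutator G) (x : R → G) :
    component S f (Pi.mulSingle b (k : G) * x) = component S f x :=
  component_mul_of_mem S f (mulSingle_mem_commutator b k)
    (fun _ ha => Pi.mulSingle_eq_of_ne (ne_of_mem_of_not_mem ha hb) _) x

variable [Fintype (commutator G)]

theorem sum_component_mulSingle {S : Finset R} {b : R} (hb : b ∈ S) (f : (R → G) → ℝ)
    (x : R → G) : ∑ k : commutator G, component S f (Pi.mulSingle b (k : G) * x) = 0 := by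
  have : ∀ k : commutator G, component S f (Pi.mulSingle b (k : G) * x) =
      ∑ c : R → G, componentKernel S (Pi.mulSingle b (k : G) * c) * f (c⁻¹ * x) := by
    intro k
    rw [component_apply, ← Equiv.sum_comp (Equiv.mulLeft (Pi.mulSingle b (k : G)))]
    refine Finset.sum_congr rfl fun c _ => ?_
    rw [Equiv.coe_mulLeft]
    congr 2
    group
  simp only [this]
  rw [Finset.sum_comm]
  simp only [← Finset.sum_mul, sum_componentKernel_mulSingle hb, zero_mul, Finset.sum_const_zero]

/-- Averaging over k at coordinate b puts k both in the kernel and in f. If one of the two is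
invariant in that coordinate and the other has mean zero, the sum vanishes; both combinations are
used next. -/
theorem card_smul_component (S : Finset R) (b : R) (f : (R → G) → ℝ) (x : R → G) :
    (Fintype.card (commutator G) : ℝ) * component S f x = ∑ k : commutator G, ∑ c : R → G,
      componentKernel S (Pi.mulSingle b (k : G) * c) *
        f ((Pi.mulSingle b (k : G))⁻¹ * (c⁻¹ * x)) := by
  have : ∀ k : commutator G, component S f x = ∑ c : R → G,
      componentKernel S (Pi.mulSingle b (k : G) * c) *
        f ((Pi.mulSingle b (k : G))⁻¹ * (c⁻¹ * x)) := by
    intro k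
    rw [component_apply, ← Equiv.sum_comp (Equiv.mulRight (Pi.mulSingle b (k : G)))]
    refine Finset.sum_congr rfl fun c _ => ?_
    rw [Equiv.coe_mulRight, componentKernel_mul_comm]
    congr 2
    group
  rw [← Finset.sum_congr rfl fun k _ => this k]
  simp

theorem component_eq_zero_of_invariant {S : Finset R} {b : R} (hb : b ∈ S) {f : (R → G) → ℝ}
    (hf : ∀ (k : commutator G) (x : R → G), f (Pi.mulSingle b (k : G) * x) = f x) :
    component S f = 0 := by
  funext x
  have h := card_smul_component S b f x
  have hf' : ∀ (k : commutator G) (x : R → G), f ((Pi.mulSingle b (k : G))⁻¹ * x) = f x := by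
    intro k x
    rw [← Pi.mulSingle_inv]
    exact hf k⁻¹ x
  simp only [hf'] at h
  rw [Finset.sum_comm] at h
  simp only [← Finset.sum_mul, sum_componentKernel_mulSingle hb, zero_mul,
    Finset.sum_const_zero] at h
  exact (mul_eq_zero.1 h).resolve_left (by simp)

theorem component_eq_zero_of_sum_eq_zero {S : Finset R} {b : R} (hb : b ∉ S) {f : (R → G) → ℝ}
    (hf : ∀ x : R → G, ∑ k : commutator G, f (Pi.mulSingle b (k : G) * x) = 0) :
    component S f = 0 := by
  funext x
  have h := card_smul_component S b f x
  have hκ : ∀ (k : commutator G) (c : R → G),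
      componentKernel S (Pi.mulSingle b (k : G) * c) = componentKernel S c := fun k c =>
    componentKernel_mul S (mulSingle_mem_commutator b k)
      (fun a ha => Pi.mulSingle_eq_of_ne (ne_of_mem_of_not_mem ha hb) _) c
  simp only [hκ] at h
  rw [Finset.sum_comm] at h
  have hf' : ∀ x : R → G, ∑ k : commutator G, f ((Pi.mulSingle b (k : G))⁻¹ * x) = 0 := by
    intro x
    rw [← hf x, ← Equiv.sum_comp (Equiv.inv (commutator G))]
    refine Finset.sum_congr rfl fun k _ => ?_
    simp [← Pi.mulSingle_inv]
  simp only [← Finset.mul_sum, hf', mul_zero, Finset.sum_const_zero] at h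
  exact (mul_eq_zero.1 h).resolve_left (by simp)

/-- Translating x by k at b changes f only; averaging over k annihilates it. This is the
orthogonality of different components, which differ in type at some coordinate. -/
theorem sum_mul_eq_zero_of_coordinate (b : R) {f g : (R → G) → ℝ}
    (hf : ∀ x : R → G, ∑ k : commutator G, f (Pi.mulSingle b (k : G) * x) = 0)
    (hg : ∀ (k : commutator G) (x : R → G), g (Pi.mulSingle b (k : G) * x) = g x) :
    ∑ x, f x * g x = 0 := by
  have h : ∀ k : commutator G,
      ∑ x, f x * g x = ∑ x : R → G, f (Pi.mulSingle b (k : G) * x) * g x := by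
    intro k
    rw [← Equiv.sum_comp (Equiv.mulLeft (Pi.mulSingle b (k : G)))]
    refine Finset.sum_congr rfl fun x _ => ?_
    rw [Equiv.coe_mulLeft, hg]
  have h2 : (Fintype.card (commutator G) : ℝ) * ∑ x, f x * g x = 0 := by
    rw [← nsmul_eq_mul, ← Finset.card_univ, ← Finset.sum_const,
      Finset.sum_congr rfl fun k _ => h k, Finset.sum_comm]
    simp [← Finset.sum_mul, hf]
  exact (mul_eq_zero.1 h2).resolve_left (by simp)

theorem sum_component_mul_component_of_ne {S S' : Finset R} (h : S ≠ S') (f g : (R → G) → ℝ) :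
    ∑ x, component S f x * component S' g x = 0 := by
  have : ∃ b, (b ∈ S ∧ b ∉ S') ∨ (b ∈ S' ∧ b ∉ S) := by
    by_contra! hcon
    exact h (Finset.ext fun b => ⟨(hcon b).1, (hcon b).2⟩)
  obtain ⟨b, ⟨h1, h2⟩ | ⟨h1, h2⟩⟩ := this
  · exact sum_mul_eq_zero_of_coordinate b (sum_component_mulSingle h1 f)
      (component_mulSingle_of_notMem h2 g)
  · simp only [mul_comm (component S f _)]
    exact sum_mul_eq_zero_of_coordinate b (sum_component_mulSingle h1 g)
      (component_mulSingle_of_notMem h2 f)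

theorem sum_mul_eq_sum_component (f g : (R → G) → ℝ) :
    ∑ x, f x * g x = ∑ S : Finset R, ∑ x, component S f x * component S g x := by
  calc ∑ x, f x * g x
      = ∑ x, (∑ S : Finset R, component S f x) * ∑ S' : Finset R, component S' g x := by
        simp only [sum_component]
    _ = ∑ S : Finset R, ∑ S' : Finset R, ∑ x, component S f x * component S' g x := by
        simp only [Finset.sum_mul_sum]
        rw [Finset.sum_comm]
        refine Finset.sum_congr rfl fun S _ => Finset.sum_comm
    _ = _ := by
        refine Finset.sum_congr rfl fun S _ => ?_
        rw [Finset.sum_eq_single S (fun S' _ h =>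
          sum_component_mul_component_of_ne (Ne.symm h) f g) (by simp)]

end Kernels

/-! ### Correlations along a projection -/

section Expect

variable {ι : Type*} [Fintype ι]

/-- The mean square of a function on a finite type. -/
noncomputable def meanSq (f : ι → ℝ) : ℝ := 𝔼 x, f x ^ 2

theorem meanSq_nonneg (f : ι → ℝ) : 0 ≤ meanSq f :=
  Finset.expect_nonneg fun _ _ => sq_nonneg _

theorem expect_mul_sq_le (f g : ι → ℝ) : (𝔼 x, f x * g x) ^ 2 ≤ meanSq f * meanSq g := by
  simp only [meanSq, Fintype.expect_eq_sum_div_card]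
  rw [div_pow, div_mul_div_comm, ← sq]
  gcongr
  exact Finset.sum_mul_sq_le_sq_mul_sq _ _ _

theorem abs_expect_mul_le (f g : ι → ℝ) : |𝔼 x, f x * g x| ≤ √(meanSq f) * √(meanSq g) := by
  rw [← Real.sqrt_mul (meanSq_nonneg f)]
  exact Real.abs_le_sqrt (expect_mul_sq_le f g)

theorem expect_sq_le_meanSq (f : ι → ℝ) : (𝔼 x, f x) ^ 2 ≤ meanSq f := by
  cases isEmpty_or_nonempty ι
  · simp [meanSq]
  · have := expect_mul_sq_le f fun _ => 1
    simpa [meanSq] using this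

theorem abs_expect_le (f : ι → ℝ) : |𝔼 x, f x| ≤ 𝔼 x, |f x| :=
  Finset.abs_expect_le _ _

theorem expect_mono {f g : ι → ℝ} (h : ∀ x, f x ≤ g x) : 𝔼 x, f x ≤ 𝔼 x, g x :=
  Finset.expect_le_expect fun x _ => h x

theorem meanSq_le_one {f : ι → ℝ} (hf : ∀ x, |f x| ≤ 1) : meanSq f ≤ 1 := by
  cases isEmpty_or_nonempty ι
  · simp [meanSq]
  · refine (expect_mono fun x => ?_).trans_eq (Fintype.expect_const (1 : ℝ))
    rw [sq_le_one_iff_abs_le_one]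
    exact hf x

/-- If the functions `N ω i`, `i < k`, are almost uncorrelated on average, then their overall
mean has small correlation with any function. -/
theorem expect_expect_mul_sq_le {Ω : Type*} [Fintype Ω] [Nonempty Ω] {k : ℕ} (hk : 0 < k)
    (N : Ω → Fin k → ι → ℝ) (a : ι → ℝ) {B η : ℝ} (hη : 0 ≤ η) (hB : ∀ ω i, meanSq (N ω i) ≤ B)
    (hN : ∀ i j, i ≠ j → 𝔼 ω, |𝔼 x, N ω i x * N ω j x| ≤ η * B) :
    (𝔼 ω, 𝔼 i, 𝔼 x, a x * N ω i x) ^ 2 ≤ meanSq a * ((1 / k + η) * B) := by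
  have : Nonempty (Fin k) := ⟨⟨0, hk⟩⟩
  have hk0 : (0 : ℝ) < k := by exact_mod_cast hk
  have hB0 : 0 ≤ B := (meanSq_nonneg _).trans (hB (Classical.arbitrary Ω) ⟨0, hk⟩)
  have h1 : 𝔼 ω, 𝔼 i, 𝔼 x, a x * N ω i x = 𝔼 x, a x * 𝔼 ω, 𝔼 i, N ω i x := by
    simp only [Finset.mul_expect]
    rw [Finset.expect_comm]
    refine Eq.trans ?_ (Finset.expect_congr rfl fun x _ => rfl)
    calc 𝔼 i, 𝔼 ω, 𝔼 x, a x * N ω i x = 𝔼 i, 𝔼 x, 𝔼 ω, a x * N ω i x :=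
          Finset.expect_congr rfl fun i _ => Finset.expect_comm _ _ _
      _ = 𝔼 x, 𝔼 i, 𝔼 ω, a x * N ω i x := Finset.expect_comm _ _ _
      _ = _ := Finset.expect_congr rfl fun x _ => Finset.expect_comm _ _ _
  rw [h1]
  refine (expect_mul_sq_le _ _).trans ?_
  refine mul_le_mul_of_nonneg_left ?_ (meanSq_nonneg a)
  -- Only the mean over i is expanded into pairs: Jensen keeps ω outside the square, so almost
  -- orthogonality is needed only for the same ω. The diagonal has weight 1/k.
  calc meanSq (fun x => 𝔼 ω, 𝔼 i, N ω i x)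
      ≤ 𝔼 x, 𝔼 ω, (𝔼 i, N ω i x) ^ 2 := expect_mono fun x => expect_sq_le_meanSq _
    _ = 𝔼 ω, 𝔼 i, 𝔼 j, 𝔼 x, N ω i x * N ω j x := by
        rw [Finset.expect_comm]
        refine Finset.expect_congr rfl fun ω _ => ?_
        simp only [sq, Finset.expect_mul_expect]
        rw [Finset.expect_comm]
        exact Finset.expect_congr rfl fun i _ => Finset.expect_comm _ _ _
    _ = 𝔼 i, 𝔼 j, 𝔼 ω, 𝔼 x, N ω i x * N ω j x := by
        rw [Finset.expect_comm]
        exact Finset.expect_congr rfl fun i _ => Finset.expect_comm _ _ _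
    _ ≤ 𝔼 i : Fin k, 𝔼 j : Fin k, ((if i = j then B else 0) + η * B) := by
        refine expect_mono fun i => expect_mono fun j => ?_
        by_cases hij : i = j
        · subst hij
          rw [if_pos rfl]
          have h2 : 𝔼 ω, 𝔼 x, N ω i x * N ω i x ≤ B := by
            refine (expect_mono fun ω => ?_).trans_eq (Fintype.expect_const B)
            have := hB ω i
            simpa only [meanSq, sq] using this
          have : 0 ≤ η * B := mul_nonneg hη hB0
          linarith
        · rw [if_neg hij, zero_add]
          exact (expect_mono fun ω => le_abs_self _).trans (hN i j hij)
    _ = (1 / k + η) * B := by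
        simp only [Finset.expect_add_distrib, Fintype.expect_const]
        simp only [Fintype.expect_eq_sum_div_card, Finset.sum_ite_eq, Finset.mem_univ, if_true,
          Finset.sum_const, Finset.card_univ, Fintype.card_fin, nsmul_eq_mul]
        field_simp

end Expect

/-! ### Correlations, fibre means and their components. -/

section Correlation

variable {G R L : Type*} [Group G] [Fintype G] [Fintype R] [DecidableEq R] [Fintype L]
  [DecidableEq L]

/-- The correlation of `a` with the translates of `b` by the elements constant on the fibres of
`π`, weighted by `h`. -/
noncomputable def correlation (π : R → L) (h : (L → G) → ℝ) (a b : (R → G) → ℝ) : ℝ :=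
  𝔼 y, h y * 𝔼 x, a x * b ((y ∘ π) * x)

theorem meanSq_translate (b : (R → G) → ℝ) (g : R → G) :
    meanSq (fun x => b (g * x)) = meanSq b :=
  Fintype.expect_equiv (Equiv.mulLeft g) _ _ fun _ => rfl

theorem abs_correlation_le (π : R → L) {h : (L → G) → ℝ} (hh : ∀ y, |h y| ≤ 1)
    (a b : (R → G) → ℝ) : |correlation π h a b| ≤ √(meanSq a) * √(meanSq b) := by
  refine (abs_expect_le _).trans ((expect_mono fun y => ?_).trans_eq (Fintype.expect_const _))
  rw [abs_mul]
  have h1 := abs_expect_mul_le a fun x => b ((y ∘ π) * x)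
  rw [meanSq_translate] at h1
  calc |h y| * |𝔼 x, a x * b ((y ∘ π) * x)| ≤ 1 * |𝔼 x, a x * b ((y ∘ π) * x)| := by
        gcongr
        exact hh y
    _ ≤ _ := by rwa [one_mul]

/-- The mean of the translates of `b` by the elements constant on the fibres of `π`, weighted by
`h`. -/
noncomputable def fibreMean (π : R → L) (h : (L → G) → ℝ) (b : (R → G) → ℝ) (x : R → G) : ℝ :=
  𝔼 y, h y * b ((y ∘ π) * x)

theorem correlation_eq_expect_fibreMean (π : R → L) (h : (L → G) → ℝ) (a b : (R → G) → ℝ) :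
    correlation π h a b = 𝔼 x, a x * fibreMean π h b x := by
  simp only [correlation, fibreMean, Finset.mul_expect]
  rw [Finset.expect_comm]
  refine Finset.expect_congr rfl fun x _ => Finset.expect_congr rfl fun y _ => ?_
  ring

theorem meanSq_fibreMean_le (π : R → L) {h : (L → G) → ℝ} (hh : ∀ y, |h y| ≤ 1)
    (b : (R → G) → ℝ) : meanSq (fibreMean π h b) ≤ meanSq b := by
  calc meanSq (fibreMean π h b) ≤ 𝔼 x, 𝔼 y, (h y * b ((y ∘ π) * x)) ^ 2 :=
        expect_mono fun x => expect_sq_le_meanSq _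
    _ = 𝔼 y, 𝔼 x, (h y * b ((y ∘ π) * x)) ^ 2 := Finset.expect_comm _ _ _
    _ ≤ 𝔼 y : L → G, meanSq b := by
        refine expect_mono fun y => ?_
        rw [← meanSq_translate b (y ∘ π)]
        refine expect_mono fun x => ?_
        rw [mul_pow]
        have : h y ^ 2 ≤ 1 := (sq_le_one_iff_abs_le_one _).2 (hh y)
        nlinarith [sq_nonneg (b ((y ∘ π) * x))]
    _ = _ := Fintype.expect_const _

variable [Fintype (commutator G)]

theorem expect_mul_eq_sum_component (f g : (R → G) → ℝ) :
    𝔼 x, f x * g x = ∑ S : Finset R, 𝔼 x, component S f x * component S g x := by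
  simp only [Fintype.expect_eq_sum_div_card]
  rw [sum_mul_eq_sum_component, Finset.sum_div]

theorem meanSq_eq_sum_component (f : (R → G) → ℝ) :
    meanSq f = ∑ S : Finset R, meanSq (component S f) := by
  simp only [meanSq, sq]
  exact expect_mul_eq_sum_component f f

theorem correlation_eq_sum_component (π : R → L) (h : (L → G) → ℝ) (a b : (R → G) → ℝ) :
    correlation π h a b = ∑ S : Finset R, correlation π h (component S a) (component S b) := by
  simp only [correlation]
  rw [← Finset.expect_sum_comm]
  refine Finset.expect_congr rfl fun y _ => ?_
  rw [expect_mul_eq_sum_component, Finset.mul_sum]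
  simp only [component_translate]

/-- The two conditions say that K is its own component at `T`; by orthogonality it sees only that
component of h. -/
theorem component_component_self_of (T : Finset L) {K : (L → G) → ℝ}
    (h1 : ∀ b ∉ T, ∀ (k : commutator G) (y : L → G), K (Pi.mulSingle b (k : G) * y) = K y)
    (h2 : ∀ b ∈ T, ∀ y : L → G, ∑ k : commutator G, K (Pi.mulSingle b (k : G) * y) = 0)
    (h : (L → G) → ℝ) : 𝔼 y, h y * K y = 𝔼 y, component T h y * K y := by
  have h0 : ∀ T', T' ≠ T → component T' K = 0 := by
    intro T' hT'
    have : ∃ b, (b ∈ T' ∧ b ∉ T) ∨ (b ∈ T ∧ b ∉ T') := by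
      by_contra! hcon
      exact hT' (Finset.ext fun b => ⟨(hcon b).1, (hcon b).2⟩)
    obtain ⟨b, ⟨hb, hb'⟩ | ⟨hb, hb'⟩⟩ := this
    · exact component_eq_zero_of_invariant hb (h1 b hb')
    · exact component_eq_zero_of_sum_eq_zero hb' (h2 b hb)
  have hK : component T K = K := by
    funext y
    rw [← sum_component K y, Finset.sum_eq_single T (fun T' _ hT' => by rw [h0 T' hT']; rfl)
      (by simp)]
  rw [expect_mul_eq_sum_component, Finset.sum_eq_single T (fun T' _ hT' => by
    rw [h0 T' hT']; simp) (by simp), hK]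

/-- Where `π` is injective on `S`, the components at `S` correlate only with the component of `h`
at the image of `S`. -/
theorem abs_correlation_component_le (π : R → L) (h : (L → G) → ℝ) (a b : (R → G) → ℝ)
    (S : Finset R) (hS : Set.InjOn π S) :
    |correlation π h (component S a) (component S b)| ≤
      √(meanSq (component (S.image π) h)) *
        (√(meanSq (component S a)) * √(meanSq (component S b))) := by
  set K : (L → G) → ℝ := fun y => 𝔼 x, component S a x * component S b ((y ∘ π) * x) with hK
  have hcomp : ∀ (l : L) (k : G) (y : L → G) (x : R → G),
      ((Pi.mulSingle l k * y) ∘ π) * x = (Pi.mulSingle l k ∘ π) * ((y ∘ π) * x) := by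
    intro l k y x
    rw [← mul_assoc]
    rfl
  have h1 : ∀ l ∉ S.image π, ∀ (k : commutator G) (y : L → G),
      K (Pi.mulSingle l (k : G) * y) = K y := by
    intro l hl k y
    refine Finset.expect_congr rfl fun x _ => ?_
    rw [hcomp, component_mul_of_mem]
    · exact fun r => mulSingle_mem_commutator l k (π r)
    · intro r hr
      exact Pi.mulSingle_eq_of_ne (ne_of_mem_of_not_mem (Finset.mem_image_of_mem π hr) hl) _
  have h2 : ∀ l ∈ S.image π, ∀ y : L → G,
      ∑ k : commutator G, K (Pi.mulSingle l (k : G) * y) = 0 := by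
    intro l hl y
    obtain ⟨s, hs, rfl⟩ := Finset.mem_image.1 hl
    simp only [hK]
    rw [← Finset.expect_sum_comm]
    refine Finset.expect_eq_zero fun x _ => ?_
    rw [← Finset.mul_sum]
    refine mul_eq_zero_of_right _ ?_
    rw [← sum_component_mulSingle hs b ((y ∘ π) * x)]
    refine Finset.sum_congr rfl fun k _ => ?_
    -- Translation by k on the whole fibre is k at s times elements of K at the other points of the
    -- fibre. By injectivity these lie outside S, where the component of b is K-invariant, so only
    -- the average at s remains.
    have hsplit : (Pi.mulSingle (π s) (k : G) ∘ π : R → G) =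
        ((Pi.mulSingle (π s) (k : G) ∘ π) * (Pi.mulSingle s (k : G))⁻¹) *
          Pi.mulSingle s (k : G) := by group
    rw [hcomp, hsplit, mul_assoc, component_mul_of_mem]
    · intro r
      exact mul_mem (mulSingle_mem_commutator (π s) k (π r))
        (inv_mem (mulSingle_mem_commutator s k r))
    · intro r hr
      by_cases hrs : r = s
      · subst hrs; simp
      · have : π r ≠ π s := fun h => hrs (hS hr hs h)
        simp [hrs, this]
  have h3 : correlation π h (component S a) (component S b) =
      𝔼 y, component (S.image π) h y * K y :=
    component_component_self_of (S.image π) h1 h2 h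
  rw [h3]
  refine (abs_expect_mul_le _ _).trans (mul_le_mul_of_nonneg_left ?_ (Real.sqrt_nonneg _))
  rw [← Real.sqrt_mul (meanSq_nonneg _)]
  refine Real.sqrt_le_sqrt ((expect_mono fun y => ?_).trans_eq (Fintype.expect_const _))
  refine (expect_mul_sq_le _ _).trans_eq ?_
  rw [meanSq_translate]

/-- Means along projections whose fibres meet in an induced matching are almost orthogonal. -/
theorem abs_expect_fibreMean_mul_le {m : ℕ} (hm : 0 < m) (π π' : R → L) (r : Fin m → R)
    (hr : ∀ i j s, π s = π (r i) → π' s = π' (r j) → i = j ∧ s = r i) {h h' : (L → G) → ℝ}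
    (hh : ∀ y, |h y| ≤ 1) (hh' : ∀ y, |h' y| ≤ 1) (b : (R → G) → ℝ)
    (hb : ∀ i, ∀ x : R → G, ∑ c : commutator G, b (Pi.mulSingle (r i) (c : G) * x) = 0) :
    |𝔼 x, fibreMean π h b x * fibreMean π' h' b x| ≤
      √(3 * (Fintype.card G : ℝ) ^ 2 / √m) * meanSq b := by
  set C : (L → G) → (L → G) → ℝ := fun y y' => 𝔼 x, b ((y ∘ π) * x) * b ((y' ∘ π') * x) with hC
  have h1 : 𝔼 x, fibreMean π h b x * fibreMean π' h' b x =
      𝔼 y, 𝔼 y', h y * h' y' * C y y' := by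
    have hx : ∀ x, fibreMean π h b x * fibreMean π' h' b x =
        𝔼 y, 𝔼 y', h y * b ((y ∘ π) * x) * (h' y' * b ((y' ∘ π') * x)) :=
      fun x => Fintype.expect_mul_expect _ _
    simp only [hx, hC, Finset.mul_expect]
    rw [Finset.expect_comm]
    refine Finset.expect_congr rfl fun y _ => ?_
    rw [Finset.expect_comm]
    refine Finset.expect_congr rfl fun y' _ => Finset.expect_congr rfl fun x _ => ?_
    ring
  have h2 : 𝔼 y, 𝔼 y', C y y' ^ 2 ≤ (3 * (Fintype.card G : ℝ) ^ 2 / √m) * meanSq b ^ 2 := by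
    have := sum_correlation_sq_le hm π π' r hr b hb
    simp only [hC, meanSq, Fintype.expect_eq_sum_div_card, div_pow]
    simp only [← Finset.sum_div]
    set M : ℝ := (Fintype.card (L → G) : ℝ) with hM
    have hM0 : 0 < M := by simp only [hM]; exact_mod_cast Fintype.card_pos
    rw [div_div, div_div, mul_div_assoc', div_le_div_iff₀ (by positivity) (by positivity)]
    calc _ ≤ _ := mul_le_mul_of_nonneg_right this (by positivity)
      _ = _ := by ring
  rw [h1]
  calc |𝔼 y, 𝔼 y', h y * h' y' * C y y'| ≤ 𝔼 y, 𝔼 y', |C y y'| := by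
        refine (abs_expect_le _).trans (expect_mono fun y => (abs_expect_le _).trans
          (expect_mono fun y' => ?_))
        rw [abs_mul, abs_mul]
        have := mul_le_one₀ (hh y) (abs_nonneg _) (hh' y')
        nlinarith [abs_nonneg (C y y')]
    _ ≤ √(𝔼 y, 𝔼 y', C y y' ^ 2) := by
        refine Real.le_sqrt_of_sq_le ((expect_sq_le_meanSq _).trans (expect_mono fun y => ?_))
        refine (expect_sq_le_meanSq _).trans (expect_mono fun y' => ?_)
        rw [sq_abs]
    _ ≤ √((3 * (Fintype.card G : ℝ) ^ 2 / √m) * meanSq b ^ 2) := Real.sqrt_le_sqrt h2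
    _ = _ := by rw [Real.sqrt_mul (by positivity), Real.sqrt_sq (meanSq_nonneg b)]

end Correlation

/-! ### Random positions -/

section Transitive

theorem expect_prod {A B : Type*} [Fintype A] [Fintype B] (F : A × B → ℝ) :
    𝔼 x, F x = 𝔼 a, 𝔼 b, F (a, b) := by
  rw [← Finset.univ_product_univ, Finset.expect_product]

theorem expect_prod_fst {A B : Type*} [Fintype A] [Fintype B] [Nonempty B] (F : A → ℝ) :
    𝔼 x : A × B, F x.1 = 𝔼 a, F a := by
  rw [expect_prod]
  exact Finset.expect_congr rfl fun a _ => Fintype.expect_const (F a)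

/-- A uniformly random group element moves any point of a transitive action to a uniformly random
point. -/
theorem expect_smul_eq {H X : Type*} [Group H] [Fintype H] [Fintype X] [MulAction H X]
    [MulAction.IsPretransitive H X] (F : X → ℝ) (x : X) : 𝔼 g : H, F (g • x) = 𝔼 y, F y := by
  have : Nonempty X := ⟨x⟩
  have h1 : ∀ y, 𝔼 g : H, F (g • y) = 𝔼 g : H, F (g • x) := by
    intro y
    obtain ⟨k, rfl⟩ := MulAction.exists_smul_eq H x y
    exact Fintype.expect_equiv (Equiv.mulRight k) _ _ fun g => by simp [mul_smul]
  calc 𝔼 g : H, F (g • x) = 𝔼 y : X, 𝔼 g : H, F (g • y) := by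
        simp only [h1]; exact (Fintype.expect_const _).symm
    _ = 𝔼 g : H, 𝔼 y : X, F (g • y) := Finset.expect_comm _ _ _
    _ = 𝔼 g : H, 𝔼 y, F y := Finset.expect_congr rfl fun g _ =>
        Fintype.expect_equiv (MulAction.toPerm g) _ _ fun y => rfl
    _ = _ := Fintype.expect_const _

end Transitive

/-! ### Permutations of blocks of positions. -/

section Blocks

variable {r t : ℕ}

/-- Permutations of the positions act on the sets of `t` positions. -/
def permBlock (g : Equiv.Perm (Fin r)) (T : {T : Finset (Fin r) // T.card = t}) :
    {T : Finset (Fin r) // T.card = t} :=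
  ⟨T.1.map g.toEmbedding, by rw [Finset.card_map, T.2]⟩

instance : MulAction (Equiv.Perm (Fin r)) {T : Finset (Fin r) // T.card = t} where
  smul := permBlock
  one_smul _ := Subtype.ext Finset.map_refl
  mul_smul g g' T := Subtype.ext (Finset.map_map g'.toEmbedding g.toEmbedding T.1).symm

theorem mem_smul_block (g : Equiv.Perm (Fin r)) (T : {T : Finset (Fin r) // T.card = t})
    (p : Fin r) : p ∈ (g • T).1 ↔ g⁻¹ p ∈ T.1 := by
  change p ∈ T.1.map g.toEmbedding ↔ _
  rw [Finset.mem_map_equiv]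
  rfl

instance : MulAction.IsPretransitive (Equiv.Perm (Fin r))
    {T : Finset (Fin r) // T.card = t} where
  exists_smul_eq T T' := by
    -- Any bijection between the two blocks extends to a permutation of all positions.
    have e : {p // p ∈ T.1} ≃ {p // p ∈ T'.1} :=
      Fintype.equivOfCardEq (by simp [T.2, T'.2])
    refine ⟨e.extendSubtype, Subtype.ext (Finset.eq_of_subset_of_card_le ?_ ?_)⟩
    · intro p hp
      rw [mem_smul_block] at hp
      have := e.extendSubtype_mem _ hp
      simpa using this
    · rw [(e.extendSubtype • T).2, T'.2]

theorem expect_perm_mem (T : {T : Finset (Fin r) // T.card = t}) (p : Fin r) :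
    (𝔼 g : Equiv.Perm (Fin r), if p ∈ (g • T).1 then (1 : ℝ) else 0) = t / r := by
  have h1 : (𝔼 g : Equiv.Perm (Fin r), if p ∈ (g • T).1 then (1 : ℝ) else 0) =
      𝔼 g : Equiv.Perm (Fin r), if g • p ∈ T.1 then (1 : ℝ) else 0 := by
    refine Fintype.expect_equiv (Equiv.inv _) _ _ fun g => ?_
    simp only [mem_smul_block]
    rfl
  rw [h1, expect_smul_eq (fun q => if q ∈ T.1 then (1 : ℝ) else 0) p,
    Fintype.expect_eq_sum_div_card]
  simp [T.2]

theorem expect_block_mem (ht : t ≤ r) (p : Fin r) :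
    (𝔼 T : {T : Finset (Fin r) // T.card = t}, if p ∈ T.1 then (1 : ℝ) else 0) = t / r := by
  obtain ⟨T, hT⟩ := Finset.exists_subset_card_eq (s := (Finset.univ : Finset (Fin r))) (n := t)
    (by simpa using ht)
  rw [← expect_perm_mem ⟨T, hT.2⟩ p]
  exact (expect_smul_eq (H := Equiv.Perm (Fin r))
    (fun T : {T : Finset (Fin r) // T.card = t} => if p ∈ T.1 then (1 : ℝ) else 0)
    ⟨T, hT.2⟩).symm

theorem exists_disjoint_blocks {k : ℕ} (h : k * t ≤ r) :
    ∃ I : Fin k → {T : Finset (Fin r) // T.card = t},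
      ∀ i j, i ≠ j → Disjoint (I i).1 (I j).1 := by
  have hinj : ∀ i : Fin k, Function.Injective
      fun j : Fin t => Fin.castLE h (finProdFinEquiv (i, j)) := by
    intro i j j' hj
    have := finProdFinEquiv.injective (Fin.castLE_injective h hj)
    exact (Prod.ext_iff.1 this).2
  refine ⟨fun i => ⟨Finset.univ.map ⟨_, hinj i⟩, by simp⟩, fun i j hij => ?_⟩
  rw [Finset.disjoint_left]
  intro p hp hp'
  simp only [Finset.mem_map, Finset.mem_univ, true_and, Function.Embedding.coeFn_mk] at hp hp'
  obtain ⟨q, rfl⟩ := hp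
  obtain ⟨q', hq'⟩ := hp'
  have := finProdFinEquiv.injective (Fin.castLE_injective h hq')
  exact hij (Prod.ext_iff.1 this).1.symm

end Blocks

/-! ### The projections of the smooth repetition -/

namespace MaxTSA

variable {r t : ℕ}

/-- What the verifier chooses once the constraints are fixed. -/
abbrev RepChoice (r t : ℕ) : Type :=
  {T : Finset (Fin r) // T.card = t} × (Fin t → Fin 5)

/-- The projection of an edge of the smooth repetition; it depends only on the verifier's choice of
positions and variables. -/
def choiceProj (ω : RepChoice r t) (a : RepAnsR r) : RepAnsL r t :=
  (fun k => a (selected ω.1 k) (ω.2 k), fun k => a (unselected ω.1 k))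

theorem eq_of_choiceProj_eq {ω : RepChoice r t} {a a' : RepAnsR r}
    (h : choiceProj ω a = choiceProj ω a') {p : Fin r} (hp : p ∉ ω.1.1) : a p = a' p := by
  have hmem : p ∈ Set.range (unselected ω.1) := by
    rw [unselected, Finset.range_orderEmbOfFin]
    simpa using hp
  obtain ⟨k, rfl⟩ := hmem
  exact congrFun (Prod.ext_iff.1 h).2 k

open Classical in
/-- A small set of answers is rarely identified by a random projection. -/
theorem expect_not_injOn_le (ht : t ≤ r) (A : Finset (RepAnsR r)) :
    (𝔼 ω : RepChoice r t, if Set.InjOn (choiceProj ω) A then (0 : ℝ) else 1) ≤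
      (A.card : ℝ) ^ 2 * (t / r) := by
  -- One position where the pair differs is fixed beforehand. The projection can identify the pair
  -- only if that position is selected, an event of probability t/r; `none` makes equal pairs
  -- contribute 0.
  have hdiff : ∀ q : RepAnsR r × RepAnsR r, ∃ p : Option (Fin r), q.1 ≠ q.2 →
      ∃ p', p = some p' ∧ q.1 p' ≠ q.2 p' := by
    intro q
    by_cases hq : q.1 = q.2
    · exact ⟨none, fun h => absurd hq h⟩
    · obtain ⟨p, hp⟩ := Function.ne_iff.1 hq
      exact ⟨some p, fun _ => ⟨p, rfl, hp⟩⟩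
  choose P hP using hdiff
  calc (𝔼 ω : RepChoice r t, if Set.InjOn (choiceProj ω) A then (0 : ℝ) else 1)
      ≤ 𝔼 ω : RepChoice r t, ∑ q ∈ A ×ˢ A, if ∃ p ∈ P q, p ∈ ω.1.1 then (1 : ℝ) else 0 := by
        refine expect_mono fun ω => ?_
        split_ifs with hinj
        · exact Finset.sum_nonneg fun q _ => by split_ifs <;> norm_num
        · simp only [Set.InjOn] at hinj
          push Not at hinj
          obtain ⟨a, ha, a', ha', haa, hne⟩ := hinj
          obtain ⟨p, hp, hpne⟩ := hP (a, a') hne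
          refine le_trans (b := if ∃ p ∈ P (a, a'), p ∈ ω.1.1 then (1 : ℝ) else 0) ?_
            (Finset.single_le_sum
              (f := fun q => if ∃ p ∈ P q, p ∈ ω.1.1 then (1 : ℝ) else 0)
              (fun q _ => by split_ifs <;> norm_num)
              (Finset.mem_product.2 ⟨ha, ha'⟩))
          rw [if_pos ⟨p, hp, by_contra fun h => hpne (eq_of_choiceProj_eq haa h)⟩]
    _ = ∑ q ∈ A ×ˢ A, 𝔼 ω : RepChoice r t, if ∃ p ∈ P q, p ∈ ω.1.1 then (1 : ℝ) else 0 :=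
        Finset.expect_sum_comm _ _ _
    _ ≤ ∑ q ∈ A ×ˢ A, (t / r : ℝ) := by
        refine Finset.sum_le_sum fun q _ => ?_
        rcases hPq : P q with _ | p
        · simp; positivity
        · rw [← expect_block_mem ht p]
          simp only [Option.mem_def, Option.some.injEq, exists_eq_left']
          exact (expect_prod_fst fun T : {T : Finset (Fin r) // T.card = t} =>
            if p ∈ T.1 then (1 : ℝ) else 0).le
    _ = (A.card : ℝ) ^ 2 * (t / r) := by
        rw [Finset.sum_const, Finset.card_product, nsmul_eq_mul]
        push_cast
        ring

end MaxTSA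

/-! ### Correlations at large sets -/

namespace MaxTSA

variable {G : Type*} [Group G] [Fintype G] {r t : ℕ}

/-- The trivial bound, for the rare permutations under which some of the chosen answers differ only
inside the two blocks. -/
theorem abs_expect_fibreMean_mul_le_meanSq (ω ω' : RepChoice r t)
    {h h' : (RepAnsL r t → G) → ℝ} (hh : ∀ y, |h y| ≤ 1) (hh' : ∀ y, |h' y| ≤ 1)
    (b : (RepAnsR r → G) → ℝ) :
    |𝔼 x, fibreMean (choiceProj ω) h b x * fibreMean (choiceProj ω') h' b x| ≤ meanSq b := by
  refine (abs_expect_mul_le _ _).trans ?_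
  rw [← Real.sqrt_mul (meanSq_nonneg _)]
  refine Real.sqrt_le_iff.2 ⟨meanSq_nonneg b, ?_⟩
  rw [sq]
  exact mul_le_mul (meanSq_fibreMean_le _ hh b) (meanSq_fibreMean_le _ hh' b) (meanSq_nonneg _)
    (meanSq_nonneg _)

variable [Fintype (commutator G)]

/-- Two projections with disjoint sets of selected positions, outside of which the answers `a i`
are pairwise different, have almost orthogonal fibre means. -/
theorem abs_expect_choice_fibreMean_mul_le {m : ℕ} (hm : 0 < m) {ω ω' : RepChoice r t}
    (hd : Disjoint ω.1.1 ω'.1.1) (a : Fin m → RepAnsR r)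
    (ha : ∀ i j, i ≠ j → ∃ p, p ∉ ω.1.1 ∧ p ∉ ω'.1.1 ∧ a i p ≠ a j p)
    {h h' : (RepAnsL r t → G) → ℝ} (hh : ∀ y, |h y| ≤ 1) (hh' : ∀ y, |h' y| ≤ 1)
    (b : (RepAnsR r → G) → ℝ)
    (hb : ∀ i, ∀ x : RepAnsR r → G,
      ∑ c : commutator G, b (Pi.mulSingle (a i) (c : G) * x) = 0) :
    |𝔼 x, fibreMean (choiceProj ω) h b x * fibreMean (choiceProj ω') h' b x| ≤
      √(3 * (Fintype.card G : ℝ) ^ 2 / √m) * meanSq b := by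
  refine abs_expect_fibreMean_mul_le hm _ _ a ?_ hh hh' b hb
  intro i j s hi hj
  -- s agrees with a i off the first block and with a j off the second, so a i and a j agree off
  -- both. Once i = j, disjointness of the blocks gives s = a i at every position.
  have hij : i = j := by
    by_contra hne
    obtain ⟨p, hp, hp', hap⟩ := ha i j hne
    exact hap ((eq_of_choiceProj_eq hi hp).symm.trans (eq_of_choiceProj_eq hj hp'))
  subst hij
  refine ⟨rfl, funext fun p => ?_⟩
  by_cases hp : p ∈ ω.1.1
  · exact eq_of_choiceProj_eq hj (Finset.disjoint_left.1 hd hp)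
  · exact eq_of_choiceProj_eq hi hp

/-- Along random disjoint blocks the fibre means are almost orthogonal on average. -/
theorem expect_abs_expect_fibreMean_mul_le {m : ℕ} (hm : 0 < m)
    {T T' : {T : Finset (Fin r) // T.card = t}} (hd : Disjoint T.1 T'.1)
    (a : Fin m → RepAnsR r) (ha : Function.Injective a)
    {h : RepChoice r t → (RepAnsL r t → G) → ℝ} (hh : ∀ ω y, |h ω y| ≤ 1)
    (b : (RepAnsR r → G) → ℝ)
    (hb : ∀ i, ∀ x : RepAnsR r → G,
      ∑ c : commutator G, b (Pi.mulSingle (a i) (c : G) * x) = 0) :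
    (𝔼 g : Equiv.Perm (Fin r) × (Fin t → Fin 5),
      |𝔼 x, fibreMean (choiceProj (g.1 • T, g.2)) (h (g.1 • T, g.2)) b x *
        fibreMean (choiceProj (g.1 • T', g.2)) (h (g.1 • T', g.2)) b x|) ≤
      ((m : ℝ) ^ 2 * (2 * (t / r)) + √(3 * (Fintype.card G : ℝ) ^ 2 / √m)) * meanSq b := by
  classical
  have hB := meanSq_nonneg b
  have hdiff : ∀ q : Fin m × Fin m, ∃ p : Option (Fin r), q.1 ≠ q.2 →
      ∃ p', p = some p' ∧ a q.1 p' ≠ a q.2 p' := by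
    intro q
    by_cases hq : q.1 = q.2
    · exact ⟨none, fun h => absurd hq h⟩
    · obtain ⟨p, hp⟩ := Function.ne_iff.1 fun h => hq (ha h)
      exact ⟨some p, fun _ => ⟨p, rfl, hp⟩⟩
  choose P hP using hdiff
  -- Counts how often the fixed differing position of the pair q is covered by the two moved blocks;
  -- it is at least 1 for some q whenever the induced-matching bound is not available.
  set χ : Equiv.Perm (Fin r) → Fin m × Fin m → ℝ := fun g q =>
    (if ∃ p ∈ P q, p ∈ (g • T).1 then (1 : ℝ) else 0) +
      (if ∃ p ∈ P q, p ∈ (g • T').1 then (1 : ℝ) else 0) with hχ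
  have hχ0 : ∀ g q, 0 ≤ χ g q := fun g q => by
    simp only [hχ]
    split_ifs <;> norm_num
  have hdis : ∀ g : Equiv.Perm (Fin r), Disjoint (g • T).1 (g • T').1 := by
    intro g
    rw [Finset.disjoint_left]
    intro p hp hp'
    rw [mem_smul_block] at hp hp'
    exact Finset.disjoint_left.1 hd hp hp'
  set η := √(3 * (Fintype.card G : ℝ) ^ 2 / √m) with hη
  have hη0 : 0 ≤ η := Real.sqrt_nonneg _
  have hpt : ∀ g : Equiv.Perm (Fin r) × (Fin t → Fin 5),
      |𝔼 x, fibreMean (choiceProj (g.1 • T, g.2)) (h (g.1 • T, g.2)) b x *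
        fibreMean (choiceProj (g.1 • T', g.2)) (h (g.1 • T', g.2)) b x| ≤
      ((∑ q, χ g.1 q) + η) * meanSq b := by
    rintro ⟨g, u⟩
    by_cases hgood : ∀ q : Fin m × Fin m, q.1 ≠ q.2 →
        ∃ p, p ∉ (g • T).1 ∧ p ∉ (g • T').1 ∧ a q.1 p ≠ a q.2 p
    · refine (abs_expect_choice_fibreMean_mul_le hm (ω := (g • T, u)) (ω' := (g • T', u))
        (hdis g) a (fun i j hij => hgood (i, j) hij) (hh _) (hh _) b hb).trans ?_
      refine mul_le_mul_of_nonneg_right ?_ hB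
      have := Finset.sum_nonneg fun q (_ : q ∈ Finset.univ) => hχ0 g q
      simp only
      linarith
    · refine (abs_expect_fibreMean_mul_le_meanSq _ _ (hh _) (hh _) b).trans ?_
      refine le_mul_of_one_le_left hB ?_
      push Not at hgood
      obtain ⟨q, hq, hbad⟩ := hgood
      obtain ⟨p, hp, hpne⟩ := hP q hq
      have h1 : 1 ≤ χ g q := by
        simp only [hχ]
        by_cases hpT : p ∈ (g • T).1
        · rw [if_pos ⟨p, hp, hpT⟩]
          split_ifs <;> norm_num
        · by_cases hpT' : p ∈ (g • T').1
          · rw [if_pos (c := ∃ p ∈ P q, p ∈ (g • T').1) ⟨p, hp, hpT'⟩]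
            split_ifs <;> norm_num
          · exact absurd (hbad p hpT hpT') hpne
      have := Finset.single_le_sum (fun q _ => hχ0 g q) (Finset.mem_univ q)
      simp only
      linarith
  have hcount : ∀ (T : {T : Finset (Fin r) // T.card = t}) (q : Fin m × Fin m),
      (𝔼 g : Equiv.Perm (Fin r), if ∃ p ∈ P q, p ∈ (g • T).1 then (1 : ℝ) else 0) ≤ t / r := by
    intro T q
    rcases hPq : P q with _ | p
    · simp; positivity
    · rw [← expect_perm_mem T p]
      simp only [Option.mem_def, Option.some.injEq, exists_eq_left']
      exact le_rfl
  refine (expect_mono hpt).trans ?_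
  rw [← Finset.expect_mul]
  refine mul_le_mul_of_nonneg_right ?_ hB
  rw [expect_prod_fst (B := Fin t → Fin 5) fun g : Equiv.Perm (Fin r) => (∑ q, χ g q) + η,
    Finset.expect_add_distrib, Fintype.expect_const, Finset.expect_sum_comm]
  refine add_le_add ?_ le_rfl
  calc ∑ q, 𝔼 g, χ g q ≤ ∑ q : Fin m × Fin m, (2 * (t / r) : ℝ) := by
        refine Finset.sum_le_sum fun q _ => ?_
        simp only [hχ, Finset.expect_add_distrib]
        linarith [hcount T q, hcount T' q]
    _ = _ := by
        rw [Finset.sum_const, Finset.card_univ, Fintype.card_prod, Fintype.card_fin,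
          nsmul_eq_mul]
        push_cast
        ring

/-- Any fixed block moved by a random permutation is uniform. So a single random permutation can
serve k disjoint blocks at once while each keeps the verifier's distribution. -/
theorem expect_choice_eq (T : {T : Finset (Fin r) // T.card = t}) (F : RepChoice r t → ℝ) :
    𝔼 ω, F ω = 𝔼 g : Equiv.Perm (Fin r) × (Fin t → Fin 5), F (g.1 • T, g.2) := by
  rw [expect_prod, expect_prod, Finset.expect_comm]
  refine Eq.trans ?_ (Finset.expect_comm _ _ _).symm
  exact Finset.expect_congr rfl fun u _ => (expect_smul_eq (fun T => F (T, u)) T).symm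

/-- Components at large sets have small correlation along a random projection. -/
theorem sq_expect_correlation_component_le {k m : ℕ} (hk : 0 < k) (hkt : k * t ≤ r) (hm : 0 < m)
    (S : Finset (RepAnsR r)) (hS : m ≤ S.card)
    {h : RepChoice r t → (RepAnsL r t → G) → ℝ} (hh : ∀ ω y, |h ω y| ≤ 1)
    (a b : (RepAnsR r → G) → ℝ) :
    (𝔼 ω, correlation (choiceProj ω) (h ω) (component S a) (component S b)) ^ 2 ≤
      meanSq (component S a) *
        ((1 / k + ((m : ℝ) ^ 2 * (2 * (t / r)) + √(3 * (Fintype.card G : ℝ) ^ 2 / √m))) *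
          meanSq (component S b)) := by
  obtain ⟨I, hI⟩ := exists_disjoint_blocks hkt
  have hmS : Fintype.card (Fin m) ≤ Fintype.card S := by simpa using hS
  obtain ⟨e⟩ := Function.Embedding.nonempty_of_card_le hmS
  have : Nonempty (Fin k) := ⟨⟨0, hk⟩⟩
  have h1 : 𝔼 ω, correlation (choiceProj ω) (h ω) (component S a) (component S b) =
      𝔼 g : Equiv.Perm (Fin r) × (Fin t → Fin 5), 𝔼 i, 𝔼 x, component S a x *
        fibreMean (choiceProj (g.1 • I i, g.2)) (h (g.1 • I i, g.2)) (component S b) x := by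
    rw [Finset.expect_comm]
    simp only [← correlation_eq_expect_fibreMean]
    simp only [← expect_choice_eq (I _)
      fun ω => correlation (choiceProj ω) (h ω) (component S a) (component S b)]
    exact (Fintype.expect_const _).symm
  rw [h1]
  refine expect_expect_mul_sq_le hk _ _ (by positivity)
    (fun g i => meanSq_fibreMean_le _ (hh _) _) fun i j hij => ?_
  exact expect_abs_expect_fibreMean_mul_le hm (hI i j hij) (fun i => (e i : RepAnsR r))
    (Subtype.val_injective.comp e.injective) hh _
    fun i x => sum_component_mulSingle (e i).2 b x

end MaxTSA

/-! ### Decoding -/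

section Decode

theorem uniformProb_eq_expect {Ω : Type*} [Fintype Ω] (P : Ω → Prop) [DecidablePred P] :
    uniformProb P = 𝔼 ω, if P ω then (1 : ℝ) else 0 := by
  classical
  rw [uniformProb, Fintype.expect_eq_sum_div_card, Finset.sum_boole, Nat.card_eq_fintype_card,
    Nat.card_eq_fintype_card, Fintype.card_subtype]

/-- Independent random choices can be replaced by a deterministic choice. -/
theorem exists_sum_mul_le {E X ι : Type*} [Fintype E] [Fintype X] [Fintype ι] [Nonempty ι]
    (f : E → X) {ν : X → ι → ℝ} (hν : ∀ x l, 0 ≤ ν x l) (hν1 : ∀ x, ∑ l, ν x l ≤ 1)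
    {c : E → ι → ℝ} (hc : ∀ e l, 0 ≤ c e l) :
    ∃ σ : X → ι, ∑ e, ∑ l, ν (f e) l * c e l ≤ ∑ e, c e (σ (f e)) := by
  classical
  have hmax : ∀ x, ∃ l, ∀ l', ∑ e with f e = x, c e l' ≤ ∑ e with f e = x, c e l :=
    fun x => Finite.exists_max fun l => ∑ e with f e = x, c e l
  choose σ hσ using hmax
  refine ⟨σ, ?_⟩
  rw [← Finset.sum_fiberwise Finset.univ f, ← Finset.sum_fiberwise Finset.univ f]
  refine Finset.sum_le_sum fun x _ => ?_
  calc ∑ e with f e = x, ∑ l, ν (f e) l * c e l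
      = ∑ e with f e = x, ∑ l, ν x l * c e l :=
        Finset.sum_congr rfl fun e he => by rw [(Finset.mem_filter.1 he).2]
    _ = ∑ l, ν x l * ∑ e with f e = x, c e l := by
        rw [Finset.sum_comm]
        simp only [Finset.mul_sum]
    _ ≤ ∑ l, ν x l * ∑ e with f e = x, c e (σ x) :=
        Finset.sum_le_sum fun l _ => mul_le_mul_of_nonneg_left (hσ x l) (hν x l)
    _ ≤ ∑ e with f e = x, c e (σ x) := by
        rw [← Finset.sum_mul]
        exact mul_le_of_le_one_left (Finset.sum_nonneg fun e _ => hc e _) (hν1 x)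
    _ = _ := Finset.sum_congr rfl fun e he => by rw [(Finset.mem_filter.1 he).2]

namespace UFGLabelCover

variable {V W E L R : Type*} {r m : ℕ}

/-- The label `a` of the vertex `w` meets the constraints of `w`. -/
def Admissible (Λ : UFGLabelCover V W E L R r m) (w : W) (a : R) : Prop :=
  ∀ i, Λ.p i a = Λ.b (Λ.I w i)

theorem val_le_opt [Finite V] [Finite W] [Finite L] [Finite R] (Λ : UFGLabelCover V W E L R r m)
    (σ : (V → L) × (W → R)) : Λ.val σ ≤ Λ.opt :=
  le_ciSup (Set.finite_range Λ.val).bddAbove σ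

variable [Fintype V] [Fintype W] [Fintype E] [Fintype L] [Fintype R] [Nonempty L] [Nonempty R]

open Classical in
/-- A randomized assignment satisfies at most the fraction `opt` of the edges on average. -/
theorem expect_weights_le_opt (Λ : UFGLabelCover V W E L R r m) {μ : W → R → ℝ} {ν : V → L → ℝ}
    (hμ : ∀ w a, 0 ≤ μ w a) (hμ1 : ∀ w, ∑ a, μ w a ≤ 1) (hν : ∀ v l, 0 ≤ ν v l)
    (hν1 : ∀ v, ∑ l, ν v l ≤ 1) :
    (𝔼 e, ∑ a, μ (Λ.right e) a *
      if Λ.Admissible (Λ.right e) a then ν (Λ.left e) (Λ.proj e a) else 0) ≤ Λ.opt := by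
  obtain ⟨σR, hσR⟩ := exists_sum_mul_le Λ.right hμ hμ1
    (c := fun e a => if Λ.Admissible (Λ.right e) a then ν (Λ.left e) (Λ.proj e a) else 0)
    fun e a => by split_ifs <;> simp [hν]
  obtain ⟨σL, hσL⟩ := exists_sum_mul_le Λ.left hν hν1
    (c := fun e l => if Λ.Admissible (Λ.right e) (σR (Λ.right e)) ∧
      Λ.proj e (σR (Λ.right e)) = l then (1 : ℝ) else 0)
    fun e l => by split_ifs <;> norm_num
  refine le_trans ?_ (Λ.val_le_opt (σL, σR))
  rw [val, uniformProb_eq_expect, Fintype.expect_eq_sum_div_card, Fintype.expect_eq_sum_div_card]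
  refine div_le_div_of_nonneg_right ?_ (Nat.cast_nonneg _)
  refine hσR.trans (le_trans (le_of_eq ?_) (hσL.trans (le_of_eq ?_)))
  · refine Finset.sum_congr rfl fun e _ => ?_
    by_cases h : Λ.Admissible (Λ.right e) (σR (Λ.right e))
    · simp [h]
    · simp [h]
  · refine Finset.sum_congr rfl fun e _ => if_congr ?_ rfl rfl
    rw [and_comm]
    rfl

open Classical in
/-- Weights on small sets of labels are decoded to an assignment. -/
theorem expect_setWeights_le [DecidableEq L] (Λ : UFGLabelCover V W E L R r m) {C : ℝ} (hC : 0 < C)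
    {A : W → Finset R → ℝ} {H : V → Finset L → ℝ}
    (hA : ∀ w S, 0 ≤ A w S) (hA1 : ∀ w, ∑ S, A w S ≤ 1)
    (hA0 : ∀ w S, (∀ a ∈ S, ¬ Λ.Admissible w a) → A w S = 0)
    (hH : ∀ v T, 0 ≤ H v T) (hH1 : ∀ v, ∑ T, H v T ≤ 1) :
    (𝔼 e, ∑ S : Finset R with (S.card : ℝ) ≤ C,
      A (Λ.right e) S * H (Λ.left e) (S.image (Λ.proj e))) ≤ C * Λ.opt := by
  -- An admissible label of S if there is one; the arbitrary default is harmless, as then A w S = 0.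
  have hlab : ∀ (w : W) (S : Finset R), ∃ a : R, (∃ a ∈ S, Λ.Admissible w a) → a ∈ S ∧ Λ.Admissible w a := by
    intro w S
    by_cases h : ∃ a ∈ S, Λ.Admissible w a
    · exact ⟨h.choose, fun _ => h.choose_spec⟩
    · exact ⟨Classical.arbitrary R, fun h' => absurd h' h⟩
  choose lab hlab using hlab
  set μ : W → R → ℝ := fun w a => ∑ S with lab w S = a, A w S with hμ
  -- Draw T with weight H and then a uniform element of T. Hitting the image of the label of w
  -- inside an image set of at most C elements costs the factor C.
  set ν : V → L → ℝ := fun v l => ∑ T : Finset L with l ∈ T, H v T / T.card with hν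
  have hμs : ∀ w (F : R → ℝ), ∑ a, μ w a * F a = ∑ S, A w S * F (lab w S) := by
    intro w F
    rw [← Finset.sum_fiberwise Finset.univ (lab w)]
    refine Finset.sum_congr rfl fun a _ => ?_
    rw [hμ, Finset.sum_mul]
    exact Finset.sum_congr rfl fun S hS => by rw [(Finset.mem_filter.1 hS).2]
  have hν1 : ∀ v, ∑ l, ν v l ≤ 1 := by
    intro v
    refine le_trans ?_ (hH1 v)
    simp only [hν, Finset.sum_filter]
    rw [Finset.sum_comm]
    refine Finset.sum_le_sum fun T _ => ?_
    rw [← Finset.sum_filter, Finset.sum_const, Finset.filter_mem_eq_inter, Finset.univ_inter,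
      nsmul_eq_mul, mul_div_assoc', mul_div_right_comm]
    exact mul_le_of_le_one_left (hH v T) (div_self_le_one _)
  have hν0 : ∀ v l, 0 ≤ ν v l := fun v l =>
    Finset.sum_nonneg fun T _ => div_nonneg (hH v T) (Nat.cast_nonneg _)
  have key := Λ.expect_weights_le_opt (μ := μ) (ν := ν)
    (fun w a => Finset.sum_nonneg fun S _ => hA w S)
    (fun w => by simpa using (hμs w fun _ => 1).trans_le (by simpa using hA1 w)) hν0 hν1
  refine le_trans ?_ (mul_le_mul_of_nonneg_left key hC.le)
  rw [Finset.mul_expect]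
  refine expect_mono fun e => ?_
  rw [hμs, Finset.mul_sum]
  refine le_trans ?_ (Finset.sum_le_sum_of_subset_of_nonneg
    (Finset.filter_subset (fun S : Finset R => (S.card : ℝ) ≤ C) _) fun S _ _ => ?_)
  · refine Finset.sum_le_sum fun S hS => ?_
    have hSC := (Finset.mem_filter.1 hS).2
    by_cases h : ∃ a ∈ S, Λ.Admissible (Λ.right e) a
    · obtain ⟨h1, h2⟩ := hlab _ _ h
      rw [if_pos h2, mul_left_comm]
      refine mul_le_mul_of_nonneg_left ?_ (hA _ _)
      have hmem : Λ.proj e (lab (Λ.right e) S) ∈ S.image (Λ.proj e) :=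
        Finset.mem_image_of_mem _ h1
      have hpos : (0 : ℝ) < (S.image (Λ.proj e)).card := by
        exact_mod_cast Finset.card_pos.2 ⟨_, hmem⟩
      have hle : ((S.image (Λ.proj e)).card : ℝ) ≤ C :=
        le_trans (by exact_mod_cast Finset.card_image_le) hSC
      have h3 : H (Λ.left e) (S.image (Λ.proj e)) / (S.image (Λ.proj e)).card ≤
          ν (Λ.left e) (Λ.proj e (lab (Λ.right e) S)) :=
        Finset.single_le_sum (f := fun T : Finset L => H (Λ.left e) T / T.card)
          (fun T _ => div_nonneg (hH _ T) (Nat.cast_nonneg _))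
          (Finset.mem_filter.2 ⟨Finset.mem_univ _, hmem⟩)
      calc H (Λ.left e) (S.image (Λ.proj e))
          = (S.image (Λ.proj e)).card *
            (H (Λ.left e) (S.image (Λ.proj e)) / (S.image (Λ.proj e)).card) := by
            field_simp
        _ ≤ C * ν (Λ.left e) (Λ.proj e (lab (Λ.right e) S)) :=
            mul_le_mul hle h3 (div_nonneg (hH _ _) hpos.le) hC.le
    · push Not at h
      rw [hA0 _ S h]
      simp
  · refine mul_nonneg hC.le (mul_nonneg (hA _ _) ?_)
    split_ifs
    · exact hν0 _ _
    · exact le_rfl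

end UFGLabelCover

end Decode

/-! ### Correlations over a label cover -/

section Combine

variable {G V W Ω L R : Type*} [Group G] [Fintype G] [Fintype (commutator G)] [Fintype V]
  [Fintype W] [Fintype Ω] [Fintype L] [DecidableEq L] [Fintype R] [DecidableEq R]

theorem sum_sqrt_meanSq_mul_le_one {a b : (R → G) → ℝ} (ha : ∀ x, |a x| ≤ 1)
    (hb : ∀ x, |b x| ≤ 1) :
    ∑ S, √(meanSq (component S a)) * √(meanSq (component S b)) ≤ 1 := by
  refine (Real.sum_sqrt_mul_sqrt_le _ (fun _ => meanSq_nonneg _)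
    fun _ => meanSq_nonneg _).trans ?_
  rw [← meanSq_eq_sum_component, ← meanSq_eq_sum_component]
  exact mul_le_one₀ (Real.sqrt_le_one.2 (meanSq_le_one ha)) (Real.sqrt_nonneg _)
    (Real.sqrt_le_one.2 (meanSq_le_one hb))

-- The weights ‖a_S‖‖b_S‖ sum to at most 1, so errors uniform in S add up without loss. On small
-- sets, failure of injectivity costs κ₁; otherwise the component of h at π(S) enters, and
-- Cauchy–Schwarz over S with ∑‖b_S‖² ≤ 1 gives the square root.
open Classical in
theorem abs_expect_correlation_choice_le (π : Ω → R → L) {h : Ω → (L → G) → ℝ}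
    (hh : ∀ ω y, |h ω y| ≤ 1) {a b : (R → G) → ℝ} (ha : ∀ x, |a x| ≤ 1) (hb : ∀ x, |b x| ≤ 1)
    {C κ₁ κ₂ : ℝ} (hκ₁0 : 0 ≤ κ₁) (hκ₂0 : 0 ≤ κ₂)
    (hκ₁ : ∀ S : Finset R, (S.card : ℝ) ≤ C →
      (𝔼 ω, if Set.InjOn (π ω) S then (0 : ℝ) else 1) ≤ κ₁)
    (hκ₂ : ∀ S : Finset R, C < (S.card : ℝ) →
      |𝔼 ω, correlation (π ω) (h ω) (component S a) (component S b)| ≤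
        κ₂ * (√(meanSq (component S a)) * √(meanSq (component S b)))) :
    |𝔼 ω, correlation (π ω) (h ω) a b| ≤
      κ₁ + κ₂ + 𝔼 ω, √(∑ S : Finset R with (S.card : ℝ) ≤ C,
        meanSq (component S a) * meanSq (component (S.image (π ω)) (h ω))) := by
  set s : Finset R → ℝ := fun S => √(meanSq (component S a)) * √(meanSq (component S b)) with hs
  have hs0 : ∀ S, 0 ≤ s S := fun S => by positivity
  have hs1 : ∑ S, s S ≤ 1 := sum_sqrt_meanSq_mul_le_one ha hb
  set Q : Ω → Finset R → ℝ := fun ω S => if (S.card : ℝ) ≤ C then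
    √(meanSq (component (S.image (π ω)) (h ω))) * s S else 0 with hQ
  have hQ0 : ∀ ω S, 0 ≤ Q ω S := fun ω S => by
    simp only [hQ]; split_ifs
    · exact mul_nonneg (Real.sqrt_nonneg _) (hs0 S)
    · exact le_rfl
  have h1 : ∀ S, |𝔼 ω, correlation (π ω) (h ω) (component S a) (component S b)| ≤
      (κ₁ + κ₂) * s S + 𝔼 ω, Q ω S := by
    intro S
    by_cases hS : (S.card : ℝ) ≤ C
    · have h2 : ∀ ω, |correlation (π ω) (h ω) (component S a) (component S b)| ≤
          (if Set.InjOn (π ω) S then (0 : ℝ) else 1) * s S + Q ω S := by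
        intro ω
        by_cases hinj : Set.InjOn (π ω) S
        · rw [if_pos hinj, zero_mul, zero_add]
          simp only [hQ]
          rw [if_pos hS]
          convert abs_correlation_component_le (π ω) (h ω) a b S hinj
        · rw [if_neg hinj, one_mul]
          exact (abs_correlation_le _ (hh ω) _ _).trans (le_add_of_nonneg_right (hQ0 ω S))
      refine (abs_expect_le _).trans ((expect_mono h2).trans ?_)
      rw [Finset.expect_add_distrib, ← Finset.expect_mul]
      exact add_le_add (mul_le_mul_of_nonneg_right (by linarith [hκ₁ S hS]) (hs0 S)) le_rfl
    · have := hκ₂ S (not_le.1 hS)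
      have h3 : 0 ≤ 𝔼 ω, Q ω S := Finset.expect_nonneg fun ω _ => hQ0 ω S
      have h4 : 0 ≤ κ₁ * s S := mul_nonneg hκ₁0 (hs0 S)
      have h5 : κ₂ * s S = κ₂ * (√(meanSq (component S a)) * √(meanSq (component S b))) := rfl
      rw [add_mul]
      linarith
  have h2 : 𝔼 ω, correlation (π ω) (h ω) a b =
      ∑ S, 𝔼 ω, correlation (π ω) (h ω) (component S a) (component S b) := by
    rw [← Finset.expect_sum_comm]
    exact Finset.expect_congr rfl fun ω _ => correlation_eq_sum_component _ _ _ _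
  rw [h2]
  refine (Finset.abs_sum_le_sum_abs _ _).trans ((Finset.sum_le_sum fun S _ => h1 S).trans ?_)
  rw [Finset.sum_add_distrib, ← Finset.mul_sum, ← Finset.expect_sum_comm]
  refine add_le_add (mul_le_of_le_one_right (add_nonneg hκ₁0 hκ₂0) hs1)
    (expect_mono fun ω => ?_)
  simp only [hQ, ← Finset.sum_filter]
  calc ∑ S : Finset R with (S.card : ℝ) ≤ C, √(meanSq (component (S.image (π ω)) (h ω))) * s S
      = ∑ S : Finset R with (S.card : ℝ) ≤ C,
        √(meanSq (component S a) * meanSq (component (S.image (π ω)) (h ω))) *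
          √(meanSq (component S b)) := by
        refine Finset.sum_congr rfl fun S _ => ?_
        rw [Real.sqrt_mul (meanSq_nonneg _)]
        simp only [hs]
        ring
    _ ≤ √(∑ S : Finset R with (S.card : ℝ) ≤ C,
          meanSq (component S a) * meanSq (component (S.image (π ω)) (h ω))) *
        √(∑ S : Finset R with (S.card : ℝ) ≤ C, meanSq (component S b)) :=
        Real.sum_sqrt_mul_sqrt_le _ (fun S => mul_nonneg (meanSq_nonneg _) (meanSq_nonneg _))
          fun S => meanSq_nonneg _
    _ ≤ _ := by
        refine mul_le_of_le_one_right (Real.sqrt_nonneg _) (Real.sqrt_le_one.2 ?_)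
        refine le_trans ?_ (meanSq_le_one hb)
        rw [meanSq_eq_sum_component]
        exact Finset.sum_le_sum_of_subset_of_nonneg (Finset.filter_subset _ _)
          fun S _ _ => meanSq_nonneg _

open Classical in
/-- Correlations over a label cover with small optimum are small. -/
theorem abs_expect_correlation_le [Nonempty L] [Nonempty R] {r m : ℕ}
    (Λ : UFGLabelCover V W (W × Ω) L R r m) {π : Ω → R → L} (hright : ∀ e, Λ.right e = e.1)
    (hproj : ∀ e, Λ.proj e = π e.2) {h : V → (L → G) → ℝ}
    (hh : ∀ v y, |h v y| ≤ 1) {a b : W → (R → G) → ℝ} (ha : ∀ w x, |a w x| ≤ 1)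
    (hb : ∀ w x, |b w x| ≤ 1)
    (hfold : ∀ w S, (∀ s ∈ S, ¬ Λ.Admissible w s) → component S (a w) = 0)
    {C κ₁ κ₂ : ℝ} (hC : 0 < C) (hκ₁0 : 0 ≤ κ₁) (hκ₂0 : 0 ≤ κ₂)
    (hκ₁ : ∀ S : Finset R, (S.card : ℝ) ≤ C →
      (𝔼 ω, if Set.InjOn (π ω) S then (0 : ℝ) else 1) ≤ κ₁)
    (hκ₂ : ∀ w, ∀ S : Finset R, C < (S.card : ℝ) →
      |𝔼 ω, correlation (π ω) (h (Λ.left (w, ω))) (component S (a w)) (component S (b w))| ≤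
        κ₂ * (√(meanSq (component S (a w))) * √(meanSq (component S (b w))))) :
    |𝔼 e, correlation (Λ.proj e) (h (Λ.left e)) (a (Λ.right e)) (b (Λ.right e))| ≤
      κ₁ + κ₂ + √(C * Λ.opt) := by
  set Z : W × Ω → ℝ := fun e => ∑ S : Finset R with (S.card : ℝ) ≤ C,
    meanSq (component S (a (Λ.right e))) *
      meanSq (component (S.image (Λ.proj e)) (h (Λ.left e))) with hZ
  have hZ0 : ∀ e, 0 ≤ Z e := fun e =>
    Finset.sum_nonneg fun S _ => mul_nonneg (meanSq_nonneg _) (meanSq_nonneg _)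
  -- Squared norms of components sum to at most 1, so they act as weights of a random choice of
  -- label sets; Jensen takes the square root out of the mean.
  have h1 : 𝔼 e, √(Z e) ≤ √(C * Λ.opt) := by
    refine Real.le_sqrt_of_sq_le ((expect_sq_le_meanSq _).trans ?_)
    simp only [meanSq, Real.sq_sqrt (hZ0 _)]
    exact Λ.expect_setWeights_le hC (A := fun w S => meanSq (component S (a w)))
      (H := fun v T => meanSq (component T (h v))) (fun _ _ => meanSq_nonneg _)
      (fun w => by
        rw [← meanSq_eq_sum_component]
        exact meanSq_le_one (ha w))
      (fun w S hS => by
        rw [hfold w S hS]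
        simp [meanSq])
      (fun _ _ => meanSq_nonneg _) fun v => by
        rw [← meanSq_eq_sum_component]
        exact meanSq_le_one (hh v)
  cases isEmpty_or_nonempty W
  · simp only [Finset.univ_eq_empty, Finset.expect_empty, abs_zero]
    positivity
  refine le_trans ?_ (add_le_add le_rfl h1)
  rw [expect_prod, expect_prod]
  refine (abs_expect_le _).trans ?_
  rw [← Fintype.expect_const (ι := W) (κ₁ + κ₂), ← Finset.expect_add_distrib]
  refine expect_mono fun w => ?_
  have := abs_expect_correlation_choice_le π (h := fun ω => h (Λ.left (w, ω)))
    (fun ω => hh _) (ha w) (hb w) hκ₁0 hκ₂0 hκ₁ (hκ₂ w)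
  simpa only [hZ, hright, hproj] using this

end Combine

/-! ### From the noiseless test to correlations -/

section Folding

variable {G V W E L R : Type*} [Group G] {r m : ℕ}

/-- The folded table of the vertex `w`. -/
noncomputable def functionalFoldedTable (Λ : UFGLabelCover V W E L R r m)
    (σ : TestVar G Λ → G) (w : W) (x : R → G) : G :=
  functionalShift Λ.p x (fun i => Λ.b (Λ.I w i)) *
    σ (Sum.inl (w, Quotient.mk (functionalFolding G Λ.p) x))

/-- The folded table of the vertex `v`. -/
noncomputable def classicalFoldedTable (Λ : UFGLabelCover V W E L R r m)
    (σ : TestVar G Λ → G) (v : V) (y : L → G) : G :=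
  σ (Sum.inr (Sum.inr (v, Quotient.mk (classicalFolding G L) y))) * classicalShift y

theorem functionalShift_spec (p : Fin r → R → ZMod 2) (x : R → G) (d : R) :
    x d = functionalShift p x (fun i => p i d) *
      (Quotient.mk (functionalFolding G p) x).out d :=
  (exists_functionalFolding_out p x).choose_spec d

theorem classicalShift_spec (y : L → G) (d : L) :
    y d = (Quotient.mk (classicalFolding G L) y).out d * classicalShift y :=
  (exists_classicalFolding_out y).choose_spec d

theorem noiselessTest_satisfied_iff (Λ : UFGLabelCover V W E L R r m) (σ : TestVar G Λ → G)
    (e : E) (y : L → G) (x : R → G) :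
    σ ((noiselessTest G Λ).scope (e, y, x) 0) * σ ((noiselessTest G Λ).scope (e, y, x) 1) *
        σ ((noiselessTest G Λ).scope (e, y, x) 2) = (noiselessTest G Λ).rhs (e, y, x) ↔
      functionalFoldedTable Λ σ (Λ.right e) x *
        σ (Sum.inr (Sum.inl (Λ.right e, ((y ∘ Λ.proj e) * x)⁻¹))) *
        classicalFoldedTable Λ σ (Λ.left e) y = 1 := by
  have hz : ((y ∘ Λ.proj e) * x)⁻¹ = fun i => (x i)⁻¹ * (y (Λ.proj e i))⁻¹ := by
    funext i
    simp
  rw [hz]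
  change σ (Sum.inl _) * σ (Sum.inr (Sum.inl _)) * σ (Sum.inr (Sum.inr _)) = _⁻¹ * _⁻¹ ↔ _
  simp only [functionalFoldedTable, classicalFoldedTable, mul_assoc]
  rw [eq_inv_mul_iff_mul_eq, ← mul_eq_one_iff_eq_inv]
  simp only [mul_assoc]

open Classical in
/-- Multiplying `x` by `c` at the admissible labels multiplies the folded table by `c`. -/
theorem functionalFoldedTable_mul (Λ : UFGLabelCover V W E L R r m) (σ : TestVar G Λ → G)
    {w : W} (hw : ∃ d, Λ.Admissible w d) (c : G) (x : R → G) :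
    functionalFoldedTable Λ σ w ((fun d => if Λ.Admissible w d then c else 1) * x) =
      c * functionalFoldedTable Λ σ w x := by
  obtain ⟨d, hd⟩ := hw
  have hiff : ∀ d, Λ.Admissible w d ↔ (fun i => Λ.p i d) = fun i => Λ.b (Λ.I w i) :=
    fun d => funext_iff.symm
  -- The admissible labels form the fibre of (p₁,…,p_r) over the bits of w, so the multiplier is
  -- itself of the form F(p₁,…,p_r).
  have hclass : Quotient.mk (functionalFolding G Λ.p)
      ((fun d => if Λ.Admissible w d then c else 1) * x) =
      Quotient.mk (functionalFolding G Λ.p) x :=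
    Quotient.sound ⟨fun u => if u = (fun i => Λ.b (Λ.I w i)) then c else 1, fun d => by
      simp only [Pi.mul_apply, hiff]⟩
  -- The shift is determined only at values taken by (p₁,…,p_r); an admissible d makes the required
  -- bits such a value.
  have h1 := functionalShift_spec Λ.p ((fun d => if Λ.Admissible w d then c else 1) * x) d
  rw [hclass, Pi.mul_apply, if_pos hd, functionalShift_spec Λ.p x d, (hiff d).1 hd,
    ← mul_assoc] at h1
  rw [functionalFoldedTable, functionalFoldedTable, hclass, ← mul_right_cancel h1, mul_assoc]

open Classical in
/-- A function with mean zero over the multiples at `P` has no component away from `P`. -/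
theorem component_eq_zero_of_disjoint [Fintype G] [Fintype R] [DecidableEq R]
    [Fintype (commutator G)] (P : R → Prop) {a : (R → G) → ℝ}
    (ha : ∀ x, ∑ c : commutator G, a ((fun d => if P d then (c : G) else 1) * x) = 0)
    {S : Finset R} (hS : ∀ s ∈ S, ¬ P s) : component S a = 0 := by
  funext x
  have h1 : ∀ c : commutator G, component S a x =
      component S (fun x => a ((fun d => if P d then (c : G) else 1) * x)) x := by
    intro c
    rw [component_translate S a, component_mul_of_mem]
    · intro d
      by_cases hd : P d
      · rw [if_pos hd]; exact c.2
      · rw [if_neg hd]; exact one_mem _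
    · intro s hs
      rw [if_neg (hS s hs)]
  have h2 : ∑ _c : commutator G, component S a x = 0 := by
    rw [Finset.sum_congr rfl fun c _ => h1 c, ← Finset.sum_apply, ← map_sum]
    have : (∑ c : commutator G, fun x => a ((fun d => if P d then (c : G) else 1) * x)) = 0 := by
      funext x
      rw [Finset.sum_apply]
      exact ha x
    rw [this, map_zero]
    rfl
  rw [Finset.sum_const, Finset.card_univ, nsmul_eq_mul] at h2
  exact (mul_eq_zero.1 h2).resolve_left (by exact_mod_cast Fintype.card_ne_zero)

end Folding

/-! ### Expansion of the acceptance probability into correlations. -/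

section Test

variable {G V W E L R : Type*} [Group G] [DecidableEq G] [Fintype E] [Fintype L] [DecidableEq L]
  [Fintype R] [DecidableEq R] {r m : ℕ}

/-- The sum runs over l = h and k = g·h. It separates the three tables at the price of |G|² terms,
and leaves the mean-zero factor on the functionally folded table f. -/
theorem commutatorDefect_mul_mul [Fintype G] (f g h : G) :
    commutatorDefect (f * g * h) = ∑ k : G, ∑ l : G, (if h = l then 1 else 0) *
      (commutatorDefect (f * k) * if g = k * l⁻¹ then 1 else 0) := by
  rw [Finset.sum_eq_single (g * h)]
  · rw [Finset.sum_eq_single h (fun l _ hl => by rw [if_neg (Ne.symm hl), zero_mul]) (by simp)]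
    simp [mul_assoc]
  · intro k _ hk
    refine Finset.sum_eq_zero fun l _ => ?_
    by_cases hl : h = l
    · have : g ≠ k * l⁻¹ := by
        rintro rfl
        subst hl
        simp at hk
      simp [this]
    · simp [hl]
  · simp

theorem ite_eq_one_le_add_commutatorDefect (g : G) :
    (if g = 1 then (1 : ℝ) else 0) ≤ 1 / (Nat.card (commutator G) : ℝ) + commutatorDefect g := by
  have h : commutatorDensity g ≤ 1 / (Nat.card (commutator G) : ℝ) := by
    unfold commutatorDensity
    split_ifs
    · exact le_rfl
    · positivity
  have h' : (if g = 1 then (1 : ℝ) else 0) = commutatorDensity g + commutatorDefect g := by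
    unfold commutatorDefect
    rw [add_sub_cancel]
    by_cases hg : g = 1 <;> simp [hg]
  linarith

/-- If all correlations between folded tables are at most `ε`, the noiseless test accepts with
probability at most `1 / |[G, G]| + |G| ^ 2 * ε`. -/
theorem noiselessTest_opt_le [Fintype G] [Fintype (commutator G)] (Λ : UFGLabelCover V W E L R r m)
    (hadm : ∀ w, ∃ d, Λ.Admissible w d) {ε : ℝ}
    (hε : ∀ (h : V → (L → G) → ℝ) (a b : W → (R → G) → ℝ), (∀ v y, |h v y| ≤ 1) →
      (∀ w x, |a w x| ≤ 1) → (∀ w x, |b w x| ≤ 1) →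
      (∀ w S, (∀ s ∈ S, ¬ Λ.Admissible w s) → component S (a w) = 0) →
      |𝔼 e, correlation (Λ.proj e) (h (Λ.left e)) (a (Λ.right e)) (b (Λ.right e))| ≤ ε) :
    (noiselessTest G Λ).opt ≤
      1 / (Nat.card (commutator G) : ℝ) + (Fintype.card G : ℝ) ^ 2 * ε := by
  refine ciSup_le fun σ => ?_
  set f := functionalFoldedTable Λ σ with hf
  set g := classicalFoldedTable Λ σ with hg
  set φ : W → (R → G) → G := fun w z => σ (Sum.inr (Sum.inl (w, z))) with hφ
  set h : G → V → (L → G) → ℝ := fun l v y => if g v y = l then 1 else 0 with hh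
  set a : G → W → (R → G) → ℝ := fun k w x => commutatorDefect (f w x * k) with ha
  set b : G → G → W → (R → G) → ℝ := fun k l w x =>
    if φ w x⁻¹ = k * l⁻¹ then 1 else 0 with hb
  have hcorr : ∀ k l, |𝔼 e, correlation (Λ.proj e) (h l (Λ.left e)) (a k (Λ.right e))
      (b k l (Λ.right e))| ≤ ε := by
    intro k l
    refine hε _ _ _ (fun v y => ?_) (fun w x => abs_commutatorDefect_le_one _) (fun w x => ?_)
      fun w S hS => component_eq_zero_of_disjoint (Λ.Admissible w) (fun x => ?_) hS
    · simp only [hh]; split_ifs <;> simp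
    · simp only [hb]; split_ifs <;> simp
    · simp only [ha, hf, functionalFoldedTable_mul Λ σ (hadm w), mul_assoc]
      exact sum_commutatorDefect _
  have h1 : (noiselessTest G Λ).val σ ≤ 𝔼 e : E, 𝔼 y : L → G, 𝔼 x : R → G,
      (1 / (Nat.card (commutator G) : ℝ) + commutatorDefect (f (Λ.right e) x *
        φ (Λ.right e) ((y ∘ Λ.proj e) * x)⁻¹ * g (Λ.left e) y)) := by
    classical
    rw [MaxThreeLin.val, uniformProb_eq_expect, expect_prod]
    refine expect_mono fun e => ?_
    rw [expect_prod]
    refine expect_mono fun y => expect_mono fun x => ?_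
    refine le_trans (le_of_eq ?_) (ite_eq_one_le_add_commutatorDefect _)
    exact if_congr (noiselessTest_satisfied_iff Λ σ e y x) rfl rfl
  have h2 : 𝔼 e : E, 𝔼 y : L → G, 𝔼 x : R → G, commutatorDefect (f (Λ.right e) x *
        φ (Λ.right e) ((y ∘ Λ.proj e) * x)⁻¹ * g (Λ.left e) y) =
      ∑ k : G, ∑ l : G, 𝔼 e, correlation (Λ.proj e) (h l (Λ.left e)) (a k (Λ.right e))
        (b k l (Λ.right e)) := by
    simp only [commutatorDefect_mul_mul, Finset.expect_sum_comm, correlation, Finset.mul_expect]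
    rfl
  have hε0 : 0 ≤ ε := (abs_nonneg _).trans (hcorr 1 1)
  cases isEmpty_or_nonempty E
  · refine h1.trans ?_
    rw [Finset.univ_eq_empty, Finset.expect_empty]
    positivity
  refine h1.trans ?_
  simp only [Finset.expect_add_distrib, Fintype.expect_const]
  rw [h2]
  refine add_le_add le_rfl ?_
  calc _ ≤ ∑ _k : G, ∑ _l : G, ε :=
        Finset.sum_le_sum fun k _ => Finset.sum_le_sum fun l _ =>
          (le_abs_self _).trans (hcorr k l)
    _ = _ := by
        simp only [Finset.sum_const, Finset.card_univ, nsmul_eq_mul]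
        ring

end Test

/-! ### Completeness -/

section UniformProb

theorem uniformProb_le_one {Ω : Type*} [Finite Ω] (P : Ω → Prop) : uniformProb P ≤ 1 :=
  div_le_one_of_le₀ (by exact_mod_cast Finite.card_subtype_le P) (Nat.cast_nonneg _)

theorem uniformProb_congr {Ω Ω' : Type*} (e : Ω ≃ Ω') {P : Ω → Prop} {Q : Ω' → Prop}
    (h : ∀ ω, P ω ↔ Q (e ω)) : uniformProb P = uniformProb Q := by
  rw [uniformProb, uniformProb, Nat.card_congr e, Nat.card_congr (e.subtypeEquiv h)]

theorem uniformProb_eq_one_iff {Ω : Type*} [Finite Ω] (P : Ω → Prop) :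
    uniformProb P = 1 ↔ Nonempty Ω ∧ ∀ ω, P ω := by
  classical
  have := Fintype.ofFinite Ω
  cases isEmpty_or_nonempty Ω
  · simp [uniformProb, *]
  · have h0 : (Fintype.card Ω : ℝ) ≠ 0 := by exact_mod_cast Fintype.card_ne_zero
    rw [uniformProb, Nat.card_eq_fintype_card, Nat.card_eq_fintype_card, div_eq_one_iff_eq h0,
      Nat.cast_inj, Fintype.card_subtype, ← Finset.card_univ, Finset.card_filter_eq_iff]
    simp [*]

end UniformProb

section Completeness

variable {G V W E L R : Type*} [Group G] {r m : ℕ}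

theorem MaxThreeLin.val_le_one {X ι : Type*} [Finite ι] (J : MaxThreeLin G X ι) (σ : X → G) :
    J.val σ ≤ 1 := uniformProb_le_one _

theorem MaxThreeLin.opt_le_one {X ι : Type*} [Finite ι] (J : MaxThreeLin G X ι) : J.opt ≤ 1 :=
  ciSup_le J.val_le_one

theorem MaxThreeLin.val_le_opt {X ι : Type*} [Finite ι] (J : MaxThreeLin G X ι) (σ : X → G) :
    J.val σ ≤ J.opt :=
  le_ciSup (f := J.val) ⟨1, by rintro _ ⟨σ, rfl⟩; exact J.val_le_one σ⟩ σ

/-- A satisfiable label cover gives a satisfiable instance: assign the evaluations at the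
labels. -/
theorem noiselessTest_opt_eq_one [Finite G] [Finite V] [Finite W] [Finite E] [Finite L] [Finite R]
    [Nonempty L] [Nonempty R] (Λ : UFGLabelCover V W E L R r m) (h : Λ.opt = 1) :
    (noiselessTest G Λ).opt = 1 := by
  obtain ⟨σ, hσ⟩ := exists_eq_ciSup_of_finite (f := Λ.val)
  have hσ1 : Λ.val σ = 1 := hσ.trans h
  obtain ⟨hE, hsat⟩ := (uniformProb_eq_one_iff _).1 hσ1
  refine le_antisymm (MaxThreeLin.opt_le_one _) ?_
  -- Every table is the evaluation at the label of its vertex. The folded tables are then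
  -- evaluations too, as the label of w satisfies its constraints.
  let τ : TestVar G Λ → G := Sum.elim (fun q => q.2.out (σ.2 q.1))
    (Sum.elim (fun q => q.2 (σ.2 q.1)) fun q => q.2.out (σ.1 q.1))
  refine le_trans (le_of_eq ?_) (MaxThreeLin.val_le_opt _ τ)
  refine ((uniformProb_eq_one_iff _).2 ⟨inferInstance, ?_⟩).symm
  rintro ⟨e, y, x⟩
  refine (noiselessTest_satisfied_iff Λ τ e y x).2 ?_
  obtain ⟨h1, h2⟩ := hsat e
  have hx : functionalFoldedTable Λ τ (Λ.right e) x = x (σ.2 (Λ.right e)) := by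
    rw [functionalShift_spec Λ.p x (σ.2 (Λ.right e)), functionalFoldedTable,
      funext fun i => (h2 i).symm]
    rfl
  have hy : classicalFoldedTable Λ τ (Λ.left e) y = y (σ.1 (Λ.left e)) :=
    (classicalShift_spec y (σ.1 (Λ.left e))).symm
  rw [hx, hy]
  change x _ * (y (Λ.proj e (σ.2 (Λ.right e))) * x (σ.2 (Λ.right e)))⁻¹ * _ = 1
  rw [h1]
  group

end Completeness

/-! ### Smoothness -/

namespace MaxTSA

variable {r t : ℕ}

/-- The edges at a vertex correspond to the choices of the verifier. -/
def edgesEquivChoice (Φ : MaxTSA) (w : Φ.RepW r) :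
    {e : Φ.RepE r t // (Φ.smoothRepetition r t).right e = w} ≃ RepChoice r t where
  toFun e := e.1.2
  invFun ω := ⟨(w, ω), rfl⟩
  left_inv := by rintro ⟨⟨w, ω⟩, rfl⟩; rfl
  right_inv _ := rfl

/-- An answer is determined by its projection and its values at the t selected positions, with 32
possibilities each. -/
theorem card_le_mul_card_image_choiceProj (ω : RepChoice r t) (S : Finset (RepAnsR r)) :
    S.card ≤ 32 ^ t * (S.image (choiceProj ω)).card := by
  refine Finset.card_le_mul_card_image S _ fun l _ => ?_
  have hcard : (Finset.univ : Finset (Fin t → Fin 5 → ZMod 2)).card = 32 ^ t := by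
    simp [ZMod.card]
  rw [← hcard]
  refine Finset.card_le_card_of_injOn (fun a k => a (selected ω.1 k))
    (fun _ _ => Finset.mem_coe.2 (Finset.mem_univ _)) ?_
  intro a ha a' ha' haa
  funext p
  by_cases hp : p ∈ ω.1.1
  · have hmem : p ∈ Set.range (selected ω.1) := by
      rw [selected, Finset.range_orderEmbOfFin]
      exact hp
    obtain ⟨k, rfl⟩ := hmem
    exact congrFun haa k
  · exact eq_of_choiceProj_eq ((Finset.mem_filter.1 ha).2.trans (Finset.mem_filter.1 ha').2.symm) hp

theorem isSmooth_smoothRepetition (htr : t ≤ r) (hr : (32 ^ t) ^ 6 * t ≤ r) (Φ : MaxTSA) :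
    (Φ.smoothRepetition r t).IsSmooth (1 / 4) := by
  classical
  intro w S
  obtain ⟨A, rfl⟩ : ∃ A : Finset (RepAnsR r), S = A := ⟨S.toFinite.toFinset, by simp⟩
  refine (uniformProb_congr (Φ.edgesEquivChoice w)
    (Q := fun ω => ((choiceProj ω '' (A : Set (RepAnsR r))).ncard : ℝ) <
      ((A : Set (RepAnsR r)).ncard : ℝ) ^ (1 / 4 : ℝ)) fun e => Iff.rfl).trans_le ?_
  rw [uniformProb_eq_expect]
  simp only [← Finset.coe_image, Set.ncard_coe_finset]
  set N : ℝ := (A.card : ℝ) with hN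
  set M : ℝ := (32 : ℝ) ^ t with hM
  have hM1 : 1 ≤ M := one_le_pow₀ (by norm_num)
  rcases Nat.eq_zero_or_pos A.card with h0 | hpos
  · have hN0 : N = 0 := by rw [hN, h0, Nat.cast_zero]
    rw [hN0, Real.zero_rpow (by norm_num), div_zero]
    exact (Finset.expect_eq_zero fun ω _ => if_neg (not_lt.2 (Nat.cast_nonneg _))).le
  have hN1 : 1 ≤ N := by rw [hN]; exact_mod_cast hpos
  have hquarter : N ^ (1 / 4 : ℝ) ≤ N := by
    calc N ^ (1 / 4 : ℝ) ≤ N ^ (1 : ℝ) := Real.rpow_le_rpow_of_exponent_le hN1 (by norm_num)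
      _ = N := Real.rpow_one N
  have hq0 : 0 < N ^ (1 / 4 : ℝ) := Real.rpow_pos_of_pos (by linarith) _
  -- With N ≥ M², fibres of size at most M leave an image of at least √N ≥ N^(1/4) points. With N ≤
  -- M², non-injectivity has probability at most N²t/r, which is at most N^(−1/4) since N^(2+1/4)·t
  -- ≤ M⁶·t ≤ r.
  rcases le_total (M ^ 2) N with hbig | hsmall
  · refine le_trans (le_of_eq ?_) (by positivity)
    refine Finset.expect_eq_zero fun ω _ => if_neg (not_lt.2 ?_)
    have h1 : N ≤ M * ((A.image (choiceProj ω)).card : ℝ) := by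
      rw [hN, hM]
      exact_mod_cast card_le_mul_card_image_choiceProj ω A
    have h2 : N ^ (1 / 4 : ℝ) ≤ √N := by
      rw [Real.sqrt_eq_rpow]
      exact Real.rpow_le_rpow_of_exponent_le hN1 (by norm_num)
    have h3 : M ≤ √N := Real.le_sqrt_of_sq_le hbig
    have h4 : √N * √N = N := Real.mul_self_sqrt (by linarith)
    have h5 : M * √N ≤ N := by nlinarith [Real.sqrt_nonneg N]
    have h6 : √N ≤ ((A.image (choiceProj ω)).card : ℝ) :=
      le_of_mul_le_mul_left (h5.trans h1) (by linarith)
    exact h2.trans h6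
  · have h1 : (𝔼 ω : RepChoice r t, if ((A.image (choiceProj ω)).card : ℝ) < N ^ (1 / 4 : ℝ)
        then (1 : ℝ) else 0) ≤ N ^ 2 * (t / r) := by
      refine (expect_mono fun ω => ?_).trans (expect_not_injOn_le htr A)
      by_cases hinj : Set.InjOn (choiceProj ω) A
      · rw [Finset.card_image_of_injOn hinj, if_neg (not_lt.2 hquarter), if_pos hinj]
      · rw [if_neg hinj]
        split_ifs <;> norm_num
    refine h1.trans ?_
    rcases Nat.eq_zero_or_pos t with ht | ht
    · subst ht
      simp
      positivity
    have hr0 : (0 : ℝ) < r := by exact_mod_cast ht.trans_le htr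
    rw [le_div_iff₀ hq0, mul_div_assoc', div_mul_eq_mul_div, div_le_one hr0]
    have hr' : M ^ 6 * t ≤ r := by
      rw [hM]
      exact_mod_cast hr
    calc N ^ 2 * t * N ^ (1 / 4 : ℝ) ≤ (M ^ 2) ^ 2 * t * M ^ 2 := by
          gcongr
          exact hquarter.trans hsmall
      _ = M ^ 6 * t := by ring
      _ ≤ r := hr'

end MaxTSA

/-! ### Soundness -/

/-- The only use of d < 1/3: then d/2 < 1/6, so A is at most C^(1/6). -/
theorem pow_six_le_of_rpow_le {A C d : ℝ} (hA : 1 < A) (hC : 0 < C) (hd0 : 0 < d)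
    (hd : d < 1 / 3) (h : C ^ (-d / 2) ≤ 1 / A) : A ^ 6 ≤ C := by
  have h1 : A ≤ C ^ (d / 2) := by
    rw [neg_div, Real.rpow_neg hC.le, ← one_div] at h
    exact le_of_one_div_le_one_div (Real.rpow_pos_of_pos hC _) h
  have hC1 : 1 ≤ C := by
    by_contra hlt
    have := Real.rpow_le_one hC.le (not_le.1 hlt).le (by linarith : 0 ≤ d / 2)
    linarith
  have h2 : A ≤ C ^ (1 / 6 : ℝ) :=
    h1.trans (Real.rpow_le_rpow_of_exponent_le hC1 (by linarith))
  calc A ^ 6 ≤ (C ^ (1 / 6 : ℝ)) ^ 6 := by gcongr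
    _ = C := by
      rw [← Real.rpow_natCast, ← Real.rpow_mul hC.le]
      norm_num

/-- The parameters of the soundness analysis make the total error at most `δ`. -/
theorem soundness_error_le {n δ C d ρ s κ : ℝ} {m : ℕ} (hn : 2 ≤ n) (hδ : 0 < δ) (hδ1 : δ ≤ 1)
    (hC : 0 < C) (hd0 : 0 < d) (hd : d < 1 / 3) (h : C ^ (-d / 2) ≤ δ ^ 2 / (12 * n ^ 6))
    (hρ0 : 0 ≤ ρ) (hρ : ρ ≤ δ ^ 2 / (8 * n ^ (6 + C) * C ^ 2))
    (hs : s ≤ δ ^ 4 / (257 * n ^ (12 + 2 * C)) * C⁻¹) (hm : C ≤ m) (hm' : (m : ℝ) ≤ C + 1)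
    (hκ : κ ≤ 2 * ρ) :
    n ^ 2 * (C ^ 2 * ρ + √(κ + ((m : ℝ) ^ 2 * (2 * ρ) + √(3 * n ^ 2 / √m))) + √(C * s)) ≤ δ := by
  have hn0 : 0 < n := by linarith
  set A := 12 * n ^ 6 / δ ^ 2 with hA
  have hn2 : (64 : ℝ) ≤ n ^ 6 := by
    calc (64 : ℝ) = 2 ^ 6 := by norm_num
      _ ≤ n ^ 6 := by gcongr
  have hδ2 : δ ^ 2 ≤ 1 := pow_le_one₀ hδ.le hδ1
  have hA12 : 12 ≤ A := by
    rw [hA, le_div_iff₀ (by positivity)]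
    nlinarith
  have hAC : A ^ 6 ≤ C := by
    refine pow_six_le_of_rpow_le (by linarith) hC hd0 hd (h.trans_eq ?_)
    rw [hA, one_div_div]
  have hC12 : 12 ≤ C := by
    refine le_trans hA12 (le_trans ?_ hAC)
    exact le_self_pow₀ (by linarith) (by norm_num)
  set P := n ^ C with hP
  have hP32 : 32 ≤ P := by
    calc (32 : ℝ) = 2 ^ (5 : ℝ) := by norm_num
      _ ≤ n ^ (5 : ℝ) := Real.rpow_le_rpow (by norm_num) hn (by norm_num)
      _ ≤ n ^ C := Real.rpow_le_rpow_of_exponent_le (by linarith) (by linarith)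
  have hP1 : n ^ (6 + C) = n ^ 6 * P := by
    rw [Real.rpow_add hn0]
    norm_cast
  have hP2 : n ^ (12 + 2 * C) = (n ^ 6 * P) ^ 2 := by
    rw [← hP1, ← Real.rpow_natCast (n ^ (6 + C)), ← Real.rpow_mul hn0.le]
    congr 1
    push_cast
    ring
  rw [hP1] at hρ
  rw [hP2] at hs
  -- The bracket must be at most D. Its summands turn out to be at most D²/256, D/3 and D²/512.
  set D := δ / n ^ 2 with hD
  have hD0 : 0 < D := by positivity
  have hn4 : 1 ≤ n ^ 2 := one_le_pow₀ (by linarith)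
  have hD1 : D ≤ 1 := by
    rw [hD, div_le_one (by positivity)]
    linarith
  have hDP : δ ^ 2 / (n ^ 6 * P) ≤ D ^ 2 / 32 := by
    rw [hD, div_pow, div_div, div_le_div_iff_of_pos_left (by positivity) (by positivity)
      (by positivity)]
    have : n ^ 4 ≤ n ^ 6 := pow_le_pow_right₀ (by linarith) (by norm_num)
    calc (n ^ 2) ^ 2 * 32 = n ^ 4 * 32 := by ring
      _ ≤ n ^ 6 * P := by gcongr
  have hρ1 : C ^ 2 * ρ ≤ D ^ 2 / 256 := by
    calc C ^ 2 * ρ ≤ C ^ 2 * (δ ^ 2 / (8 * (n ^ 6 * P) * C ^ 2)) := by gcongr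
      _ = δ ^ 2 / (n ^ 6 * P) / 8 := by field_simp
      _ ≤ D ^ 2 / 32 / 8 := by gcongr
      _ = _ := by ring
  have hs1 : √(C * s) ≤ D ^ 2 / 512 := by
    have h1 : √(C * s) ≤ δ ^ 2 / (16 * (n ^ 6 * P)) := by
      refine Real.sqrt_le_iff.2 ⟨by positivity, ?_⟩
      calc C * s ≤ C * (δ ^ 4 / (257 * (n ^ 6 * P) ^ 2) * C⁻¹) := by gcongr
        _ = δ ^ 4 / (257 * (n ^ 6 * P) ^ 2) := by field_simp
        _ ≤ δ ^ 4 / (256 * (n ^ 6 * P) ^ 2) := by gcongr; norm_num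
        _ = _ := by rw [div_pow]; ring
    calc √(C * s) ≤ δ ^ 2 / (16 * (n ^ 6 * P)) := h1
      _ = δ ^ 2 / (n ^ 6 * P) / 16 := by field_simp
      _ ≤ D ^ 2 / 32 / 16 := by gcongr
      _ = _ := by ring
  have hm2 : (m : ℝ) ^ 2 * (2 * ρ) ≤ D ^ 2 / 32 := by
    have : (m : ℝ) ≤ 2 * C := by linarith
    calc (m : ℝ) ^ 2 * (2 * ρ) ≤ (2 * C) ^ 2 * (2 * ρ) := by gcongr
      _ = 8 * (C ^ 2 * ρ) := by ring
      _ ≤ 8 * (D ^ 2 / 256) := by gcongr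
      _ = _ := by ring
  have hκ1 : κ ≤ D ^ 2 / 128 := by
    have : ρ ≤ C ^ 2 * ρ := le_mul_of_one_le_left hρ0 (one_le_pow₀ (by linarith))
    linarith
  -- From m ≥ C ≥ A⁶ one has √m ≥ A³, and 3n²/A³ equals D⁴/576 times δ²/n⁸.
  have hη : √(3 * n ^ 2 / √m) ≤ D ^ 2 / 24 := by
    have hAm : A ^ 3 ≤ √m := by
      refine Real.le_sqrt_of_sq_le (le_trans ?_ (hAC.trans hm))
      rw [← pow_mul]
    refine Real.sqrt_le_iff.2 ⟨by positivity, ?_⟩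
    calc 3 * n ^ 2 / √m ≤ 3 * n ^ 2 / A ^ 3 := by gcongr
      _ = D ^ 4 / 576 * (δ ^ 2 / n ^ 8) := by
        rw [hA, hD]
        field_simp
        norm_num
      _ ≤ D ^ 4 / 576 * 1 := by
        gcongr
        rw [div_le_one (by positivity)]
        exact hδ2.trans (one_le_pow₀ (by linarith))
      _ = _ := by ring
  have hκ2 : √(κ + ((m : ℝ) ^ 2 * (2 * ρ) + √(3 * n ^ 2 / √m))) ≤ D / 3 := by
    refine Real.sqrt_le_iff.2 ⟨by positivity, ?_⟩
    -- 1/128 + 1/32 + 1/24 = 31/384 is less than 1/9.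
    nlinarith [sq_nonneg D]
  have hDD : D ^ 2 ≤ D := by nlinarith
  calc _ ≤ n ^ 2 * D := by
        gcongr
        linarith
    _ = δ := by
        rw [hD]
        field_simp

namespace MaxTSA

theorem exists_admissible (Φ : MaxTSA) {r t : ℕ} (w : Φ.RepW r) :
    ∃ d, (Φ.smoothRepetition r t).Admissible w d :=
  ⟨fun i j => if j = 0 then Φ.b (w i) else 0, fun i => by
    change tsa (fun j => if j = 0 then Φ.b (w i) else 0) = Φ.b (w i)
    simp [tsa]⟩

theorem noiselessTest_smoothRepetition_opt_le {G : Type*} [Group G] [Finite G] {δ C d : ℝ}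
    (hδ : 0 < δ) (hC : 0 < C) (hd0 : 0 < d) (hd : d < 1 / 3)
    (h : C ^ (-d / 2) ≤ δ ^ 2 / (12 * (Nat.card G : ℝ) ^ 6)) {r t : ℕ} (Φ : MaxTSA)
    (ht : 0 < t) (htr : t ≤ r)
    (hρ : (t : ℝ) / (r : ℝ) ≤ δ ^ 2 / (8 * (Nat.card G : ℝ) ^ (6 + C) * C ^ 2))
    (hs : (Φ.smoothRepetition r t).opt ≤
      δ ^ 4 / (257 * (Nat.card G : ℝ) ^ (12 + 2 * C)) * C⁻¹) :
    (noiselessTest G (Φ.smoothRepetition r t)).opt ≤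
      1 / (Nat.card (commutator G) : ℝ) + δ := by
  classical
  have := Fintype.ofFinite G
  have := Fintype.ofFinite (commutator G)
  have hK0 : 0 ≤ 1 / (Nat.card (commutator G) : ℝ) := by positivity
  -- For δ > 1, and for trivial G, the claimed bound is at least 1.
  rcases lt_or_ge 1 δ with hδ1 | hδ1
  · exact (MaxThreeLin.opt_le_one _).trans (by linarith)
  rcases Nat.lt_or_ge (Nat.card G) 2 with hG | hG
  · have hK : Nat.card (commutator G) = 1 := by
      have h1 : Nat.card (commutator G) ≤ Nat.card G := Subgroup.card_le_card_group _
      have h2 : 0 < Nat.card (commutator G) := Nat.card_pos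
      omega
    refine (MaxThreeLin.opt_le_one _).trans ?_
    rw [hK]
    simp [hδ.le]
  rw [Nat.card_eq_fintype_card] at hG h hρ hs
  have hn : (2 : ℝ) ≤ Fintype.card G := by exact_mod_cast hG
  have hk : 0 < r / t := Nat.div_pos htr ht
  have ht0 : (0 : ℝ) < t := by exact_mod_cast ht
  have hr0 : (0 : ℝ) < r := by exact_mod_cast ht.trans_le htr
  -- Natural-number division: ⌊r/t⌋ disjoint blocks fit, and ⌊r/t⌋ ≥ r/(2t) because t ≤ r.
  have hκ : 1 / ((r / t : ℕ) : ℝ) ≤ 2 * ((t : ℝ) / r) := by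
    have h1 : r ≤ 2 * (t * (r / t)) := by
      have h2 := Nat.div_add_mod r t
      have h3 := Nat.mod_lt r ht
      have h4 : t ≤ t * (r / t) := Nat.le_mul_of_pos_right t hk
      omega
    have h1' : (r : ℝ) ≤ 2 * (t * (r / t : ℕ)) := by exact_mod_cast h1
    rw [mul_div_assoc', div_le_div_iff₀ (by exact_mod_cast hk) hr0]
    linarith
  -- m = ⌈C⌉ points are used: every set with more than C elements contains that many.
  have herr := soundness_error_le hn hδ hδ1 hC hd0 hd h (by positivity) hρ hs
    (Nat.le_ceil C) (Nat.ceil_lt_add_one hC.le).le hκ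
  refine (noiselessTest_opt_le (Φ.smoothRepetition r t) Φ.exists_admissible
    fun f a b hf ha hb hfold => abs_expect_correlation_le (Φ.smoothRepetition r t)
      (π := choiceProj) (fun _ => rfl) (fun _ => rfl) hf ha hb hfold hC
      (κ₁ := C ^ 2 * (t / r)) (by positivity) (Real.sqrt_nonneg _) (fun S hS => ?_)
      fun w S hS => ?_).trans (add_le_add le_rfl herr)
  · refine (expect_not_injOn_le htr S).trans ?_
    gcongr
  · rw [← Real.sqrt_mul (meanSq_nonneg _), ← Real.sqrt_mul (by positivity)]
    refine Real.abs_le_sqrt ((sq_expect_correlation_component_le hk (Nat.div_mul_le_self r t)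
      (Nat.ceil_pos.2 hC) S (Nat.ceil_le.2 hS.le) (fun ω => hf _) (a w) (b w)).trans_eq ?_)
    ring

end MaxTSA

theorem mainTheorem4 {G : Type*} [Group G] [Finite G] :
    (∃ d₀ : ℝ, 0 < d₀ ∧ d₀ < 1 / 3 ∧
      ∀ t : ℕ, 1 < t → ∃ r₀ : ℕ, ∀ r : ℕ, r₀ ≤ r → t < r →
        ∀ Φ : MaxTSA, (Φ.smoothRepetition r t).IsSmooth d₀) ∧
    ∀ d₀ : ℝ, 0 < d₀ → d₀ < 1 / 3 →
      ∀ δ C : ℝ, 0 < δ → 0 < C →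
        C ^ (-d₀ / 2) ≤ δ ^ 2 / (12 * (Nat.card G : ℝ) ^ 6) →
      ∀ (r t : ℕ) (Φ : MaxTSA), 1 < t → t < r →
        (Φ.smoothRepetition r t).IsSmooth d₀ →
        (t : ℝ) / (r : ℝ) ≤ δ ^ 2 / (8 * (Nat.card G : ℝ) ^ (6 + C) * C ^ 2) →
        ((Φ.smoothRepetition r t).opt = 1 →
          (noiselessTest G (Φ.smoothRepetition r t)).opt = 1) ∧
        ((Φ.smoothRepetition r t).opt ≤
            δ ^ 4 / (257 * (Nat.card G : ℝ) ^ (12 + 2 * C)) * C⁻¹ →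
          (noiselessTest G (Φ.smoothRepetition r t)).opt ≤
            1 / (Nat.card (commutator G) : ℝ) + δ) := by
  refine ⟨⟨1 / 4, by norm_num, by norm_num, fun t _ => ⟨(32 ^ t) ^ 6 * t, fun r hr htr Φ =>
    MaxTSA.isSmooth_smoothRepetition htr.le hr Φ⟩⟩, ?_⟩
  intro d₀ hd0 hd δ C hδ hC h r t Φ ht htr _ hρ
  exact ⟨noiselessTest_opt_eq_one _, fun hs =>
    MaxTSA.noiselessTest_smoothRepetition_opt_le hδ hC hd0 hd h Φ (by omega) htr.le hρ hs⟩
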